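/- **Setting.** Let $G$ be a countable set, let $(S,d)$ be a metric space whose Borel $\sigma$-algebra is standard Borel, and let $\Phi=(\Phi_A)_{A\subset G\text{ finite}}$ be an interaction: each $\Phi_A:S^G\to\mathbb R$ is measurable and depends only on the coordinates in $A$. Assume $\sup_{i\in G}\sum_{A\ni i}|A|\,\|\Phi_A\|_\infty<\infty$. Put $H_\Lambda=\sum_{A\cap\Lambda\ne\emptyset}\Phi_A$ and $H_i=H_{\{i\}}$. For $F:S^G\to\mathbb R$ let $\delta(F)=\sup_{\omega,\omega'}|F(\omega)-F(\omega')|$, and let $\delta_j(F)$ be the same supremum over pairs $\omega,\omega'$ that agree off $j$. For a probability measure $\alpha$ on $S$, the Gibbs distributions of $\Phi$ with a priori measure $\alpha$ are $$\gamma_\Lambda(d\sigma_\Lambda\mid\bar\sigma)=Z_\Lambda(\bar\sigma)^{-1}\exp\bigl(-H_\Lambda(\sigma_\Lambda\bar\sigma_{\Lambda^c})\bigr)\prod_{i\in\Lambda}\alpha(d\sigma_i),\qquad \Lambda\subset G\text{ finite}.$$ A probability measure $\mu$ is a Gibbs measure for a family of finite-volume distributions $\gamma=(\gamma_\Lambda)$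 if $\int\mu(d\omega)\,\gamma_\Lambda(\cdot\mid\omega)=\mu$ for every finite $\Lambda$. Write $\|\nu_1-\nu_2\|=\sup_A|\nu_1(A)-\nu_2(A)|$ for probability measures, i.e. half of the $L^1$-distance of their densities. The Dobrushin interdependence matrix of a specification $\gamma$ has entries $C_{ij}(\gamma)=\sup\{\|\gamma_i(\cdot\mid\zeta)-\gamma_i(\cdot\mid\eta)\|:\zeta=\eta\text{ off }j\}$, where $\gamma_i(\cdot\mid\zeta)$ is the law of the spin at $i$. Let $T:S\to S'$ be a measurable map to a standard Borel space (finite, countable or uncountable), which decomposes $S$ into the cells $S_{s'}=T^{-1}(\{s'\})$, and let $\rho=\sup_{s'}\operatorname{diam}(S_{s'})$ (with $0\cdot\infty=0$ below). Also write $T$ for the map $S^G\to S'^G$ that acts sitewise. **Theorem.** Assume that there are constants $L_{ij}\in[0,\infty)$ such that, for all $i,j\in G$ and all $\sigma_i,a_i\in S$, $$\sup_{\zeta,\bar\zeta:\ \zeta_{j^c}=\bar\zeta_{j^c}}\Bigl|H_i(\sigma_i\zeta_{i^c})-H_i(\sigma_i\bar\zeta_{i^c})-\bigl(H_i(a_i\zeta_{i^c})-H_i(a_i\bar\zeta_{i^c})\bigr)\Bigr|\le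 L_{ij}\,d(\sigma_i,a_i),$$ and suppose that $$\frac\rho2\,\sup_{i\in G}\sum_{j\in G}\exp\Bigl(\tfrac12\sum_{A\supset\{i,j\}}\delta(\Phi_A)\Bigr)L_{ij}<1 .$$ Then for every probability measure $\alpha$ on $S$ there is a specification $\gamma'$ on $S'^G$ (a proper, consistent family of probability kernels $\gamma'_\Lambda(\cdot\mid\eta)$, $\Lambda\subset G$ finite, that depend measurably on $\eta$ and only on $\eta_{\Lambda^c}$) with the following properties. 0. $\gamma'$ is continuous in the conditioning: for every finite $\Lambda$ and $\varepsilon>0$ there is a finite $\Delta$ such that the laws in $\Lambda$ under $\gamma'_\Lambda(\cdot\mid\eta)$ and $\gamma'_\Lambda(\cdot\mid\bar\eta)$ differ by at most $\varepsilon$ in $\|\cdot\|$ whenever $\eta=\bar\eta$ on $\Delta$. Moreover $\gamma'$ is uniformly non-null: for every finite $\Lambda$ there is $c>0$ such that, for all $\eta$, the law $\gamma'_{\Lambda}(d\eta_\Lambda\mid\eta)$ in $\Lambda$ satisfies $c\,(T\alpha)^{\otimes\Lambda}\le\gamma'_\Lambda(d\eta_\Lambda\mid\eta)\le c^{-1}(T\alpha)^{\otimes\Lambda}$,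 where $T\alpha$ is the image of $\alpha$. 1. For every Gibbs measure $\mu$ for $\Phi$ with a priori measure $\alpha$, the image $T(\mu)$ is a Gibbs measure for $\gamma'$. 2. For all $i,j\in G$, $C_{ij}(\gamma')\le Q_{ij}$, where $$Q_{ij}=4\,e^{2\sum_{A\ni i}\|\Phi_A\|_\infty}\Bigl(\sum_{k\in G\setminus\{i\}}\delta_k\Bigl(\sum_{A\supset\{i,k\}}\Phi_A\Bigr)\bar D_{kj}\Bigr)e^{\sum_{A\ni j}\delta_j(\Phi_A)},\qquad \bar D=\sum_{n\ge0}\bar C^n,$$ $$\bar C_{ij}=\frac\rho2\exp\Bigl(\tfrac12\sum_{A\supset\{i,j\}}\delta(\Phi_A)\Bigr)L_{ij}.$$ -/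

import Mathlib

open MeasureTheory
open scoped ENNReal NNReal

namespace Fuzzy

noncomputable section

/-! ### Oscillations, total variation, infinite matrices -/

/-- The supremum norm of a real function, as an extended nonnegative real. -/
def supNorm {X : Type*} (F : X → ℝ) : ℝ≥0∞ := ⨆ x, ‖F x‖ₑ

/-- The oscillation `δ(F) = sup |F(ω) - F(ω')|`. -/
def osc {X : Type*} (F : X → ℝ) : ℝ≥0∞ := ⨆ (ω : X) (ω' : X), edist (F ω) (F ω')

/-- The oscillation `δ_j(F)` at the site `j`: supremum of `|F(ω) - F(ω')|` over all pairs of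
configurations that agree off `j`. -/
def oscAt {G S : Type*} (j : G) (F : (G → S) → ℝ) : ℝ≥0∞ :=
  ⨆ (ω : G → S) (ω' : G → S) (_ : ∀ k, k ≠ j → ω k = ω' k), edist (F ω) (F ω')

/-- The total variation distance `sup_A |μ(A) - ν(A)|` of two probability measures, which is one
half of the `L¹` distance of their densities with respect to a common dominating measure. -/
def tvDist {X : Type*} [MeasurableSpace X] (μ ν : Measure X) : ℝ≥0∞ :=
  ⨆ (A : Set X) (_ : MeasurableSet A), ENNReal.ofReal |μ.real A - ν.real A|

/-- The exponential of an extended nonnegative real. -/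
def expE (x : ℝ≥0∞) : ℝ≥0∞ := EReal.exp (x : EReal)

/-- Powers of a matrix with nonnegative entries indexed by a possibly infinite set. -/
def matPow {G : Type*} [DecidableEq G] (C : G → G → ℝ≥0∞) : ℕ → G → G → ℝ≥0∞
  | 0 => fun i j => if i = j then 1 else 0
  | n + 1 => fun i j => ∑' k, C i k * matPow C n k j

/-- The matrix `∑_{n ≥ 0} Cⁿ`. -/
def neumann {G : Type*} [DecidableEq G] (C : G → G → ℝ≥0∞) (i j : G) : ℝ≥0∞ :=
  ∑' n, matPow C n i j

/-! ### Specifications and Gibbs measures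

A family of finite-volume distributions assigns to each finite `Λ ⊆ G` and each boundary condition
`ω` a measure `γ Λ ω` on the configuration space `G → E`. -/

/-- Specifications: measurable families of probability measures `γ Λ ω` which depend on `ω` only
through its restriction to the complement of `Λ`, are proper (under `γ Λ ω` the configuration
agrees with `ω` off `Λ`), and are consistent: `γ Λ' γ Λ = γ Λ'` for `Λ ⊆ Λ'`. -/
structure IsSpecification {G E : Type*} [MeasurableSpace E]
    (γ : Finset G → (G → E) → Measure (G → E)) : Prop where
  measurable : ∀ Λ, Measurable (γ Λ)
  isProbabilityMeasure : ∀ Λ ω, IsProbabilityMeasure (γ Λ ω)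
  congr_of_eq_off : ∀ Λ ω ω', (∀ i, i ∉ Λ → ω i = ω' i) → γ Λ ω = γ Λ ω'
  proper : ∀ Λ ω, ∀ᵐ σ ∂(γ Λ ω), ∀ i, i ∉ Λ → σ i = ω i
  consistent : ∀ Λ Λ', Λ ⊆ Λ' → ∀ ω, (γ Λ' ω).bind (γ Λ) = γ Λ' ω

/-- Continuity in the conditioning: for every finite `Λ`, the law in `Λ` under `γ Λ ω` changes
arbitrarily little in total variation, uniformly in `ω`, when `ω` is changed far away. -/
def IsQuasilocal {G E : Type*} [MeasurableSpace E]
    (γ : Finset G → (G → E) → Measure (G → E)) : Prop :=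
  ∀ (Λ : Finset G) (ε : ℝ≥0∞), 0 < ε → ∃ Δ : Finset G, ∀ ω ω' : G → E,
    (∀ i ∈ Δ, ω i = ω' i) → tvDist ((γ Λ ω).map Λ.restrict) ((γ Λ ω').map Λ.restrict) ≤ ε

/-- Uniform non-nullness with respect to the single-site measure `β`: for every finite `Λ`, the law
in `Λ` under `γ Λ ω` is comparable with the product measure `β^Λ`, uniformly in `ω`. -/
def IsUniformlyNonnull {G E : Type*} [MeasurableSpace E]
    (γ : Finset G → (G → E) → Measure (G → E)) (β : Measure E) : Prop :=
  ∀ Λ : Finset G, ∃ c : ℝ≥0, 0 < c ∧ ∀ ω : G → E,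
    c • Measure.pi (fun _ : Λ => β) ≤ (γ Λ ω).map Λ.restrict ∧
      c • (γ Λ ω).map Λ.restrict ≤ Measure.pi (fun _ : Λ => β)

/-- `μ` is a Gibbs measure for `γ`: a probability measure that satisfies the
Dobrushin-Lanford-Ruelle equations `∫ γ Λ ω μ(dω) = μ` for all finite `Λ`. -/
structure IsGibbsMeasure {G E : Type*} [MeasurableSpace E]
    (γ : Finset G → (G → E) → Measure (G → E)) (μ : Measure (G → E)) : Prop where
  isProbabilityMeasure : IsProbabilityMeasure μ
  dlr : ∀ Λ, μ.bind (γ Λ) = μ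

/-- The entry `C_{ij}` of the Dobrushin interdependence matrix of `γ`: the largest total variation
distance of the laws of the spin at `i` under `γ {i} ζ` and `γ {i} η`, for `ζ`, `η` agreeing off
`j`. -/
def dobrushinMatrix {G E : Type*} [MeasurableSpace E]
    (γ : Finset G → (G → E) → Measure (G → E)) (i j : G) : ℝ≥0∞ :=
  ⨆ (ζ : G → E) (η : G → E) (_ : ∀ k, k ≠ j → ζ k = η k),
    tvDist ((γ {i} ζ).map (fun σ => σ i)) ((γ {i} η).map (fun σ => σ i))

/-! ### Interactions and their Gibbs specifications -/

/-- Interaction potentials: `Φ A` is a measurable function of the spins in the finite set `A`. -/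
structure IsInteraction {G S : Type*} [MeasurableSpace S]
    (Φ : Finset G → (G → S) → ℝ) : Prop where
  measurable : ∀ A, Measurable (Φ A)
  dependsOn : ∀ A, DependsOn (Φ A) (A : Set G)

/-- The norm `|||Φ||| = sup_i ∑_{A ∋ i} |A| ‖Φ_A‖_∞`. -/
def tripleNorm {G S : Type*} (Φ : Finset G → (G → S) → ℝ) : ℝ≥0∞ :=
  ⨆ i : G, ∑' A : {A : Finset G // i ∈ A}, ((A : Finset G).card : ℝ≥0∞) * supNorm (Φ A)

/-- The Hamiltonian `H_Λ = ∑_{A ∩ Λ ≠ ∅} Φ_A`. -/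
def hamiltonian {G S : Type*} (Φ : Finset G → (G → S) → ℝ) (Λ : Finset G) (σ : G → S) : ℝ :=
  ∑' A : {A : Finset G // ∃ i ∈ A, i ∈ Λ}, Φ A σ

/-- The part `∑_{A ⊇ {i,j}} Φ_A` of the Hamiltonian. -/
def pairHamiltonian {G S : Type*} (Φ : Finset G → (G → S) → ℝ) (i j : G) (σ : G → S) : ℝ :=
  ∑' A : {A : Finset G // i ∈ A ∧ j ∈ A}, Φ A σ

/-- The configuration that is `σ` in `Λ` and `ω` off `Λ`. -/
def glue {G S : Type*} [DecidableEq G] (Λ : Finset G) (ω : G → S) (σ : Λ → S) : G → S :=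
  fun i => if h : i ∈ Λ then σ ⟨i, h⟩ else ω i

/-- The finite-volume Gibbs distributions of `Φ` with a priori measure `α`:
`exp(-H_Λ(σ_Λ ω_{Λᶜ})) ∏_{i ∈ Λ} α(dσ_i) / Z_Λ(ω)`, as measures on the full configuration space
with the spins off `Λ` frozen to `ω`. -/
def gibbsSpecification {G S : Type*} [DecidableEq G] [MeasurableSpace S]
    (Φ : Finset G → (G → S) → ℝ) (α : Measure S) (Λ : Finset G) (ω : G → S) : Measure (G → S) :=
  ((Measure.pi (fun _ : Λ => α)).map (glue Λ ω)).tilted (fun σ => -hamiltonian Φ Λ σ)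

/-! ### Quantities in the theorem -/

/-- The Hamiltonian has `j`-variations at `i` that are Lipschitz in the spin at `i` with constant
`L i j`, for all sites `i`, `j`. -/
def HasLipschitzVariations {G S : Type*} [DecidableEq G] [PseudoMetricSpace S]
    (Φ : Finset G → (G → S) → ℝ) (L : G → G → ℝ≥0) : Prop :=
  ∀ (i j : G) (ζ ζ' : G → S), (∀ k, k ≠ j → ζ k = ζ' k) → ∀ s a : S,
    |hamiltonian Φ {i} (Function.update ζ i s) - hamiltonian Φ {i} (Function.update ζ' i s)
      - (hamiltonian Φ {i} (Function.update ζ i a) - hamiltonian Φ {i} (Function.update ζ' i a))|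
      ≤ L i j * dist s a

/-- The fineness `ρ` of the decomposition of `S` into the cells `T ⁻¹' {s'}`: the supremum of their
diameters. -/
def fineness {S S' : Type*} [PseudoEMetricSpace S] (T : S → S') : ℝ≥0∞ :=
  ⨆ s' : S', Metric.ediam (T ⁻¹' {s'})

/-- The factor `exp(½ ∑_{A ⊇ {i,j}} δ(Φ_A))`. -/
def pairFactor {G S : Type*} (Φ : Finset G → (G → S) → ℝ) (i j : G) : ℝ≥0∞ :=
  expE ((∑' A : {A : Finset G // i ∈ A ∧ j ∈ A}, osc (Φ A)) / 2)

/-- The matrix `C̄_{ij} = (ρ/2) exp(½ ∑_{A ⊇ {i,j}} δ(Φ_A)) L_{ij}`. -/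
def cBar {G S : Type*} (Φ : Finset G → (G → S) → ℝ) (ρ : ℝ≥0∞) (L : G → G → ℝ≥0) (i j : G) :
    ℝ≥0∞ :=
  ρ / 2 * pairFactor Φ i j * L i j

/-- The matrix
`Q_{ij} = 4 exp(2 ∑_{A ∋ i} ‖Φ_A‖_∞) (∑_{k ≠ i} δ_k(∑_{A ⊇ {i,k}} Φ_A) D̄_{kj}) exp(∑_{A ∋ j} δ_j(Φ_A))`
with `D̄ = ∑_n C̄ⁿ`. -/
def qMatrix {G S : Type*} [DecidableEq G] (Φ : Finset G → (G → S) → ℝ) (C : G → G → ℝ≥0∞)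
    (i j : G) : ℝ≥0∞ :=
  4 * expE (2 * ∑' A : {A : Finset G // i ∈ A}, supNorm (Φ A))
    * (∑' k : {k : G // k ≠ i}, oscAt (k : G) (pairHamiltonian Φ i k) * neumann C k j)
    * expE (∑' A : {A : Finset G // j ∈ A}, oscAt j (Φ A))

end

end Fuzzy

/-! Disintegrate `α` along `T` by a kernel `K` such that every `K s'` is carried by a set of
diameter at most `ρ`. Fixing an image configuration `η` and integrating `exp(-H_Δ)` against the
product of the `K (η i)` gives the partition function Z_Δ^ω(η) (`constrainedPartition`). Up to
normalization it is the density of the image of the Gibbs distribution in Δ with respect to the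
product of copies of `Tα`. The conditional density in Λ of this image is therefore Z_Δ^ω divided by
its integral over the spins in Λ, and everything depends on the ratios Z_Δ^ω(η)/Z_Δ^ω(η') for η = η'
off Λ, as Δ grows.

Fineness of the cells puts the constrained model in the Dobrushin regime, uniformly in η. A
constrained spin moves in a set of diameter at most ρ, so by the Lipschitz hypothesis the change of
a spin at j alters the energy at i by a function of oscillation at most ρ L_ij. Tilting by such a
function costs at most half of that in total variation (`abs_integral_tilted_sub_le`), hence the
interdependence matrix is bounded by C̄, whose row sums are bounded by some c < 1, and
`dobrushin_comparison` applies. A ratio of partition functions is the expectation of a Boltzmann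
factor under a constrained Gibbs measure (`lmarginal_boltzmann_eq_ratio_mul`), and this factor has
summable site oscillations. The comparison theorem then bounds its response to a change of the
far-away boundary spins (`ofReal_abs_partitionRatio_sub_le_of_boundary`) and to a change of one
image spin (`ofReal_abs_partitionRatio_sub_le_of_site`).

The first bound makes the finite-volume conditional densities converge to `limDensity`, up to
factors close to 1 and uniformly in the boundary condition and in η
(`IsPartitionSystem.exists_limDensity_le`). Uniformity transfers the finite-volume facts to the
limit: the chain rule gives consistency (`isSpecification_imageSpec`), locality gives continuity,
two-sided bounds give non-nullness, and the DLR equations in Δ give those of the image measure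
(`isGibbsMeasure_imageSpec`). The second bound gives the estimate of the interdependence matrix
(`dobrushinMatrix_imageSpec_le`), with some room: of the exponential factors in C̄ and of the last
factor in Q only the bound ≥ 1 is used. -/

namespace Fuzzy

/-! ### Energies, and the bounds that follow from summability of the interaction. -/

section Energy

variable {G S : Type*} {Φ : Finset G → (G → S) → ℝ}

/-- The sum of the terms of an interaction over the sets that satisfy `P`. -/
noncomputable def energy (Φ : Finset G → (G → S) → ℝ) (P : Finset G → Prop) (σ : G → S) : ℝ :=
  ∑' A : {A : Finset G // P A}, Φ A σ

/-- The sum of the norms of the terms of an interaction over the sets that satisfy `P`. -/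
noncomputable def normSum (Φ : Finset G → (G → S) → ℝ) (P : Finset G → Prop) : ℝ≥0∞ :=
  ∑' A : {A : Finset G // P A}, supNorm (Φ A)

/-- The finite set `A` meets `Λ`. -/
def Meets (Λ : Finset G) (A : Finset G) : Prop := ∃ i ∈ A, i ∈ Λ

lemma meets_singleton {i : G} {A : Finset G} : Meets {i} A ↔ i ∈ A := by
  simp [Meets]

lemma enorm_le_supNorm {X : Type*} (F : X → ℝ) (x : X) : ‖F x‖ₑ ≤ supNorm F :=
  le_iSup (fun x => ‖F x‖ₑ) x

lemma tsum_subtype_eq_indicator {α M : Type*} [AddCommMonoid M] [TopologicalSpace M] (P : α → Prop)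
    (f : α → M) : ∑' a : {a // P a}, f a = ∑' a, {a | P a}.indicator f a :=
  tsum_subtype {a | P a} f

lemma normSum_eq (P : Finset G → Prop) :
    normSum Φ P = ∑' A, {A | P A}.indicator (fun A => supNorm (Φ A)) A :=
  tsum_subtype_eq_indicator P (fun A => supNorm (Φ A))

lemma normSum_mono {P Q : Finset G → Prop} (h : ∀ A, P A → Q A) : normSum Φ P ≤ normSum Φ Q := by
  classical
  rw [normSum_eq, normSum_eq]
  refine ENNReal.tsum_le_tsum fun A => ?_
  by_cases hA : P A
  · simp [hA, h A hA]
  · simp [hA]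

lemma normSum_mem_le_tripleNorm (i : G) : normSum Φ (fun A => i ∈ A) ≤ tripleNorm Φ := by
  refine le_trans ?_ (le_iSup _ i)
  refine ENNReal.tsum_le_tsum fun A => ?_
  have : (1 : ℝ≥0∞) ≤ ((A : Finset G).card : ℝ≥0∞) := by
    exact_mod_cast Finset.card_pos.mpr ⟨i, A.2⟩
  calc supNorm (Φ A) = 1 * supNorm (Φ A) := (one_mul _).symm
    _ ≤ _ := by gcongr

lemma normSum_meets_le (Λ : Finset G) :
    normSum Φ (Meets Λ) ≤ ∑ i ∈ Λ, normSum Φ (fun A => i ∈ A) := by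
  classical
  simp_rw [normSum_eq]
  rw [← Summable.tsum_finsetSum (fun _ _ => ENNReal.summable)]
  refine ENNReal.tsum_le_tsum fun A => ?_
  by_cases hA : Meets Λ A
  · obtain ⟨i, hi, hiΛ⟩ := id hA
    rw [Set.indicator_of_mem (show A ∈ {A | Meets Λ A} from hA)]
    calc supNorm (Φ A) = {A | i ∈ A}.indicator (fun A => supNorm (Φ A)) A := by simp [hi]
      _ ≤ _ := Finset.single_le_sum
        (f := fun i => {A : Finset G | i ∈ A}.indicator (fun A => supNorm (Φ A)) A)
        (fun _ _ => zero_le) hiΛ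
  · simp [hA]

lemma normSum_meets_lt_top (h : tripleNorm Φ < ∞) (Λ : Finset G) : normSum Φ (Meets Λ) < ∞ :=
  (normSum_meets_le Λ).trans_lt <| ENNReal.sum_lt_top.mpr fun i _ =>
    (normSum_mem_le_tripleNorm i).trans_lt h

lemma normSum_mem_lt_top (h : tripleNorm Φ < ∞) (i : G) : normSum Φ (fun A => i ∈ A) < ∞ :=
  (normSum_mem_le_tripleNorm i).trans_lt h

/-- After exchanging the sums, a set `A` that meets `Λ` is counted once for each of its points. This
is what the weight `|A|` in `tripleNorm` pays for. -/
lemma sum_normSum_meets_and_mem_lt_top (h : tripleNorm Φ < ∞) (Λ : Finset G) :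
    ∑' k, normSum Φ (fun A => Meets Λ A ∧ k ∈ A) < ∞ := by
  have key : ∑' k, normSum Φ (fun A => Meets Λ A ∧ k ∈ A) ≤ ∑ i ∈ Λ, tripleNorm Φ := by
    simp_rw [normSum_eq]
    rw [ENNReal.tsum_comm]
    let f : Finset G → ℝ≥0∞ := fun A => (A.card : ℝ≥0∞) * supNorm (Φ A)
    calc ∑' A, ∑' k, {A | Meets Λ A ∧ k ∈ A}.indicator (fun A => supNorm (Φ A)) A
        ≤ ∑' A, ∑ i ∈ Λ, {A : Finset G | i ∈ A}.indicator f A := by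
          refine ENNReal.tsum_le_tsum fun A => ?_
          by_cases hA : Meets Λ A
          · obtain ⟨i, hi, hiΛ⟩ := id hA
            calc ∑' k, {A | Meets Λ A ∧ k ∈ A}.indicator (fun A => supNorm (Φ A)) A
                = ∑ k ∈ A, supNorm (Φ A) := by
                  rw [tsum_eq_sum (s := A) (by intro k hk; simp [hk])]
                  exact Finset.sum_congr rfl fun k hk => by simp [hA, hk]
              _ = {A : Finset G | i ∈ A}.indicator f A := by simp [hi, f]
              _ ≤ _ := Finset.single_le_sum
                (f := fun i => {A : Finset G | i ∈ A}.indicator f A) (fun _ _ => zero_le) hiΛ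
          · simp [hA]
      _ = ∑ i ∈ Λ, ∑' A : Finset G, {A : Finset G | i ∈ A}.indicator f A :=
          Summable.tsum_finsetSum fun _ _ => ENNReal.summable
      _ ≤ ∑ i ∈ Λ, tripleNorm Φ := by
          refine Finset.sum_le_sum fun i _ => le_trans (le_of_eq ?_) (le_iSup _ i)
          exact (tsum_subtype_eq_indicator (fun A => i ∈ A) f).symm
  exact key.trans_lt (ENNReal.sum_lt_top.mpr fun _ _ => h)

variable {P Q : Finset G → Prop}

lemma summable_norm_of_normSum (h : normSum Φ P < ∞) (σ : G → S) :
    Summable fun A : {A : Finset G // P A} => ‖Φ A σ‖ := by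
  have h1 : ∑' A : {A : Finset G // P A}, ‖Φ A σ‖ₑ ≠ ∞ :=
    (lt_of_le_of_lt (ENNReal.tsum_le_tsum fun A : {A : Finset G // P A} =>
      enorm_le_supNorm (Φ A) σ) h).ne
  have := ENNReal.summable_toReal h1
  simpa using this

lemma summable_of_normSum (h : normSum Φ P < ∞) (σ : G → S) :
    Summable fun A : {A : Finset G // P A} => Φ A σ :=
  (summable_norm_of_normSum h σ).of_norm

lemma abs_energy_le (h : normSum Φ P < ∞) (σ : G → S) : |energy Φ P σ| ≤ (normSum Φ P).toReal := by
  have hs := summable_norm_of_normSum h σ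
  have h1 : |energy Φ P σ| ≤ ∑' A : {A : Finset G // P A}, ‖Φ A σ‖ := norm_tsum_le_tsum_norm hs
  refine h1.trans ?_
  have h2 : ∀ A : {A : Finset G // P A}, supNorm (Φ A) ≠ ∞ := fun A =>
    ((ENNReal.le_tsum A).trans_lt h).ne
  rw [normSum, ENNReal.tsum_toReal_eq h2]
  refine hs.tsum_le_tsum (fun A => ?_) (ENNReal.summable_toReal h.ne)
  have := ENNReal.toReal_mono (h2 A) (enorm_le_supNorm (Φ A) σ)
  simpa using this

/-- Differences of energies only involve the terms that change. -/
lemma energy_sub_energy (hP : normSum Φ P < ∞) (hQ : ∀ A, Q A → P A) {σ τ : G → S}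
    (h : ∀ A, P A → ¬ Q A → Φ A σ = Φ A τ) :
    energy Φ P σ - energy Φ P τ = energy Φ Q σ - energy Φ Q τ := by
  have hQ' : normSum Φ Q < ∞ := (normSum_mono hQ).trans_lt hP
  simp only [energy]
  rw [← (summable_of_normSum hP σ).tsum_sub (summable_of_normSum hP τ),
    ← (summable_of_normSum hQ' σ).tsum_sub (summable_of_normSum hQ' τ),
    tsum_subtype_eq_indicator P (fun A => Φ A σ - Φ A τ),
    tsum_subtype_eq_indicator Q (fun A => Φ A σ - Φ A τ)]
  refine tsum_congr fun A => ?_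
  by_cases h1 : Q A
  · simp [Set.indicator, h1, hQ A h1]
  · by_cases h2 : P A
    · simp [Set.indicator, h1, h A h2 h1]
    · simp [Set.indicator, h1, h2]

lemma abs_energy_sub_le (hP : normSum Φ P < ∞) (hQ : ∀ A, Q A → P A) {σ τ : G → S}
    (h : ∀ A, P A → ¬ Q A → Φ A σ = Φ A τ) :
    |energy Φ P σ - energy Φ P τ| ≤ 2 * (normSum Φ Q).toReal := by
  have hQ' : normSum Φ Q < ∞ := (normSum_mono hQ).trans_lt hP
  rw [energy_sub_energy hP hQ h]
  have h1 := abs_energy_le hQ' σ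
  have h2 := abs_energy_le hQ' τ
  rw [abs_le] at *
  constructor <;> linarith

lemma measurable_energy [Countable G] [MeasurableSpace S] (hΦ : IsInteraction Φ)
    (P : Finset G → Prop) : Measurable (energy Φ P) :=
  Measurable.tsum fun A => hΦ.measurable A

lemma IsInteraction.congr [MeasurableSpace S] (hΦ : IsInteraction Φ) {A : Finset G} {σ τ : G → S}
    (h : ∀ i ∈ A, σ i = τ i) : Φ A σ = Φ A τ :=
  hΦ.dependsOn A fun i hi => h i hi

/-- Terms that do not meet `Λ` see the same spins in both configurations and cancel. Energy
differences in a large volume thereby obey bounds that do not depend on the volume. -/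
lemma hamiltonian_sub_of_subset [MeasurableSpace S] (hΦ : IsInteraction Φ) (h : tripleNorm Φ < ∞)
    {Λ Δ : Finset G} (hΛΔ : Λ ⊆ Δ) {σ τ : G → S} (hστ : ∀ i, i ∉ Λ → σ i = τ i) :
    hamiltonian Φ Δ σ - hamiltonian Φ Δ τ = hamiltonian Φ Λ σ - hamiltonian Φ Λ τ :=
  energy_sub_energy (normSum_meets_lt_top h Δ) (fun _ ⟨i, hi, hi'⟩ => ⟨i, hi, hΛΔ hi'⟩)
    fun _ _ hA => hΦ.congr fun i hi => hστ i fun hi' => hA ⟨i, hi, hi'⟩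

lemma hamiltonian_singleton_sub [MeasurableSpace S] (hΦ : IsInteraction Φ) (h : tripleNorm Φ < ∞)
    {i k : G} {σ τ : G → S} (hστ : ∀ j, j ≠ k → σ j = τ j) :
    hamiltonian Φ {i} σ - hamiltonian Φ {i} τ = pairHamiltonian Φ i k σ - pairHamiltonian Φ i k τ :=
  energy_sub_energy (normSum_meets_lt_top h {i}) (fun _ ⟨hi, _⟩ => meets_singleton.mpr hi)
    fun _ hA hA' => hΦ.congr fun j hj => hστ j fun hjk =>
      hA' ⟨meets_singleton.mp hA, hjk ▸ hj⟩

lemma abs_hamiltonian_sub_le_of_eq_off [MeasurableSpace S] (hΦ : IsInteraction Φ)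
    (h : tripleNorm Φ < ∞) {Λ : Finset G} {k : G} {σ τ : G → S} (hστ : ∀ j, j ≠ k → σ j = τ j) :
    |hamiltonian Φ Λ σ - hamiltonian Φ Λ τ|
      ≤ 2 * (normSum Φ (fun A => Meets Λ A ∧ k ∈ A)).toReal :=
  abs_energy_sub_le (normSum_meets_lt_top h Λ) (fun _ hA => hA.1)
    fun _ hA hA' => hΦ.congr fun j hj => hστ j fun hjk => hA' ⟨hA, hjk ▸ hj⟩

lemma abs_hamiltonian_sub_le_of_eq_on [MeasurableSpace S] (hΦ : IsInteraction Φ)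
    (h : tripleNorm Φ < ∞) {Λ Δ : Finset G} {σ τ : G → S} (hστ : ∀ j ∈ Δ, σ j = τ j) :
    |hamiltonian Φ Λ σ - hamiltonian Φ Λ τ|
      ≤ 2 * (normSum Φ (fun A => Meets Λ A ∧ ¬ A ⊆ Δ)).toReal :=
  abs_energy_sub_le (normSum_meets_lt_top h Λ) (fun _ hA => hA.1)
    fun _ hA hA' => hΦ.congr fun j hj => hστ j (by
      by_contra hj'
      exact hA' ⟨hA, fun hs => hj' (hs hj)⟩)

lemma abs_hamiltonian_le (h : tripleNorm Φ < ∞) (Λ : Finset G) (σ : G → S) :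
    |hamiltonian Φ Λ σ| ≤ (normSum Φ (Meets Λ)).toReal :=
  abs_energy_le (normSum_meets_lt_top h Λ) σ

lemma measurable_hamiltonian [Countable G] [MeasurableSpace S] (hΦ : IsInteraction Φ)
    (Λ : Finset G) : Measurable (hamiltonian Φ Λ) :=
  measurable_energy hΦ _

end Energy
end Fuzzy

namespace Fuzzy

/-! ### Total variation estimate for tilted probability measures. -/

section Tilting

/-- Bounded measurable real functions. -/
def BddMeasurable {X : Type*} [MeasurableSpace X] (f : X → ℝ) : Prop :=
  Measurable f ∧ ∃ M, ∀ x, |f x| ≤ M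

variable {X Y : Type*} [MeasurableSpace X] [MeasurableSpace Y]

lemma BddMeasurable.integrable {f : X → ℝ} (hf : BddMeasurable f) (μ : Measure X)
    [IsFiniteMeasure μ] : Integrable f μ := by
  obtain ⟨hm, M, hM⟩ := hf
  exact Integrable.of_bound hm.aestronglyMeasurable M (.of_forall hM)

lemma BddMeasurable.comp {f : Y → ℝ} (hf : BddMeasurable f) {g : X → Y} (hg : Measurable g) :
    BddMeasurable fun x => f (g x) :=
  ⟨hf.1.comp hg, hf.2.imp fun _ hM x => hM (g x)⟩

lemma BddMeasurable.mul {f g : X → ℝ} (hf : BddMeasurable f) (hg : BddMeasurable g) :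
    BddMeasurable fun x => f x * g x := by
  obtain ⟨hfm, M, hM⟩ := hf
  obtain ⟨hgm, N, hN⟩ := hg
  refine ⟨hfm.mul hgm, M * N, fun x => ?_⟩
  rw [abs_mul]
  exact mul_le_mul (hM x) (hN x) (abs_nonneg _) ((abs_nonneg _).trans (hM x))

lemma BddMeasurable.sub {f g : X → ℝ} (hf : BddMeasurable f) (hg : BddMeasurable g) :
    BddMeasurable fun x => f x - g x := by
  obtain ⟨hfm, M, hM⟩ := hf
  obtain ⟨hgm, N, hN⟩ := hg
  exact ⟨hfm.sub hgm, M + N, fun x => (abs_sub _ _).trans (add_le_add (hM x) (hN x))⟩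

lemma BddMeasurable.exp_neg {f : X → ℝ} (hf : BddMeasurable f) :
    BddMeasurable fun x => Real.exp (-f x) := by
  obtain ⟨hfm, M, hM⟩ := hf
  refine ⟨hfm.neg.exp, Real.exp M, fun x => ?_⟩
  rw [abs_of_pos (Real.exp_pos _)]
  exact Real.exp_le_exp.mpr ((neg_le_abs _).trans (hM x))

lemma integral_exp_neg_pos {U : X → ℝ} (hU : BddMeasurable U) (μ : Measure X)
    [IsProbabilityMeasure μ] : 0 < ∫ x, Real.exp (-U x) ∂μ :=
  integral_exp_pos (hU.exp_neg.integrable μ)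

lemma integral_tilted_neg (μ : Measure X) (U f : X → ℝ) :
    ∫ x, f x ∂μ.tilted (fun x => -U x)
      = (∫ x, Real.exp (-U x) * f x ∂μ) / ∫ x, Real.exp (-U x) ∂μ := by
  rw [integral_tilted, ← integral_div]
  congr with x
  rw [smul_eq_mul]
  ring

lemma isProbabilityMeasure_tilted_neg {U : X → ℝ} (hU : BddMeasurable U) (μ : Measure X)
    [IsProbabilityMeasure μ] : IsProbabilityMeasure (μ.tilted fun x => -U x) :=
  isProbabilityMeasure_tilted (hU.exp_neg.integrable μ)

lemma abs_integral_le_of_forall {μ : Measure X} [IsProbabilityMeasure μ] {f : X → ℝ} {C : ℝ}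
    (h : ∀ x, |f x| ≤ C) : |∫ x, f x ∂μ| ≤ C := by
  simpa using norm_integral_le_of_norm_le_const (μ := μ) (f := f) (.of_forall h)

/-- Equivalent to tanh(t/2) ≤ t/2. The derivative of `(t - 2) eᵗ + t + 2` is `(t - 1) eᵗ + 1`, which
is nonnegative because `1 - t ≤ e⁻ᵗ`. -/
lemma exp_sub_one_le {t : ℝ} (ht : 0 ≤ t) : Real.exp t - 1 ≤ t / 2 * (Real.exp t + 1) := by
  have hmono : MonotoneOn (fun t : ℝ => (t - 2) * Real.exp t + t + 2) (Set.Ici 0) := by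
    refine monotoneOn_of_deriv_nonneg (convex_Ici 0) (by fun_prop) (by fun_prop) fun x hx => ?_
    have hd : HasDerivAt (fun t : ℝ => (t - 2) * Real.exp t + t + 2)
        (1 * Real.exp x + (x - 2) * Real.exp x + 1) x :=
      ((((hasDerivAt_id x).sub_const 2).mul (Real.hasDerivAt_exp x)).add (hasDerivAt_id x)).add_const 2
    rw [hd.deriv]
    have h1 := Real.add_one_le_exp (-x)
    have h2 : Real.exp (-x) * Real.exp x = 1 := by rw [← Real.exp_add]; simp
    nlinarith [Real.exp_pos x]
  have := hmono (Set.mem_Ici.mpr le_rfl) (Set.mem_Ici.mpr ht) ht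
  simp only [Real.exp_zero] at this
  linarith

lemma abs_exp_sub_exp_le (a b : ℝ) :
    |Real.exp a - Real.exp b| ≤ |a - b| / 2 * (Real.exp a + Real.exp b) := by
  wlog h : b ≤ a generalizing a b
  · rw [abs_sub_comm, abs_sub_comm a, add_comm]
    exact this b a (le_of_not_ge h)
  have h1 := exp_sub_one_le (sub_nonneg.mpr h)
  have h2 : Real.exp (a - b) * Real.exp b = Real.exp a := by rw [← Real.exp_add]; simp
  rw [abs_of_nonneg (sub_nonneg.mpr (Real.exp_le_exp.mpr h)), abs_of_nonneg (sub_nonneg.mpr h)]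
  have h3 := mul_le_mul_of_nonneg_right h1 (Real.exp_pos b).le
  calc Real.exp a - Real.exp b = (Real.exp (a - b) - 1) * Real.exp b := by rw [sub_mul, h2]; ring
    _ ≤ _ := h3
    _ = (a - b) / 2 * (Real.exp (a - b) * Real.exp b + Real.exp b) := by ring
    _ = _ := by rw [h2]

/-- Two tilted measures whose energies differ by a function of oscillation at most `D` have total
variation distance at most `D / 2`. -/
lemma abs_integral_tilted_sub_le {μ : Measure X} [IsProbabilityMeasure μ] {U V g : X → ℝ}
    (hU : BddMeasurable U) (hV : BddMeasurable V) (hg : BddMeasurable g) {B : Set X}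
    (hB : ∀ᵐ x ∂μ, x ∈ B) {D R : ℝ}
    (hD : ∀ x ∈ B, ∀ y ∈ B, |U x - V x - (U y - V y)| ≤ D) (hR : ∀ x y, |g x - g y| ≤ R) :
    |∫ x, g x ∂μ.tilted (fun x => -U x) - ∫ x, g x ∂μ.tilted (fun x => -V x)| ≤ D / 2 * R := by
  set w := fun x => Real.exp (-U x) with hw
  set v := fun x => Real.exp (-V x) with hv
  have hwm : BddMeasurable w := hU.exp_neg
  have hvm : BddMeasurable v := hV.exp_neg
  have hZ : 0 < ∫ x, w x ∂μ := integral_exp_neg_pos hU μ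
  have hZ' : 0 < ∫ x, v x ∂μ := integral_exp_neg_pos hV μ
  have iw := hwm.integrable μ
  have iv := hvm.integrable μ
  have iwg := (hwm.mul hg).integrable μ
  have ivg := (hvm.mul hg).integrable μ
  -- Symmetrization: twice the difference of the two means, multiplied by both normalizations, is
  -- the double integral of `(w(x) v(y) - v(x) w(y)) (g(x) - g(y))`. The six product integrals are
  -- its four terms and the two terms of the bound.
  have e1 := integral_prod_mul (μ := μ) (ν := μ) (fun x => w x * g x) v
  have e2 := integral_prod_mul (μ := μ) (ν := μ) (fun x => v x * g x) w
  have e3 := integral_prod_mul (μ := μ) (ν := μ) w (fun x => v x * g x)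
  have e4 := integral_prod_mul (μ := μ) (ν := μ) v (fun x => w x * g x)
  have e5 := integral_prod_mul (μ := μ) (ν := μ) w v
  have e6 := integral_prod_mul (μ := μ) (ν := μ) v w
  have i1 := iwg.mul_prod iv
  have i2 := ivg.mul_prod iw
  have i3 := iw.mul_prod ivg
  have i4 := iv.mul_prod iwg
  have i5 := iw.mul_prod iv
  have i6 := iv.mul_prod iw
  have i12 : Integrable (fun z : X × X => w z.1 * g z.1 * v z.2 - v z.1 * g z.1 * w z.2)
    (μ.prod μ) := i1.sub i2
  have i123 : Integrable (fun z : X × X => w z.1 * g z.1 * v z.2 - v z.1 * g z.1 * w z.2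
    - w z.1 * (v z.2 * g z.2)) (μ.prod μ) := i12.sub i3
  have hB1 : ∀ᵐ z ∂μ.prod μ, z.1 ∈ B := Measure.quasiMeasurePreserving_fst.ae hB
  have hB2 : ∀ᵐ z ∂μ.prod μ, z.2 ∈ B := Measure.quasiMeasurePreserving_snd.ae hB
  have key : |∫ z, ((w z.1 * g z.1) * v z.2 - (v z.1 * g z.1) * w z.2
      - w z.1 * (v z.2 * g z.2) + v z.1 * (w z.2 * g z.2)) ∂μ.prod μ|
      ≤ ∫ z, D / 2 * R * (w z.1 * v z.2 + v z.1 * w z.2) ∂μ.prod μ := by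
    rw [← Real.norm_eq_abs]
    refine norm_integral_le_of_norm_le ((i5.add i6).const_mul _) ?_
    filter_upwards [hB1, hB2] with z h1 h2
    -- The exponents of `w(x) v(y)` and `v(x) w(y)` differ by the increment of `U - V` between the
    -- two points, so `hD` applies without any normalization of the energies.
    have hexp := abs_exp_sub_exp_le (-U z.1 + -V z.2) (-V z.1 + -U z.2)
    have ha : |-U z.1 + -V z.2 - (-V z.1 + -U z.2)| ≤ D := by
      rw [abs_sub_comm]
      convert hD z.1 h1 z.2 h2 using 2
      ring
    rw [Real.exp_add, Real.exp_add] at hexp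
    have hs : 0 ≤ w z.1 * v z.2 + v z.1 * w z.2 := by positivity
    have hD0 : 0 ≤ D := (abs_nonneg _).trans ha
    calc ‖(w z.1 * g z.1) * v z.2 - (v z.1 * g z.1) * w z.2
          - w z.1 * (v z.2 * g z.2) + v z.1 * (w z.2 * g z.2)‖
        = |w z.1 * v z.2 - v z.1 * w z.2| * |g z.1 - g z.2| := by
          rw [← abs_mul, Real.norm_eq_abs]; congr 1; ring
      _ ≤ (D / 2 * (w z.1 * v z.2 + v z.1 * w z.2)) * R := by
          refine mul_le_mul (hexp.trans ?_) (hR _ _) (abs_nonneg _) (by positivity)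
          exact mul_le_mul_of_nonneg_right (by linarith) hs
      _ = _ := by ring
  rw [integral_add i123 i4, integral_sub i12 i3, integral_sub i1 i2,
    integral_const_mul, integral_add i5 i6, e1, e2, e3, e4, e5, e6] at key
  rw [integral_tilted_neg, integral_tilted_neg]
  change |(∫ x, w x * g x ∂μ) / (∫ x, w x ∂μ) - (∫ x, v x * g x ∂μ) / (∫ x, v x ∂μ)| ≤ _
  rw [div_sub_div _ _ hZ.ne' hZ'.ne', abs_div, abs_of_pos (mul_pos hZ hZ'),
    div_le_iff₀ (mul_pos hZ hZ')]
  have e : ∀ a b c d : ℝ, a * d - b * c - c * b + d * a = 2 * (a * d - c * b) := by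
    intros; ring
  rw [e, abs_mul, abs_two] at key
  nlinarith [key]

end Tilting

end Fuzzy

namespace Fuzzy

/-! ### Dobrushin's comparison theorem on a finite product. -/

section Dobrushin

variable {ι S : Type*} [DecidableEq ι] [MeasurableSpace S]

lemma measurable_update_prod (i : ι) :
    Measurable fun p : (ι → S) × S => Function.update p.1 i p.2 := by
  refine measurable_pi_iff.mpr fun j => ?_
  by_cases h : j = i
  · subst h; simpa using measurable_snd
  · simp only [Function.update_of_ne h]; fun_prop

lemma BddMeasurable.update {U : (ι → S) → ℝ} (hU : BddMeasurable U) (τ : ι → S) (i : ι) :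
    BddMeasurable fun s => U (Function.update τ i s) :=
  hU.comp (measurable_update τ)

/-- The average of `f` over the spin at `i`, with respect to the measure `β i` tilted by the
energy `U`. -/
noncomputable def siteAvg (β : ι → Measure S) (U : (ι → S) → ℝ) (i : ι) (f : (ι → S) → ℝ)
    (τ : ι → S) : ℝ :=
  ∫ s, f (Function.update τ i s) ∂(β i).tilted fun s => -U (Function.update τ i s)

lemma siteAvg_congr {β : ι → Measure S} {U f : (ι → S) → ℝ} (i : ι) {τ τ' : ι → S} (h : ∀ j, j ≠ i → τ j = τ' j) :
    siteAvg β U i f τ = siteAvg β U i f τ' := by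
  have : ∀ s, Function.update τ i s = Function.update τ' i s := fun s => by
    ext j
    by_cases hj : j = i
    · subst hj; simp
    · simp [Function.update_of_ne hj, h j hj]
  simp [siteAvg, this]

/-- A function with site oscillations `d` on a finite product oscillates at most by `∑ d`. -/
lemma abs_sub_le_sum_osc {ι S : Type*} [Fintype ι] {f : (ι → S) → ℝ} {d : ι → ℝ}
    (hd : ∀ k σ τ, (∀ j, j ≠ k → σ j = τ j) → |f σ - f τ| ≤ d k) (σ τ : ι → S) :
    |f σ - f τ| ≤ ∑ k, d k := by
  classical
  have key : ∀ s : Finset ι, |f (s.piecewise σ τ) - f τ| ≤ ∑ k ∈ s, d k := by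
    intro s
    induction s using Finset.induction_on with
    | empty => simp
    | insert a s ha ih =>
      rw [Finset.sum_insert ha]
      refine (abs_sub_le _ (f (s.piecewise σ τ)) _).trans (add_le_add (hd a _ _ fun j hj => ?_) ih)
      simp [Finset.piecewise, hj]
  simpa using key Finset.univ

lemma siteAvg_bddMeasurable {β : ι → Measure S} [∀ i, IsProbabilityMeasure (β i)]
    {U f : (ι → S) → ℝ} (hU : BddMeasurable U) (hf : BddMeasurable f) (i : ι) :
    BddMeasurable (siteAvg β U i f) := by
  refine ⟨?_, ?_⟩
  · have h1 : ∀ {g : (ι → S) → ℝ}, BddMeasurable g →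
        Measurable fun τ => ∫ s, g (Function.update τ i s) ∂β i := fun {g} hg =>
      (StronglyMeasurable.integral_prod_right
        (f := fun (τ : ι → S) (s : S) => g (Function.update τ i s))
        (hg.1.comp (measurable_update_prod i)).stronglyMeasurable).measurable
    have h2 := (h1 (hU.exp_neg.mul hf)).div (h1 hU.exp_neg)
    convert h2 using 1
    ext τ
    exact integral_tilted_neg (β i) (fun s => U (Function.update τ i s)) _
  · obtain ⟨M, hM⟩ := hf.2
    refine ⟨M, fun τ => ?_⟩
    have := isProbabilityMeasure_tilted_neg (hU.update τ i) (β i)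
    exact abs_integral_le_of_forall fun s => hM _

variable [Fintype ι]

/-- Independent resampling of one coordinate leaves a product measure invariant. Single-site
averaging rests on this. -/
lemma map_update_prod (β : ι → Measure S) [∀ i, IsProbabilityMeasure (β i)] (i : ι) :
    ((Measure.pi β).prod (β i)).map (fun p => Function.update p.1 i p.2) = Measure.pi β := by
  symm
  refine Measure.pi_eq fun s hs => ?_
  rw [Measure.map_apply (measurable_update_prod i) (MeasurableSet.univ_pi hs)]
  have : (fun p : (ι → S) × S => Function.update p.1 i p.2) ⁻¹' (Set.univ.pi s)
      = (Set.univ.pi (Function.update s i Set.univ)) ×ˢ s i := by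
    ext p
    simp only [Set.mem_preimage, Set.mem_pi, Set.mem_univ, true_imp_iff, Set.mem_prod]
    constructor
    · intro h
      refine ⟨fun j => ?_, by simpa using h i⟩
      by_cases hj : j = i
      · subst hj; simp
      · simpa [Function.update_of_ne hj] using h j
    · rintro ⟨h1, h2⟩ j
      by_cases hj : j = i
      · subst hj; simpa using h2
      · simpa [Function.update_of_ne hj] using h1 j
  rw [this, Measure.prod_prod, Measure.pi_pi, ← Finset.mul_prod_erase _ _ (Finset.mem_univ i),
    ← Finset.mul_prod_erase Finset.univ (fun j => β j (s j)) (Finset.mem_univ i), mul_comm]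
  simp only [Function.update_self, measure_univ, one_mul]
  congr 1
  exact Finset.prod_congr rfl fun j hj => by
    rw [Function.update_of_ne (Finset.ne_of_mem_erase hj)]

lemma integral_pi_eq_integral_update (β : ι → Measure S) [∀ i, IsProbabilityMeasure (β i)] (i : ι)
    {g : (ι → S) → ℝ} (hg : BddMeasurable g) :
    ∫ τ, g τ ∂Measure.pi β = ∫ τ, ∫ s, g (Function.update τ i s) ∂β i ∂Measure.pi β := by
  conv_lhs => rw [← map_update_prod β i]
  rw [integral_map (measurable_update_prod i).aemeasurable hg.1.aestronglyMeasurable,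
    integral_prod _ ((hg.comp (measurable_update_prod i)).integrable _)]

variable {β β' : ι → Measure S} [∀ i, IsProbabilityMeasure (β i)]
  [∀ i, IsProbabilityMeasure (β' i)] {U V f : (ι → S) → ℝ}

/-- The single-site DLR equation. The average does not depend on the spin at `i`, so integrating the
weight over that spin produces exactly the denominator of `siteAvg`. -/
lemma integral_siteAvg (hU : BddMeasurable U) (hf : BddMeasurable f) (i : ι) :
    ∫ τ, siteAvg β U i f τ ∂(Measure.pi β).tilted (fun τ => -U τ)
      = ∫ τ, f τ ∂(Measure.pi β).tilted (fun τ => -U τ) := by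
  rw [integral_tilted_neg, integral_tilted_neg]
  congr 1
  rw [integral_pi_eq_integral_update β i (hU.exp_neg.mul hf),
    integral_pi_eq_integral_update β i (hU.exp_neg.mul (siteAvg_bddMeasurable hU hf i))]
  congr 1 with τ
  have h1 : ∀ s, siteAvg β U i f (Function.update τ i s) = siteAvg β U i f τ := fun s =>
    siteAvg_congr i fun j hj => Function.update_of_ne hj _ _
  simp only [h1]
  rw [integral_mul_const, siteAvg, integral_tilted_neg (β i) (fun s => U (Function.update τ i s)),
    mul_div_cancel₀]
  exact (integral_exp_neg_pos (hU.update τ i) (β i)).ne'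

/-- The iterates of the affine map `v ↦ C v + b`, started at the constant `2`. -/
def comparisonVec (C : ι → ι → ℝ) (b : ι → ℝ) : ℕ → ι → ℝ
  | 0 => fun _ => 2
  | n + 1 => fun i => ∑ k, C i k * comparisonVec C b n k + b i

/-- Dobrushin's comparison theorem on a finite product: if two tilted product measures have
single-site laws with interdependence matrix `C` and mutual distance `b`, then their expectations
of a function with site oscillations `d` differ at most by `∑ d v` for every iterate `v` of
`v ↦ C v + b`. -/
theorem dobrushin_comparison_iterate (hU : BddMeasurable U) (hV : BddMeasurable V)
    {B : ι → Set S} (hB : ∀ i, ∀ᵐ s ∂β i, s ∈ B i) {C : ι → ι → ℝ} (hC : ∀ i j, 0 ≤ C i j)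
    {b : ι → ℝ} (hb : ∀ i, 0 ≤ b i)
    (hmix : ∀ i j ζ ζ', (∀ k, k ≠ j → ζ k = ζ' k) → ∀ s ∈ B i, ∀ a ∈ B i,
      |U (Function.update ζ i s) - U (Function.update ζ' i s)
        - (U (Function.update ζ i a) - U (Function.update ζ' i a))| ≤ 2 * C i j)
    (hdiff : ∀ i, 1 ≤ b i ∨ (β i = β' i ∧ ∀ ζ, ∀ s ∈ B i, ∀ a ∈ B i,
      |U (Function.update ζ i s) - V (Function.update ζ i s)
        - (U (Function.update ζ i a) - V (Function.update ζ i a))| ≤ 2 * b i))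
    (n : ℕ) (hf : BddMeasurable f) {d : ι → ℝ}
    (hd : ∀ k σ τ, (∀ j, j ≠ k → σ j = τ j) → |f σ - f τ| ≤ d k) :
    |∫ τ, f τ ∂(Measure.pi β).tilted (fun τ => -U τ)
      - ∫ τ, f τ ∂(Measure.pi β').tilted (fun τ => -V τ)|
      ≤ ∑ k, d k * comparisonVec C b n k := by
  have pU := isProbabilityMeasure_tilted_neg hU (Measure.pi β)
  have pV := isProbabilityMeasure_tilted_neg hV (Measure.pi β')
  set ν := (Measure.pi β).tilted (fun τ => -U τ) with hν
  set ν' := (Measure.pi β').tilted (fun τ => -V τ) with hν'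
  let Est : (ι → ℝ) → Prop := fun a => ∀ (f : (ι → S) → ℝ) (d : ι → ℝ), BddMeasurable f →
    (∀ k σ τ, (∀ j, j ≠ k → σ j = τ j) → |f σ - f τ| ≤ d k) →
    |∫ τ, f τ ∂ν - ∫ τ, f τ ∂ν'| ≤ ∑ k, d k * a k
  have dnonneg : ∀ {f : (ι → S) → ℝ} {d : ι → ℝ},
      (∀ k σ τ, (∀ j, j ≠ k → σ j = τ j) → |f σ - f τ| ≤ d k) → ∀ k, 0 ≤ d k := by
    intro f d hd k
    obtain ⟨σ⟩ : Nonempty (ι → S) := ⟨fun i => ((β i).nonempty_of_neZero).some⟩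
    exact (abs_nonneg _).trans (hd k σ σ fun _ _ => rfl)
  have est_mono : ∀ {a a' : ι → ℝ}, Est a → (∀ k, a k ≤ a' k) → Est a' := by
    intro a a' ha h f d hf hd
    exact (ha f d hf hd).trans
      (Finset.sum_le_sum fun k _ => mul_le_mul_of_nonneg_left (h k) (dnonneg hd k))
  -- Each of the two means is within `∑ d` of the value of `f` at one fixed configuration, hence the
  -- constant 2.
  have est_zero : Est fun _ => 2 := by
    intro f d hf hd
    obtain ⟨σ⟩ : Nonempty (ι → S) := ⟨fun i => ((β i).nonempty_of_neZero).some⟩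
    have h : ∀ (κ : Measure (ι → S)) [IsProbabilityMeasure κ], |∫ τ, f τ ∂κ - f σ| ≤ ∑ k, d k := by
      intro κ _
      have h1 : ∫ τ, f τ ∂κ - f σ = ∫ τ, (f τ - f σ) ∂κ := by
        rw [integral_sub (hf.integrable κ) (integrable_const _)]; simp
      rw [h1]
      exact abs_integral_le_of_forall fun τ => abs_sub_le_sum_osc hd τ σ
    have h1 := h ν
    have h2 := h ν'
    rw [← Finset.sum_mul]
    rw [abs_le] at *
    constructor <;> linarith
  -- Replace `f` by its average at `i` under each energy. The average has no oscillation at `i`,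
  -- while its oscillation at `k` grows by at most `C i k * d i`. Exchanging one average for the
  -- other costs `b i * d i`. Collecting the coefficient of `d i` gives the new entry of the vector.
  have est_site : ∀ (a : ι → ℝ), (∀ k, 0 ≤ a k) → Est a → ∀ i,
      Est (Function.update a i (∑ k, C i k * a k + b i)) := by
    intro a ha hest i f d hf hd
    have d0 := dnonneg hd
    set g := siteAvg β U i f with hg
    set g' := siteAvg β' V i f with hg'
    have hgm : BddMeasurable g := siteAvg_bddMeasurable hU hf i
    have hgm' : BddMeasurable g' := siteAvg_bddMeasurable hV hf i
    have hosc : ∀ τ s t, |f (Function.update τ i s) - f (Function.update τ i t)| ≤ d i :=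
      fun τ s t => hd i _ _ fun j hj => by simp [Function.update_of_ne hj]
    have hgd : ∀ k σ τ, (∀ j, j ≠ k → σ j = τ j) →
        |g σ - g τ| ≤ if k = i then 0 else d k + C i k * d i := by
      intro k σ τ hστ
      split_ifs with hk
      · subst hk
        rw [hg, siteAvg_congr k hστ, sub_self, abs_zero]
      · have p1 := isProbabilityMeasure_tilted_neg (hU.update σ i) (β i)
        have h1 : |∫ s, f (Function.update σ i s) ∂(β i).tilted (fun s => -U (Function.update σ i s))
            - ∫ s, f (Function.update τ i s) ∂(β i).tilted (fun s => -U (Function.update σ i s))|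
            ≤ d k := by
          rw [← integral_sub ((hf.update σ i).integrable _) ((hf.update τ i).integrable _)]
          refine abs_integral_le_of_forall fun s => hd k _ _ fun j hj => ?_
          by_cases hji : j = i
          · subst hji; simp
          · simp [Function.update_of_ne hji, hστ j hj]
        have h2 := abs_integral_tilted_sub_le (μ := β i) (hU.update σ i) (hU.update τ i)
          (hf.update τ i) (hB i) (hmix i k σ τ hστ) (hosc τ)
        refine (abs_sub_le _ _ _).trans (add_le_add h1 (h2.trans_eq ?_))
        ring
    have h1 := hest g _ hgm hgd
    have h2 : |∫ τ, g τ ∂ν' - ∫ τ, g' τ ∂ν'| ≤ b i * d i := by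
      rw [← integral_sub (hgm.integrable _) (hgm'.integrable _)]
      refine abs_integral_le_of_forall fun τ => ?_
      rcases hdiff i with hbi | ⟨hβ, hbi⟩
      · have p1 := isProbabilityMeasure_tilted_neg (hU.update τ i) (β i)
        have p2 := isProbabilityMeasure_tilted_neg (hV.update τ i) (β' i)
        have h3 : ∀ s, |f (Function.update τ i s) - g' τ| ≤ d i := by
          intro s
          have e : f (Function.update τ i s) - g' τ
              = ∫ t, (f (Function.update τ i s) - f (Function.update τ i t))
                ∂(β' i).tilted (fun s => -V (Function.update τ i s)) := by
            rw [integral_sub (integrable_const _) ((hf.update τ i).integrable _)]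
            simp [hg', siteAvg]
          rw [e]
          exact abs_integral_le_of_forall (hosc τ s)
        have e : g τ - g' τ = ∫ s, (f (Function.update τ i s) - g' τ)
            ∂(β i).tilted (fun s => -U (Function.update τ i s)) := by
          rw [integral_sub ((hf.update τ i).integrable _) (integrable_const _)]
          simp [hg, siteAvg]
        rw [e]
        -- When `1 ≤ b i` nothing need be known about the two site laws: any two averages of `f`
        -- over the spin at `i` differ by at most `d i`.
        refine (abs_integral_le_of_forall h3).trans ?_
        nlinarith [d0 i]
      · have h3 := abs_integral_tilted_sub_le (μ := β i) (hU.update τ i) (hV.update τ i)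
          (hf.update τ i) (hB i) (hbi τ) (hosc τ)
        have e : g' τ = ∫ s, f (Function.update τ i s)
            ∂(β i).tilted (fun s => -V (Function.update τ i s)) := by
          rw [hg', siteAvg, hβ]
        rw [e]
        exact h3.trans_eq (by ring)
    rw [← integral_siteAvg hU hf i, ← integral_siteAvg hV hf i]
    refine (abs_sub_le _ (∫ τ, g τ ∂ν') _).trans ((add_le_add h1 h2).trans ?_)
    rw [← Finset.add_sum_erase _ _ (Finset.mem_univ i),
      ← Finset.add_sum_erase Finset.univ (fun k => d k * _) (Finset.mem_univ i)]
    simp only [if_true, zero_mul, zero_add, Function.update_self]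
    have e1 : ∑ k ∈ Finset.univ.erase i, (if k = i then 0 else d k + C i k * d i) * a k
        = ∑ k ∈ Finset.univ.erase i, d k * a k
          + d i * ∑ k ∈ Finset.univ.erase i, C i k * a k := by
      rw [Finset.mul_sum, ← Finset.sum_add_distrib]
      refine Finset.sum_congr rfl fun k hk => ?_
      rw [if_neg (Finset.ne_of_mem_erase hk)]
      ring
    have e2 : ∑ k ∈ Finset.univ.erase i,
        d k * Function.update a i (∑ k, C i k * a k + b i) k
        = ∑ k ∈ Finset.univ.erase i, d k * a k :=
      Finset.sum_congr rfl fun k hk => by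
        rw [Function.update_of_ne (Finset.ne_of_mem_erase hk)]
    have e3 := Finset.add_sum_erase Finset.univ (fun k => C i k * a k) (Finset.mem_univ i)
    rw [e1, e2, ← e3]
    nlinarith [mul_nonneg (d0 i) (mul_nonneg (hC i i) (ha i))]
  have est_step : ∀ (a : ι → ℝ), (∀ k, 0 ≤ a k) → Est a →
      Est fun i => ∑ k, C i k * a k + b i := by
    intro a ha hest
    set a' : ι → ℝ := fun i => ∑ k, C i k * a k + b i with ha'
    have a'0 : ∀ i, 0 ≤ a' i := fun i =>
      add_nonneg (Finset.sum_nonneg fun k _ => mul_nonneg (hC i k) (ha k)) (hb i)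
    -- The sites are updated one at a time. Taking the minimum with the old entry keeps the
    -- intermediate vector `w` below `a`, so that an entry computed from the partly updated vector
    -- is still at most the one computed from `a`.
    have key : ∀ s : Finset ι, Est (s.piecewise (fun i => min (a i) (a' i)) a) := by
      intro s
      induction s using Finset.induction_on with
      | empty => simpa using hest
      | insert i s hi ih =>
        set w := s.piecewise (fun i => min (a i) (a' i)) a with hw
        have w0 : ∀ k, 0 ≤ w k := fun k => by
          by_cases hk : k ∈ s
          · simp [hw, hk, ha k, a'0 k]
          · simp [hw, hk, ha k]
        have wa : ∀ k, w k ≤ a k := fun k => by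
          by_cases hk : k ∈ s <;> simp [hw, hk]
        rw [Finset.piecewise_insert]
        by_cases hcmp : a i ≤ a' i
        · refine est_mono ih fun k => ?_
          by_cases hk : k = i
          · subst hk; simp [hcmp, wa k]
          · simp [Function.update_of_ne hk, hw]
        · refine est_mono (est_site w w0 ih i) fun k => ?_
          by_cases hk : k = i
          · subst hk
            rw [Function.update_self, Function.update_self, min_eq_right (le_of_not_ge hcmp)]
            exact add_le_add_left (Finset.sum_le_sum fun j _ =>
              mul_le_mul_of_nonneg_left (wa j) (hC k j)) _
          · simp [Function.update_of_ne hk, hw]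
    refine est_mono (key Finset.univ) fun k => ?_
    simp
  have all : ∀ n, (∀ k, 0 ≤ comparisonVec C b n k) ∧ Est (comparisonVec C b n) := by
    intro n
    induction n with
    | zero => exact ⟨fun _ => zero_le_two, est_zero⟩
    | succ n ih =>
      exact ⟨fun i => add_nonneg (Finset.sum_nonneg fun k _ => mul_nonneg (hC i k) (ih.1 k)) (hb i),
        est_step _ ih.1 ih.2⟩
  exact (all n).2 f d hf hd

end Dobrushin

end Fuzzy

namespace Fuzzy

/-! ### The comparison theorem in terms of the Neumann series. -/

section Neumann

variable {G : Type*} [DecidableEq G] (C : G → G → ℝ≥0∞)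

lemma neumann_eq (i j : G) :
    neumann C i j = (if i = j then 1 else 0) + ∑' k, C i k * neumann C k j := by
  rw [neumann, tsum_eq_zero_add' ENNReal.summable]
  congr 1
  simp only [matPow, neumann, ← ENNReal.tsum_mul_left]
  exact ENNReal.tsum_comm

variable {C} {c : ℝ≥0∞}

lemma tsum_matPow_le (hC : ∀ i, ∑' j, C i j ≤ c) (n : ℕ) (i : G) : ∑' j, matPow C n i j ≤ c ^ n := by
  induction n generalizing i with
  | zero => simp [matPow]
  | succ n ih =>
    simp only [matPow]
    rw [ENNReal.tsum_comm]
    calc ∑' k, ∑' j, C i k * matPow C n k j = ∑' k, C i k * ∑' j, matPow C n k j := by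
          simp [ENNReal.tsum_mul_left]
      _ ≤ ∑' k, C i k * c ^ n := ENNReal.tsum_le_tsum fun k => by gcongr; exact ih k
      _ = (∑' k, C i k) * c ^ n := ENNReal.tsum_mul_right
      _ ≤ c * c ^ n := by gcongr; exact hC i
      _ = c ^ (n + 1) := (pow_succ' c n).symm

lemma tsum_neumann_le (hC : ∀ i, ∑' j, C i j ≤ c) (i : G) : ∑' j, neumann C i j ≤ (1 - c)⁻¹ := by
  simp only [neumann]
  rw [ENNReal.tsum_comm, ← ENNReal.tsum_geometric]
  exact ENNReal.tsum_le_tsum fun n => tsum_matPow_le hC n i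

variable {S : Type*} [MeasurableSpace S]

/-- Dobrushin's comparison theorem for tilted product measures on the finite set `V` of sites. -/
theorem dobrushin_comparison (hC : ∀ i, ∑' j, C i j ≤ c) (hc : c < 1) {V : Finset G} {β β' : V → Measure S}
    [∀ i, IsProbabilityMeasure (β i)] [∀ i, IsProbabilityMeasure (β' i)]
    {U W f : (V → S) → ℝ} (hU : BddMeasurable U) (hW : BddMeasurable W) (hf : BddMeasurable f)
    {B : V → Set S} (hB : ∀ i : V, ∀ᵐ s ∂β i, s ∈ B i)
    {b : G → ℝ≥0∞} (hb : ∀ i, b i ≠ ∞) {d : G → ℝ≥0∞} (hd : ∀ i, d i ≠ ∞)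
    (hmix : ∀ (i j : V) (ζ ζ' : V → S), (∀ k, k ≠ j → ζ k = ζ' k) → ∀ s ∈ B i, ∀ a ∈ B i,
      ENNReal.ofReal |U (Function.update ζ i s) - U (Function.update ζ' i s)
        - (U (Function.update ζ i a) - U (Function.update ζ' i a))| ≤ 2 * C i j)
    (hdiff : ∀ i : V, 1 ≤ b i ∨ (β i = β' i ∧ ∀ ζ, ∀ s ∈ B i, ∀ a ∈ B i,
      ENNReal.ofReal |U (Function.update ζ i s) - W (Function.update ζ i s)
        - (U (Function.update ζ i a) - W (Function.update ζ i a))| ≤ 2 * b i))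
    (hosc : ∀ (k : V) (σ τ : V → S), (∀ j, j ≠ k → σ j = τ j) →
      ENNReal.ofReal |f σ - f τ| ≤ d k) :
    ENNReal.ofReal |∫ τ, f τ ∂(Measure.pi β).tilted (fun τ => -U τ)
      - ∫ τ, f τ ∂(Measure.pi β').tilted (fun τ => -W τ)|
      ≤ ∑' k, d k * ∑' j, neumann C k j * b j := by
  have hCfin : ∀ i j, C i j ≠ ∞ := fun i j =>
    (((ENNReal.le_tsum j).trans (hC i)).trans_lt (hc.trans ENNReal.one_lt_top)).ne
  set C' : V → V → ℝ := fun i j => (C i j).toReal with hC'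
  set b' : V → ℝ := fun i => (b i).toReal with hb'
  have hvec0 : ∀ n k, 0 ≤ comparisonVec C' b' n k := by
    intro n
    induction n with
    | zero => exact fun _ => zero_le_two
    | succ n ih => exact fun i => add_nonneg (Finset.sum_nonneg fun k _ =>
        mul_nonneg ENNReal.toReal_nonneg (ih k)) ENNReal.toReal_nonneg
  -- The vector `∑ j, D k j * b j` with `D = ∑ Cⁿ` is fixed by `v ↦ C v + b`, because `D = 1 + C D`.
  -- The excess of the iterates, initially at most 2, shrinks by the factor `c` at each step. Sums
  -- over `V` are enlarged to sums over `G`.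
  have hvec : ∀ n (i : V), ENNReal.ofReal (comparisonVec C' b' n i)
      ≤ ∑' j, neumann C i j * b j + 2 * c ^ n := by
    intro n
    induction n with
    | zero =>
      intro i
      simp only [comparisonVec, pow_zero, mul_one]
      rw [show ENNReal.ofReal 2 = 2 by simp]
      exact le_add_self
    | succ n ih =>
      intro i
      simp only [comparisonVec]
      rw [ENNReal.ofReal_add (Finset.sum_nonneg fun k _ =>
        mul_nonneg ENNReal.toReal_nonneg (hvec0 n k)) ENNReal.toReal_nonneg,
        ENNReal.ofReal_sum_of_nonneg fun k _ => mul_nonneg ENNReal.toReal_nonneg (hvec0 n k),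
        ENNReal.ofReal_toReal (hb i)]
      have h1 : ∑ k : V, ENNReal.ofReal (C' i k * comparisonVec C' b' n k)
          ≤ ∑' k, C i k * (∑' j, neumann C k j * b j + 2 * c ^ n) := by
        calc ∑ k : V, ENNReal.ofReal (C' i k * comparisonVec C' b' n k)
            ≤ ∑ k : V, C i k * (∑' j, neumann C k j * b j + 2 * c ^ n) := by
              refine Finset.sum_le_sum fun k _ => ?_
              rw [ENNReal.ofReal_mul ENNReal.toReal_nonneg, ENNReal.ofReal_toReal (hCfin i k)]
              gcongr
              exact ih k
          _ = ∑ k ∈ V, C i k * (∑' j, neumann C k j * b j + 2 * c ^ n) :=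
              Finset.sum_coe_sort V fun k => C i k * (∑' j, neumann C k j * b j + 2 * c ^ n)
          _ ≤ _ := ENNReal.sum_le_tsum V
      refine (add_le_add_left h1 _).trans ?_
      have h2 : ∑' k, C i k * (∑' j, neumann C k j * b j + 2 * c ^ n)
          = ∑' j, (∑' k, C i k * neumann C k j) * b j + (∑' k, C i k) * (2 * c ^ n) := by
        simp only [mul_add]
        rw [ENNReal.tsum_add, ENNReal.tsum_mul_right]
        congr 1
        simp only [← ENNReal.tsum_mul_left, ← ENNReal.tsum_mul_right]
        rw [ENNReal.tsum_comm]
        simp only [mul_assoc]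
      have h3 : ∑' j, neumann C i j * b j
          = b i + ∑' j, (∑' k, C i k * neumann C k j) * b j := by
        rw [← tsum_ite_eq (i : G) b, ← ENNReal.tsum_add]
        refine tsum_congr fun j => ?_
        rw [neumann_eq, add_mul]
        congr 1
        by_cases hij : (i : G) = j
        · simp [hij]
        · simp [hij, Ne.symm hij]
      rw [h2, h3]
      calc ∑' j, (∑' k, C i k * neumann C k j) * b j + (∑' k, C i k) * (2 * c ^ n) + b i
          ≤ ∑' j, (∑' k, C i k * neumann C k j) * b j + c * (2 * c ^ n) + b i := by
            gcongr; exact hC i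
        _ = _ := by ring
  have key : ∀ n, ENNReal.ofReal |∫ τ, f τ ∂(Measure.pi β).tilted (fun τ => -U τ)
      - ∫ τ, f τ ∂(Measure.pi β').tilted (fun τ => -W τ)|
      ≤ ∑' k, d k * ∑' j, neumann C k j * b j + (∑ k : V, d k) * (2 * c ^ n) := by
    intro n
    have h := dobrushin_comparison_iterate hU hW hB (C := C') (fun _ _ => ENNReal.toReal_nonneg)
      (b := b') (fun _ => ENNReal.toReal_nonneg) (fun i j ζ ζ' h s hs a ha => by
        have h1 := (ENNReal.ofReal_le_iff_le_toReal
          (ENNReal.mul_ne_top ENNReal.ofNat_ne_top (hCfin i j))).mp (hmix i j ζ ζ' h s hs a ha)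
        simpa using h1)
      (fun i => by
        rcases hdiff i with h1 | ⟨h1, h2⟩
        · left
          simpa using ENNReal.toReal_mono (hb i) h1
        · refine Or.inr ⟨h1, fun ζ s hs a ha => ?_⟩
          have h3 := (ENNReal.ofReal_le_iff_le_toReal
            (ENNReal.mul_ne_top ENNReal.ofNat_ne_top (hb i))).mp (h2 ζ s hs a ha)
          simpa using h3)
      n hf (d := fun k => (d k).toReal) (fun k σ τ h =>
        (ENNReal.ofReal_le_iff_le_toReal (hd k)).mp (hosc k σ τ h))
    refine (ENNReal.ofReal_le_ofReal h).trans ?_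
    rw [ENNReal.ofReal_sum_of_nonneg fun k _ => mul_nonneg ENNReal.toReal_nonneg (hvec0 n k)]
    calc ∑ k : V, ENNReal.ofReal ((d k).toReal * comparisonVec C' b' n k)
        ≤ ∑ k : V, (d k * ∑' j, neumann C k j * b j + d k * (2 * c ^ n)) := by
          refine Finset.sum_le_sum fun k _ => ?_
          rw [ENNReal.ofReal_mul ENNReal.toReal_nonneg, ENNReal.ofReal_toReal (hd k), ← mul_add]
          gcongr
          exact hvec n k
      _ = ∑ k ∈ V, d k * ∑' j, neumann C k j * b j + (∑ k : V, d k) * (2 * c ^ n) := by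
          rw [Finset.sum_add_distrib, Finset.sum_mul,
            Finset.sum_coe_sort V fun k => d k * ∑' j, neumann C k j * b j]
      _ ≤ _ := by gcongr; exact ENNReal.sum_le_tsum V
  have hlim : Filter.Tendsto (fun n : ℕ => ∑' k, d k * ∑' j, neumann C k j * b j
      + (∑ k : V, d k) * (2 * c ^ n)) Filter.atTop
      (nhds (∑' k, d k * ∑' j, neumann C k j * b j + (∑ k : V, d k) * (2 * 0))) := by
    refine Filter.Tendsto.const_add _ (ENNReal.Tendsto.const_mul (ENNReal.Tendsto.const_mul
      (ENNReal.tendsto_pow_atTop_nhds_zero_of_lt_one hc) (Or.inr ENNReal.ofNat_ne_top)) (Or.inr ?_))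
    exact (ENNReal.sum_lt_top.mpr fun (k : V) _ => (hd k).lt_top).ne
  simpa using ge_of_tendsto' hlim key

end Neumann

end Fuzzy

namespace Fuzzy

/-! ### Vanishing tails of dominated series. -/

section Tails

variable {G S : Type*}

lemma tendsto_tsum_zero_of_dominated [Countable G] {α : Type*} {F : Finset G → α → ℝ≥0∞}
    {f : α → ℝ≥0∞} (hF : ∀ Δ a, F Δ a ≤ f a) (hf : ∑' a, f a ≠ ∞)
    (h : ∀ a, Filter.Tendsto (fun Δ => F Δ a) Filter.atTop (nhds 0)) :
    Filter.Tendsto (fun Δ => ∑' a, F Δ a) Filter.atTop (nhds 0) := by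
  let _ : MeasurableSpace α := ⊤
  -- Dominated convergence for the counting measure; countability of `G` makes the filter of finite
  -- subsets countably generated.
  have := tendsto_lintegral_filter_of_dominated_convergence (μ := Measure.count)
    (l := Filter.atTop) (F := F) (f := fun _ => 0) f (.of_forall fun Δ => measurable_from_top)
    (.of_forall fun Δ => .of_forall (hF Δ))
    (by rwa [lintegral_count]) (.of_forall h)
  simpa [lintegral_count] using this

lemma tendsto_normSum_not_subset [Countable G] {Φ : Finset G → (G → S) → ℝ} {P : Finset G → Prop}
    (hP : normSum Φ P < ∞) :
    Filter.Tendsto (fun Δ => normSum Φ (fun A => P A ∧ ¬ A ⊆ Δ)) Filter.atTop (nhds 0) := by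
  simp only [normSum_eq]
  rw [normSum_eq] at hP
  refine tendsto_tsum_zero_of_dominated (fun Δ A => ?_) hP.ne fun A => ?_
  · exact Set.indicator_le_indicator_of_subset (fun A hA => hA.1) (fun _ => zero_le) A
  · refine tendsto_const_nhds.congr' ?_
    filter_upwards [Filter.eventually_ge_atTop A] with Δ hΔ
    have : A ⊆ Δ := hΔ
    simp [this]

end Tails

/-! ### Ratios of partition functions as expectations of Boltzmann factors. -/

section Ratios

/-- The Boltzmann weight `exp(-H_Δ)`. -/
noncomputable def boltzmann {G S : Type*} (Φ : Finset G → (G → S) → ℝ) (Δ : Finset G) (σ : G → S) : ℝ≥0∞ :=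
  ENNReal.ofReal (Real.exp (-hamiltonian Φ Δ σ))

lemma measurable_boltzmann {G S : Type*} [Countable G] [MeasurableSpace S]
    {Φ : Finset G → (G → S) → ℝ} (hΦ : IsInteraction Φ) (Δ : Finset G) : Measurable (boltzmann Φ Δ) :=
  (measurable_hamiltonian hΦ Δ).neg.exp.ennreal_ofReal

lemma abs_exp_neg_sub_le {u v M : ℝ} (hu : |u| ≤ M) (hv : |v| ≤ M) :
    |Real.exp (-u) - Real.exp (-v)| ≤ Real.exp M * |u - v| := by
  refine (abs_exp_sub_exp_le _ _).trans ?_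
  have h1 : Real.exp (-u) ≤ Real.exp M := Real.exp_le_exp.mpr ((neg_le_abs u).trans hu)
  have h2 : Real.exp (-v) ≤ Real.exp M := Real.exp_le_exp.mpr ((neg_le_abs v).trans hv)
  have h3 : |-u - -v| = |u - v| := by rw [← abs_neg]; congr 1; ring
  rw [h3]
  nlinarith [abs_nonneg (u - v)]

open Function

variable {G S : Type*} [DecidableEq G] {Φ : Finset G → (G → S) → ℝ}

lemma updateFinset_update {V : Finset G} (x : G → S) (τ : V → S) (i : V) (s : S) :
    updateFinset x V (update τ i s) = update (updateFinset x V τ) i s := by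
  ext j
  by_cases hj : j ∈ V
  · by_cases hji : j = i
    · subst hji; simp [updateFinset]
    · have : (⟨j, hj⟩ : V) ≠ i := fun h => hji (congrArg Subtype.val h)
      simp [updateFinset, hj, update_of_ne hji, update_of_ne this]
  · have : j ≠ i := fun h => hj (h ▸ i.2)
    simp [updateFinset, hj, update_of_ne this]

/-- The Hamiltonian in `Δ` as a function of the spins in `V`, the other spins being those of `x`. -/
noncomputable def volEnergy (Φ : Finset G → (G → S) → ℝ) (Δ V : Finset G) (x : G → S)
    (τ : V → S) : ℝ :=
  hamiltonian Φ Δ (updateFinset x V τ)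

/-- The ratio of Boltzmann weights for outside configurations `x` and `a`. -/
noncomputable def weightRatio (Φ : Finset G → (G → S) → ℝ) (Δ V : Finset G) (x a : G → S)
    (τ : V → S) : ℝ :=
  Real.exp (-(volEnergy Φ Δ V x τ - volEnergy Φ Δ V a τ))

variable [MeasurableSpace S]

/-- The ratio of partition functions in `V` for outside configurations `x` and `a`. -/
noncomputable def partitionRatio (Φ : Finset G → (G → S) → ℝ) (Δ V : Finset G) (β : G → Measure S)
    (x a : G → S) : ℝ :=
  ∫ τ, weightRatio Φ Δ V x a τ
    ∂(Measure.pi fun i : V => β i).tilted fun τ => -volEnergy Φ Δ V a τ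

variable [Countable G] (hΦ : IsInteraction Φ) (h : tripleNorm Φ < ∞)
include hΦ h

lemma volEnergy_bddMeasurable (Δ V : Finset G) (x : G → S) : BddMeasurable (volEnergy Φ Δ V x) :=
  ⟨(measurable_hamiltonian hΦ Δ).comp measurable_updateFinset, _, fun _ => abs_hamiltonian_le h Δ _⟩

lemma weightRatio_bddMeasurable (Δ V : Finset G) (x a : G → S) :
    BddMeasurable (weightRatio Φ Δ V x a) :=
  ((volEnergy_bddMeasurable hΦ h Δ V x).sub (volEnergy_bddMeasurable hΦ h Δ V a)).exp_neg

lemma lmarginal_boltzmann_eq (Δ V : Finset G) (β : G → Measure S)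
    [∀ i, IsProbabilityMeasure (β i)] (x : G → S) :
    (∫⋯∫⁻_V, boltzmann Φ Δ ∂β) x
      = ENNReal.ofReal (∫ τ, Real.exp (-volEnergy Φ Δ V x τ) ∂Measure.pi fun i : V => β i) := by
  rw [ofReal_integral_eq_lintegral_ofReal
    ((volEnergy_bddMeasurable hΦ h Δ V x).exp_neg.integrable _)
    (.of_forall fun _ => (Real.exp_pos _).le)]
  rfl

/-- Write the weight for `x` as the weight for `a` times `weightRatio`, and normalize by the
partition function for `a`. Changes of partition functions thus become expectations, to which the
comparison theorem applies. -/
lemma lmarginal_boltzmann_eq_ratio_mul (Δ V : Finset G) (β : G → Measure S)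
    [∀ i, IsProbabilityMeasure (β i)] (x a : G → S) :
    (∫⋯∫⁻_V, boltzmann Φ Δ ∂β) x
      = ENNReal.ofReal (partitionRatio Φ Δ V β x a) * (∫⋯∫⁻_V, boltzmann Φ Δ ∂β) a := by
  have hpos := integral_exp_neg_pos (volEnergy_bddMeasurable hΦ h Δ V a)
    (Measure.pi fun i : V => β i)
  rw [lmarginal_boltzmann_eq hΦ h, lmarginal_boltzmann_eq hΦ h,
    ← ENNReal.ofReal_mul' hpos.le, partitionRatio, integral_tilted_neg, div_mul_cancel₀ _ hpos.ne']
  congr 2 with τ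
  rw [weightRatio, ← Real.exp_add]
  congr 1
  ring

variable {Λ Δ V : Finset G} (hΛΔ : Λ ⊆ Δ)
include hΛΔ

omit [Countable G] in
lemma volEnergy_sub {x a : G → S} (hxa : ∀ i, i ∉ Λ → x i = a i) (τ : V → S) :
    volEnergy Φ Δ V x τ - volEnergy Φ Δ V a τ
      = hamiltonian Φ Λ (updateFinset x V τ) - hamiltonian Φ Λ (updateFinset a V τ) :=
  hamiltonian_sub_of_subset hΦ h hΛΔ fun i hi => by
    by_cases hiV : i ∈ V
    · simp [updateFinset, hiV]
    · simp [updateFinset, hiV, hxa i hi]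

omit [Countable G] in
lemma abs_volEnergy_sub_le {x a : G → S} (hxa : ∀ i, i ∉ Λ → x i = a i) (τ : V → S) :
    |volEnergy Φ Δ V x τ - volEnergy Φ Δ V a τ| ≤ 2 * (normSum Φ (Meets Λ)).toReal := by
  rw [volEnergy_sub hΦ h hΛΔ hxa]
  have h1 := abs_hamiltonian_le h Λ (updateFinset x V τ)
  have h2 := abs_hamiltonian_le h Λ (updateFinset a V τ)
  refine (abs_sub _ _).trans ?_
  linarith

/-- A lower bound independent of `Δ`, which later turns additive errors into multiplicative ones. -/
lemma le_partitionRatio (β : G → Measure S) [∀ i, IsProbabilityMeasure (β i)] {x a : G → S}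
    (hxa : ∀ i, i ∉ Λ → x i = a i) :
    Real.exp (-(2 * (normSum Φ (Meets Λ)).toReal)) ≤ partitionRatio Φ Δ V β x a := by
  have := isProbabilityMeasure_tilted_neg (volEnergy_bddMeasurable hΦ h Δ V a)
    (Measure.pi fun i : V => β i)
  calc Real.exp (-(2 * (normSum Φ (Meets Λ)).toReal))
      = ∫ _, Real.exp (-(2 * (normSum Φ (Meets Λ)).toReal))
        ∂(Measure.pi fun i : V => β i).tilted fun τ => -volEnergy Φ Δ V a τ := by simp
    _ ≤ _ := integral_mono (integrable_const _)
      ((weightRatio_bddMeasurable hΦ h Δ V x a).integrable _) fun τ => Real.exp_le_exp.mpr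
        (neg_le_neg ((le_abs_self _).trans (abs_volEnergy_sub_le hΦ h hΛΔ hxa τ)))

lemma partitionRatio_le (β : G → Measure S) [∀ i, IsProbabilityMeasure (β i)] {x a : G → S}
    (hxa : ∀ i, i ∉ Λ → x i = a i) :
    partitionRatio Φ Δ V β x a ≤ Real.exp (2 * (normSum Φ (Meets Λ)).toReal) := by
  have := isProbabilityMeasure_tilted_neg (volEnergy_bddMeasurable hΦ h Δ V a)
    (Measure.pi fun i : V => β i)
  calc partitionRatio Φ Δ V β x a ≤ ∫ _, Real.exp (2 * (normSum Φ (Meets Λ)).toReal)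
        ∂(Measure.pi fun i : V => β i).tilted fun τ => -volEnergy Φ Δ V a τ :=
        integral_mono ((weightRatio_bddMeasurable hΦ h Δ V x a).integrable _) (integrable_const _)
          fun τ => Real.exp_le_exp.mpr
            ((neg_le_abs _).trans (abs_volEnergy_sub_le hΦ h hΛΔ hxa τ))
    _ = _ := by simp

end Ratios

end Fuzzy

namespace Fuzzy

open Function

lemma one_le_expE (x : ℝ≥0∞) : 1 ≤ expE x := by
  rw [expE]
  exact EReal.one_le_exp_iff.mpr (EReal.coe_ennreal_nonneg x)

lemma expE_ofReal {x : ℝ} (hx : 0 ≤ x) : expE (ENNReal.ofReal x) = ENNReal.ofReal (Real.exp x) := by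
  rw [expE, EReal.coe_ennreal_ofReal, max_eq_left hx, EReal.exp_coe]

/-! ### Sensitivity of the partition ratios to single sites and to the boundary. -/

section Comparison

variable {G S : Type*} [DecidableEq G] {Φ : Finset G → (G → S) → ℝ}
  [MetricSpace S] [MeasurableSpace S] [Countable G]
  (hΦ : IsInteraction Φ) (h : tripleNorm Φ < ∞)
  {L : G → G → ℝ≥0} (hL : HasLipschitzVariations Φ L) {ρ : ℝ≥0∞}
  {Λ Δ V : Finset G}

include hΦ h hL in
omit [Countable G] in
-- This is where the fineness of the cells enters. The second difference involves only terms
-- containing `i`, so it equals that of `H_i`, and the Lipschitz hypothesis applies with `s` and `a`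
-- at distance at most `ρ`. The exponential factor in `cBar` is only used as a number ≥ 1.
lemma ofReal_mixed_volEnergy_le (hVΔ : V ⊆ Δ) {B : Set S} (hB : Metric.ediam B ≤ ρ) (x : G → S)
    {i j : V} {ζ ζ' : V → S} (hζ : ∀ k, k ≠ j → ζ k = ζ' k) {s a : S} (hs : s ∈ B) (ha : a ∈ B) :
    ENNReal.ofReal |volEnergy Φ Δ V x (update ζ i s) - volEnergy Φ Δ V x (update ζ' i s)
      - (volEnergy Φ Δ V x (update ζ i a) - volEnergy Φ Δ V x (update ζ' i a))|
      ≤ 2 * cBar Φ ρ L i j := by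
  simp only [volEnergy, updateFinset_update]
  set y := updateFinset x V ζ
  set y' := updateFinset x V ζ'
  have hy : ∀ k, k ≠ (j : G) → y k = y' k := fun k hk => by
    by_cases hkV : k ∈ V
    · have : (⟨k, hkV⟩ : V) ≠ j := fun h => hk (congrArg Subtype.val h)
      simp [y, y', updateFinset, hkV, hζ _ this]
    · simp [y, y', updateFinset, hkV]
  have hsub : ∀ z : G → S, hamiltonian Φ Δ (update z i s) - hamiltonian Φ Δ (update z i a)
      = hamiltonian Φ {(i : G)} (update z i s) - hamiltonian Φ {(i : G)} (update z i a) := fun z =>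
    hamiltonian_sub_of_subset hΦ h (Finset.singleton_subset_iff.mpr (hVΔ i.2)) fun k hk => by
      rw [Finset.mem_singleton] at hk
      simp [update_of_ne hk]
  have e : hamiltonian Φ Δ (update y i s) - hamiltonian Φ Δ (update y' i s)
      - (hamiltonian Φ Δ (update y i a) - hamiltonian Φ Δ (update y' i a))
      = hamiltonian Φ {(i : G)} (update y i s) - hamiltonian Φ {(i : G)} (update y' i s)
      - (hamiltonian Φ {(i : G)} (update y i a) - hamiltonian Φ {(i : G)} (update y' i a)) := by
    linarith [hsub y, hsub y']
  rw [e]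
  calc ENNReal.ofReal |_| ≤ ENNReal.ofReal (L i j * dist s a) :=
        ENNReal.ofReal_le_ofReal (hL i j y y' hy s a)
    _ = L i j * edist s a := by
        rw [ENNReal.ofReal_mul NNReal.zero_le_coe, ENNReal.ofReal_coe_nnreal, edist_dist]
    _ ≤ L i j * ρ := by gcongr; exact (Metric.edist_le_ediam_of_mem hs ha).trans hB
    _ = 2 * (ρ / 2 * 1 * L i j) := by
        rw [mul_one, ← mul_assoc, ENNReal.mul_div_cancel two_ne_zero ENNReal.ofNat_ne_top, mul_comm]
    _ ≤ 2 * cBar Φ ρ L i j := by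
        rw [cBar]
        gcongr
        exact one_le_expE _

variable {c : ℝ≥0∞} (hC : ∀ i, ∑' j, cBar Φ ρ L i j ≤ c) (hc : c < 1)

/-- Change of the partition ratio when the a priori measure is changed at one site. -/
noncomputable def siteOsc (Φ : Finset G → (G → S) → ℝ) (i k : G) : ℝ≥0∞ :=
  if k = i then 0 else ENNReal.ofReal (Real.exp (2 * (normSum Φ (Meets {i})).toReal))
    * (2 * oscAt k (pairHamiltonian Φ i k))

omit [MetricSpace S] [Countable G] [DecidableEq G] in
include hΦ h in
lemma abs_hamiltonian_singleton_sub_le {i k : G} {σ τ : G → S} (hστ : ∀ j, j ≠ k → σ j = τ j) :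
    ENNReal.ofReal |hamiltonian Φ {i} σ - hamiltonian Φ {i} τ|
      ≤ oscAt k (pairHamiltonian Φ i k) := by
  rw [hamiltonian_singleton_sub hΦ h hστ, ← Real.dist_eq, ← edist_dist]
  exact le_iSup₂_of_le σ τ (le_iSup_of_le hστ le_rfl)

omit [MetricSpace S] [Countable G] [DecidableEq G] [MeasurableSpace S] in
include h in
lemma oscAt_pairHamiltonian_lt_top (i k : G) : oscAt k (pairHamiltonian Φ i k) < ∞ := by
  have hfin : normSum Φ (fun A => i ∈ A ∧ k ∈ A) < ∞ :=
    (normSum_mono fun _ hA => hA.1).trans_lt (normSum_mem_lt_top h i)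
  refine lt_of_le_of_lt (iSup₂_le fun σ τ => iSup_le fun hστ => ?_)
    (ENNReal.ofReal_lt_top (r := 2 * (normSum Φ (fun A => i ∈ A ∧ k ∈ A)).toReal))
  rw [edist_dist, Real.dist_eq]
  exact ENNReal.ofReal_le_ofReal (abs_energy_sub_le hfin (fun _ h => h) fun A h1 h2 => absurd h1 h2)

include hΦ h hL hC hc in
-- The two ratios are means of one function under two constrained measures whose a priori measures
-- differ at most at `j`. The comparison theorem propagates this through `D k j` to the sites `k`
-- where the function oscillates.
lemma ofReal_abs_partitionRatio_sub_le_of_site {i j : G} (hiΔ : i ∈ Δ) (hVΔ : V ⊆ Δ) (hiV : i ∉ V)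
    {β β' : G → Measure S} [∀ i, IsProbabilityMeasure (β i)] [∀ i, IsProbabilityMeasure (β' i)]
    (hβ : ∀ k, k ≠ j → β k = β' k) {B : G → Set S} (hB : ∀ k, ∀ᵐ s ∂β k, s ∈ B k)
    (hBρ : ∀ k, Metric.ediam (B k) ≤ ρ) {x a : G → S} (hxa : ∀ k, k ≠ i → x k = a k) :
    ENNReal.ofReal |partitionRatio Φ Δ V β x a - partitionRatio Φ Δ V β' x a|
      ≤ ∑' k, siteOsc Φ i k * neumann (cBar Φ ρ L) k j := by
  have hiΔ' : {i} ⊆ Δ := Finset.singleton_subset_iff.mpr hiΔ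
  have hxa' : ∀ k, k ∉ ({i} : Finset G) → x k = a k := fun k hk => hxa k (by simpa using hk)
  have hU := volEnergy_bddMeasurable hΦ h Δ V a
  have main := dobrushin_comparison (β := fun k : V => β k) (β' := fun k : V => β' k) hC hc hU hU
    (weightRatio_bddMeasurable hΦ h Δ V x a) (B := fun k : V => B k) (fun k => hB k)
    -- Nothing is assumed about the two laws at `j`, so the trivial distance 1 is used there; at all
    -- other sites the single-site laws coincide.
    (b := fun k => if k = j then 1 else 0) (fun k => by split_ifs <;> simp)
    (d := siteOsc Φ i) (fun k => by
      unfold siteOsc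
      split_ifs
      · simp
      · exact ENNReal.mul_ne_top ENNReal.ofReal_ne_top
          (ENNReal.mul_ne_top ENNReal.ofNat_ne_top (oscAt_pairHamiltonian_lt_top h i k).ne))
    (fun k l ζ ζ' hζ s hs b hb => ofReal_mixed_volEnergy_le hΦ h hL hVΔ (hBρ k) a hζ hs hb)
    (fun k => by
      by_cases hkj : (k : G) = j
      · left; simp [hkj]
      · right; exact ⟨hβ k hkj, by simp⟩)
    (fun k σ τ hστ => by
      have hki : (k : G) ≠ i := fun hk => hiV (hk ▸ k.2)
      rw [siteOsc, if_neg hki]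
      have hoff : ∀ (y : G → S) (l : G), l ≠ k → updateFinset y V σ l = updateFinset y V τ l := by
        intro y l hl
        by_cases hlV : l ∈ V
        · have : (⟨l, hlV⟩ : V) ≠ k := fun h => hl (congrArg Subtype.val h)
          simp [updateFinset, hlV, hστ _ this]
        · simp [updateFinset, hlV]
      -- The exponent is the difference of `H_i` for `x` and for `a`. It is at most twice the norm
      -- sum, which bounds the slope of the exponential, and each of its two terms oscillates at `k`
      -- by at most `oscAt`; hence the factor 2 in `siteOsc`.
      have h1 := abs_exp_neg_sub_le (abs_volEnergy_sub_le hΦ h hiΔ' hxa' σ)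
        (abs_volEnergy_sub_le hΦ h hiΔ' hxa' τ)
      rw [volEnergy_sub hΦ h hiΔ' hxa', volEnergy_sub hΦ h hiΔ' hxa'] at h1
      rw [weightRatio, weightRatio, volEnergy_sub hΦ h hiΔ' hxa', volEnergy_sub hΦ h hiΔ' hxa']
      refine (ENNReal.ofReal_le_ofReal h1).trans ?_
      rw [ENNReal.ofReal_mul (Real.exp_pos _).le, two_mul (oscAt _ _)]
      gcongr
      refine le_trans (ENNReal.ofReal_le_ofReal ?_) (ENNReal.ofReal_add_le.trans (add_le_add
        (abs_hamiltonian_singleton_sub_le hΦ h (hoff x))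
        (abs_hamiltonian_singleton_sub_le hΦ h (hoff a))))
      refine le_trans (le_of_eq ?_) (abs_sub _ _)
      congr 1
      ring)
  simpa [partitionRatio] using main

/-- The bound for the change of the partition ratio under a change of the spins off `Δ`. -/
noncomputable def boundaryBound (Φ : Finset G → (G → S) → ℝ) (C : G → G → ℝ≥0∞) (Λ Δ : Finset G) :
    ℝ≥0∞ :=
  ∑' k, (ENNReal.ofReal (Real.exp (2 * (normSum Φ (Meets Λ)).toReal))
      * (4 * normSum Φ (fun A => Meets Λ A ∧ k ∈ A)))
    * ∑' j, neumann C k j * min 1 (2 * normSum Φ (fun A => j ∈ A ∧ ¬ A ⊆ Δ))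
  + ENNReal.ofReal (Real.exp (2 * (normSum Φ (Meets Λ)).toReal))
      * (4 * normSum Φ (fun A => Meets Λ A ∧ ¬ A ⊆ Δ))

omit [MetricSpace S] [MeasurableSpace S] in
include h in
-- Dominated convergence is applied twice. The inner series is dominated by a row of `D`, with sum
-- at most `(1 - c)⁻¹`; the outer one by the series of `sum_normSum_meets_and_mem_lt_top`.
lemma tendsto_boundaryBound {C : G → G → ℝ≥0∞} (hC : ∀ i, ∑' j, C i j ≤ c) (hc : c < 1)
    (Λ : Finset G) : Filter.Tendsto (boundaryBound Φ C Λ) Filter.atTop (nhds 0) := by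
  set E := ENNReal.ofReal (Real.exp (2 * (normSum Φ (Meets Λ)).toReal)) with hE
  have hEt : E ≠ ∞ := ENNReal.ofReal_ne_top
  have hct : (1 - c)⁻¹ ≠ ∞ := ENNReal.inv_ne_top.mpr (tsub_pos_of_lt hc).ne'
  have h1 : Filter.Tendsto (fun Δ => E * (4 * normSum Φ (fun A => Meets Λ A ∧ ¬ A ⊆ Δ)))
      Filter.atTop (nhds (E * (4 * 0))) :=
    ENNReal.Tendsto.const_mul (ENNReal.Tendsto.const_mul
      (tendsto_normSum_not_subset (normSum_meets_lt_top h Λ)) (Or.inr ENNReal.ofNat_ne_top))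
      (Or.inr hEt)
  have hb : ∀ j, Filter.Tendsto
      (fun Δ => min 1 (2 * normSum Φ (fun A => j ∈ A ∧ ¬ A ⊆ Δ))) Filter.atTop (nhds 0) := by
    intro j
    have := ENNReal.Tendsto.const_mul (a := 2)
      (tendsto_normSum_not_subset (normSum_mem_lt_top h j)) (Or.inr ENNReal.ofNat_ne_top)
    rw [mul_zero] at this
    exact tendsto_of_tendsto_of_tendsto_of_le_of_le tendsto_const_nhds this (fun _ => zero_le)
      fun _ => min_le_right _ _
  have hN : ∀ k, Filter.Tendsto (fun Δ => ∑' j, neumann C k j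
      * min 1 (2 * normSum Φ (fun A => j ∈ A ∧ ¬ A ⊆ Δ))) Filter.atTop (nhds 0) := by
    intro k
    have hfin : ∑' j, neumann C k j ≠ ∞ := ((tsum_neumann_le hC k).trans_lt hct.lt_top).ne
    refine tendsto_tsum_zero_of_dominated (f := neumann C k) (fun Δ j => ?_) hfin fun j => ?_
    · exact mul_le_of_le_one_right' (min_le_left _ _)
    · have := ENNReal.Tendsto.const_mul (a := neumann C k j) (hb j)
        (Or.inr ((ENNReal.le_tsum j).trans_lt hfin.lt_top).ne)
      rwa [mul_zero] at this
  have h2 : Filter.Tendsto (fun Δ => ∑' k, (E * (4 * normSum Φ (fun A => Meets Λ A ∧ k ∈ A)))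
      * ∑' j, neumann C k j * min 1 (2 * normSum Φ (fun A => j ∈ A ∧ ¬ A ⊆ Δ)))
      Filter.atTop (nhds 0) := by
    have hsum := sum_normSum_meets_and_mem_lt_top h Λ
    refine tendsto_tsum_zero_of_dominated
      (f := fun k => (E * (4 * normSum Φ (fun A => Meets Λ A ∧ k ∈ A))) * (1 - c)⁻¹)
      (fun Δ k => ?_) ?_ fun k => ?_
    · gcongr
      exact (ENNReal.tsum_le_tsum fun j => mul_le_of_le_one_right' (min_le_left _ _)).trans
        (tsum_neumann_le hC k)
    · rw [ENNReal.tsum_mul_right, ENNReal.tsum_mul_left, ENNReal.tsum_mul_left]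
      exact ENNReal.mul_ne_top (ENNReal.mul_ne_top hEt
        (ENNReal.mul_ne_top ENNReal.ofNat_ne_top hsum.ne)) hct
    · have := ENNReal.Tendsto.const_mul (a := E * (4 * normSum Φ (fun A => Meets Λ A ∧ k ∈ A)))
        (hN k) (Or.inr (ENNReal.mul_ne_top hEt (ENNReal.mul_ne_top ENNReal.ofNat_ne_top
          ((ENNReal.le_tsum k).trans_lt hsum).ne)))
      rwa [mul_zero] at this
  have := h2.add h1
  rw [mul_zero, mul_zero, add_zero] at this
  exact this

include hΦ h hL hC hc in
-- A change of the spins off `Δ` acts in two ways: on the constrained measure, which the comparison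
-- theorem handles, and on the Boltzmann factor itself. The two summands of `boundaryBound`
-- correspond to these effects.
lemma ofReal_abs_partitionRatio_sub_le_of_boundary (hΛΔ : Λ ⊆ Δ) (hVΔ : V = Δ \ Λ)
    {β : G → Measure S} [∀ i, IsProbabilityMeasure (β i)]
    {B : G → Set S} (hB : ∀ k, ∀ᵐ s ∂β k, s ∈ B k)
    (hBρ : ∀ k, Metric.ediam (B k) ≤ ρ) {x a x' a' : G → S} (hxa : ∀ k, k ∉ Λ → x k = a k)
    (hxa' : ∀ k, k ∉ Λ → x' k = a' k) (hx : ∀ k ∈ Λ, x k = x' k) (ha : ∀ k ∈ Λ, a k = a' k) :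
    ENNReal.ofReal |partitionRatio Φ Δ V β x a - partitionRatio Φ Δ V β x' a'|
      ≤ boundaryBound Φ (cBar Φ ρ L) Λ Δ := by
  have hVsub : V ⊆ Δ := hVΔ ▸ Finset.sdiff_subset
  have hVΛ : ∀ k ∈ V, k ∉ Λ := fun k hk => by
    rw [hVΔ, Finset.mem_sdiff] at hk; exact hk.2
  have hU := volEnergy_bddMeasurable hΦ h Δ V a
  have hU' := volEnergy_bddMeasurable hΦ h Δ V a'
  have hsum := sum_normSum_meets_and_mem_lt_top h Λ
  set M := 2 * (normSum Φ (Meets Λ)).toReal with hM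
  have hon : ∀ {y y' : G → S}, (∀ k ∈ Λ, y k = y' k) → ∀ (τ : V → S), ∀ k ∈ Δ,
      updateFinset y V τ k = updateFinset y' V τ k := by
    intro y y' hy τ k hk
    by_cases hkV : k ∈ V
    · simp [updateFinset, hkV]
    · have : k ∈ Λ := by
        by_contra hkΛ
        exact hkV (by rw [hVΔ]; exact Finset.mem_sdiff.mpr ⟨hk, hkΛ⟩)
      simp [updateFinset, hkV, hy k this]
  have toE : ∀ {P : Finset G → Prop}, normSum Φ P < ∞ → ENNReal.ofReal (4 * (normSum Φ P).toReal)
      = 4 * normSum Φ P := by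
    intro P hP
    rw [ENNReal.ofReal_mul (by norm_num), ENNReal.ofReal_toReal hP.ne]
    simp
  have main := dobrushin_comparison (β := fun k : V => β k) (β' := fun k : V => β k) hC hc hU hU'
    (weightRatio_bddMeasurable hΦ h Δ V x a) (B := fun k : V => B k) (fun k => hB k)
    (b := fun j => min 1 (2 * normSum Φ (fun A => j ∈ A ∧ ¬ A ⊆ Δ)))
    (fun k => ((min_le_left _ _).trans_lt ENNReal.one_lt_top).ne)
    (d := fun k => ENNReal.ofReal (Real.exp M) * (4 * normSum Φ (fun A => Meets Λ A ∧ k ∈ A)))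
    (fun k => ENNReal.mul_ne_top ENNReal.ofReal_ne_top (ENNReal.mul_ne_top ENNReal.ofNat_ne_top
      ((ENNReal.le_tsum k).trans_lt hsum).ne))
    (fun k l ζ ζ' hζ s hs b hb => ofReal_mixed_volEnergy_le hΦ h hL hVsub (hBρ k) a hζ hs hb)
    (fun k => by
      -- Near the boundary of `Δ` the tail may exceed 1, and there the trivial estimate is taken.
      -- The truncation at 1 also provides the domination used in the limit of large `Δ`.
      by_cases hk1 : 1 ≤ 2 * normSum Φ (fun A => (k : G) ∈ A ∧ ¬ A ⊆ Δ)
      · left; simp [hk1]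
      · refine Or.inr ⟨rfl, fun ζ s _ b _ => ?_⟩
        rw [min_eq_right (le_of_not_ge hk1)]
        have hfin : normSum Φ (fun A => (k : G) ∈ A ∧ ¬ A ⊆ Δ) < ∞ :=
          (normSum_mono fun _ hA => hA.1).trans_lt (normSum_mem_lt_top h k)
        have hsub : ∀ z : G → S, hamiltonian Φ Δ (update z k s) - hamiltonian Φ Δ (update z k b)
            = hamiltonian Φ {(k : G)} (update z k s) - hamiltonian Φ {(k : G)} (update z k b) :=
          fun z => hamiltonian_sub_of_subset hΦ h
            (Finset.singleton_subset_iff.mpr (hVsub k.2)) fun l hl => by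
              rw [Finset.mem_singleton] at hl
              simp [update_of_ne hl]
        have hbd : ∀ t : S, |hamiltonian Φ {(k : G)} (update (updateFinset a V ζ) k t)
            - hamiltonian Φ {(k : G)} (update (updateFinset a' V ζ) k t)|
            ≤ 2 * (normSum Φ (fun A => (k : G) ∈ A ∧ ¬ A ⊆ Δ)).toReal := by
          intro t
          have := abs_hamiltonian_sub_le_of_eq_on hΦ h (Λ := {(k : G)}) (Δ := Δ)
            (σ := update (updateFinset a V ζ) k t) (τ := update (updateFinset a' V ζ) k t)
            (fun l hl => by
              rw [← updateFinset_update, ← updateFinset_update]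
              exact hon ha _ l hl)
          simpa only [meets_singleton] using this
        rw [← mul_assoc, show (2 : ℝ≥0∞) * 2 = 4 by norm_num, ← toE hfin]
        refine ENNReal.ofReal_le_ofReal ?_
        simp only [volEnergy, updateFinset_update]
        have h1 := hbd s
        have h2 := hbd b
        have h3 := hsub (updateFinset a V ζ)
        have h4 := hsub (updateFinset a' V ζ)
        rw [abs_le] at *
        constructor <;> linarith)
    (fun k σ τ hστ => by
      have hoff : ∀ (y : G → S) (l : G), l ≠ k → updateFinset y V σ l = updateFinset y V τ l := by
        intro y l hl
        by_cases hlV : l ∈ V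
        · have : (⟨l, hlV⟩ : V) ≠ k := fun h => hl (congrArg Subtype.val h)
          simp [updateFinset, hlV, hστ _ this]
        · simp [updateFinset, hlV]
      have h1 := abs_exp_neg_sub_le (abs_volEnergy_sub_le hΦ h hΛΔ hxa σ)
        (abs_volEnergy_sub_le hΦ h hΛΔ hxa τ)
      rw [volEnergy_sub hΦ h hΛΔ hxa, volEnergy_sub hΦ h hΛΔ hxa] at h1
      rw [weightRatio, weightRatio, volEnergy_sub hΦ h hΛΔ hxa, volEnergy_sub hΦ h hΛΔ hxa]
      refine (ENNReal.ofReal_le_ofReal h1).trans ?_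
      rw [ENNReal.ofReal_mul (Real.exp_pos _).le, ← toE ((ENNReal.le_tsum (k : G)).trans_lt hsum)]
      gcongr
      have h2 := abs_hamiltonian_sub_le_of_eq_off hΦ h (Λ := Λ) (hoff x)
      have h3 := abs_hamiltonian_sub_le_of_eq_off hΦ h (Λ := Λ) (hoff a)
      rw [abs_le] at *
      constructor <;> linarith)
  have pr := isProbabilityMeasure_tilted_neg hU' (Measure.pi fun k : V => β k)
  have second : ENNReal.ofReal |∫ τ, weightRatio Φ Δ V x a τ
        ∂(Measure.pi fun i : V => β i).tilted (fun τ => -volEnergy Φ Δ V a' τ)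
      - partitionRatio Φ Δ V β x' a'|
      ≤ ENNReal.ofReal (Real.exp M) * (4 * normSum Φ (fun A => Meets Λ A ∧ ¬ A ⊆ Δ)) := by
    rw [partitionRatio, ← integral_sub ((weightRatio_bddMeasurable hΦ h Δ V x a).integrable _)
      ((weightRatio_bddMeasurable hΦ h Δ V x' a').integrable _),
      ← toE ((normSum_mono fun _ hA => hA.1).trans_lt (normSum_meets_lt_top h Λ)),
      ← ENNReal.ofReal_mul (Real.exp_pos _).le]
    refine ENNReal.ofReal_le_ofReal (abs_integral_le_of_forall fun τ => ?_)
    refine (abs_exp_neg_sub_le (abs_volEnergy_sub_le hΦ h hΛΔ hxa τ)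
      (abs_volEnergy_sub_le hΦ h hΛΔ hxa' τ)).trans ?_
    rw [volEnergy_sub hΦ h hΛΔ hxa, volEnergy_sub hΦ h hΛΔ hxa']
    gcongr
    have h2 := abs_hamiltonian_sub_le_of_eq_on hΦ h (Λ := Λ) (hon hx τ)
    have h3 := abs_hamiltonian_sub_le_of_eq_on hΦ h (Λ := Λ) (hon ha τ)
    rw [abs_le] at *
    constructor <;> linarith
  refine le_trans (ENNReal.ofReal_le_ofReal (abs_sub_le _ _ _))
    (ENNReal.ofReal_add_le.trans (add_le_add main second))

end Comparison

end Fuzzy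

namespace Fuzzy

open Function ProbabilityTheory

/-! ### Partition functions constrained by an image configuration. -/

section PiKernel

variable {ι S S' : Type*} [Fintype ι] [MeasurableSpace S] [MeasurableSpace S']

/-- The product of copies of a Markov kernel. -/
noncomputable def piKernel (ι : Type*) [Fintype ι] (K : Kernel S' S) [IsMarkovKernel K] :
    Kernel (ι → S') (ι → S) where
  toFun η := Measure.pi fun i => K (η i)
  measurable' := by
    refine Measurable.measure_of_isPiSystem_of_isProbabilityMeasure generateFrom_pi.symm
      isPiSystem_pi ?_
    rintro _ ⟨s, hs, rfl⟩
    simp only [Measure.pi_pi]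
    exact Finset.measurable_prod _ fun i _ =>
      (K.measurable_coe (hs i (Set.mem_univ i))).comp (measurable_pi_apply i)

lemma piKernel_apply (K : Kernel S' S) [IsMarkovKernel K] (η : ι → S') :
    piKernel ι K η = Measure.pi fun i => K (η i) := rfl

instance (K : Kernel S' S) [IsMarkovKernel K] : IsMarkovKernel (piKernel ι K) :=
  ⟨fun η => by rw [piKernel_apply]; infer_instance⟩

end PiKernel

/-- Reduces a cross-ratio inequality between integrals to a pointwise one, by writing both products
as double integrals over `μ` and `ν`. -/
lemma lintegral_mul_lintegral_le {X : Type*} [MeasurableSpace X] {μ ν : Measure X} {f g : X → ℝ≥0∞}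
    (hf : Measurable f) (hg : Measurable g) {κ : ℝ≥0∞} (h : ∀ x y, f x * g y ≤ κ * (g x * f y)) :
    (∫⁻ x, f x ∂μ) * ∫⁻ y, g y ∂ν ≤ κ * ((∫⁻ x, g x ∂μ) * ∫⁻ y, f y ∂ν) := by
  calc (∫⁻ x, f x ∂μ) * ∫⁻ y, g y ∂ν = ∫⁻ x, ∫⁻ y, f x * g y ∂ν ∂μ := by
        rw [← lintegral_mul_const _ hf]
        exact lintegral_congr fun x => (lintegral_const_mul _ hg).symm
    _ ≤ ∫⁻ x, ∫⁻ y, κ * (g x * f y) ∂ν ∂μ := lintegral_mono fun x => lintegral_mono fun y => h x y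
    _ = κ * ((∫⁻ x, g x ∂μ) * ∫⁻ y, f y ∂ν) := by
        rw [← lintegral_mul_const _ hg, ← lintegral_const_mul _ (hg.mul_const _)]
        refine lintegral_congr fun x => ?_
        rw [lintegral_const_mul _ (hf.const_mul _), lintegral_const_mul _ hf]

section PartitionFunction

variable {G S S' : Type*} [DecidableEq G] [MeasurableSpace S'] [MeasurableSpace S]
  {Φ : Finset G → (G → S) → ℝ}

lemma lmarginal_congr_measure {β β' : G → Measure S} {V : Finset G} (hβ : ∀ i ∈ V, β i = β' i)
    (f : (G → S) → ℝ≥0∞) : ∫⋯∫⁻_V, f ∂β = ∫⋯∫⁻_V, f ∂β' := by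
  have : (fun i : V => β i) = fun i : V => β' i := funext fun i => hβ i i.2
  ext x
  simp only [lmarginal, this]

/-- Functions that do not depend on the spins in `V` can be taken out of a marginal integral. -/
lemma lmarginal_mul_left {β : G → Measure S} {V : Finset G} {f g : (G → S) → ℝ≥0∞}
    (hf : Measurable f) (hg : ∀ x y, (∀ i, i ∉ V → x i = y i) → g x = g y) (x : G → S) :
    (∫⋯∫⁻_V, (fun σ => g σ * f σ) ∂β) x = g x * (∫⋯∫⁻_V, f ∂β) x := by
  simp only [lmarginal]
  rw [← lintegral_const_mul (g x)
    (show Measurable fun y => f (updateFinset x V y) from hf.comp measurable_updateFinset)]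
  refine lintegral_congr fun y => ?_
  rw [hg (updateFinset x V y) x fun i hi => by simp [updateFinset, hi]]

/-- The partition function in `Δ`, with boundary condition `ω` off `Δ`, under the constraint that
the images of the spins in `Δ` are given by `η`. -/
noncomputable def constrainedPartition (Φ : Finset G → (G → S) → ℝ) (K : Kernel S' S)
    (Δ : Finset G) (ω : G → S) (η : G → S') : ℝ≥0∞ :=
  (∫⋯∫⁻_Δ, boltzmann Φ Δ ∂fun i => K (η i)) ω

lemma constrainedPartition_congr {K : Kernel S' S} {Δ : Finset G} {ω : G → S} {η η' : G → S'}
    (hη : ∀ i ∈ Δ, η i = η' i) :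
    constrainedPartition Φ K Δ ω η = constrainedPartition Φ K Δ ω η' := by
  rw [constrainedPartition, constrainedPartition,
    lmarginal_congr_measure (β' := fun i => K (η' i)) fun i hi => by rw [hη i hi]]

/-- Enlarging the volume multiplies the Boltzmann weight by a function of the spins off the smaller
volume. -/
lemma boltzmann_eq_mul {G S : Type*} {Φ : Finset G → (G → S) → ℝ} (Δ₀ Δ : Finset G) (σ : G → S) :
    boltzmann Φ Δ σ
      = ENNReal.ofReal (Real.exp (-(hamiltonian Φ Δ σ - hamiltonian Φ Δ₀ σ))) * boltzmann Φ Δ₀ σ := by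
  rw [boltzmann, boltzmann, ← ENNReal.ofReal_mul (Real.exp_pos _).le, ← Real.exp_add]
  congr 2
  ring

variable [Countable G] (hΦ : IsInteraction Φ) (h : tripleNorm Φ < ∞)
  {K : Kernel S' S} [IsMarkovKernel K]

include hΦ in
lemma measurable_constrainedPartition (Δ : Finset G) (ω : G → S) :
    Measurable (constrainedPartition Φ K Δ ω) := by
  have h1 : Measurable fun η : Δ → S' =>
      ∫⁻ σ, boltzmann Φ Δ (updateFinset ω Δ σ) ∂piKernel Δ K η :=
    ((measurable_boltzmann hΦ Δ).comp measurable_updateFinset).lintegral_kernel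
  exact h1.comp (Finset.measurable_restrict Δ)

include hΦ h

lemma lmarginal_boltzmann_pos (Δ V : Finset G) (β : G → Measure S)
    [∀ i, IsProbabilityMeasure (β i)] (x : G → S) : (∫⋯∫⁻_V, boltzmann Φ Δ ∂β) x ≠ 0 := by
  rw [lmarginal_boltzmann_eq hΦ h, Ne, ENNReal.ofReal_eq_zero, not_le]
  exact integral_exp_neg_pos (volEnergy_bddMeasurable hΦ h Δ V x) _

lemma lmarginal_boltzmann_ne_top (Δ V : Finset G) (β : G → Measure S)
    [∀ i, IsProbabilityMeasure (β i)] (x : G → S) : (∫⋯∫⁻_V, boltzmann Φ Δ ∂β) x ≠ ∞ := by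
  rw [lmarginal_boltzmann_eq hΦ h]
  exact ENNReal.ofReal_ne_top

lemma constrainedPartition_ne_zero (Δ : Finset G) (ω : G → S) (η : G → S') :
    constrainedPartition Φ K Δ ω η ≠ 0 :=
  lmarginal_boltzmann_pos hΦ h Δ Δ _ _

lemma constrainedPartition_ne_top (Δ : Finset G) (ω : G → S) (η : G → S') :
    constrainedPartition Φ K Δ ω η ≠ ∞ :=
  lmarginal_boltzmann_ne_top hΦ h Δ Δ _ _

omit h in
lemma constrainedPartition_eq_lintegral {Λ Δ : Finset G} (hΛΔ : Λ ⊆ Δ) (ω : G → S) (η : G → S') :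
    constrainedPartition Φ K Δ ω η
      = ∫⁻ σ, (∫⋯∫⁻_Δ \ Λ, boltzmann Φ Δ ∂fun i => K (η i)) (updateFinset ω Λ σ)
        ∂Measure.pi fun i : Λ => K (η i) := by
  rw [constrainedPartition]
  conv_lhs => rw [← Finset.union_sdiff_of_subset hΛΔ]
  rw [lmarginal_union _ _ (by
    rw [Finset.union_sdiff_of_subset hΛΔ]; exact measurable_boltzmann hΦ Δ)
    Finset.disjoint_sdiff]
  simp only [Finset.union_sdiff_of_subset hΛΔ]
  rfl

omit h in
lemma measurable_lmarginal_updateFinset (Λ Δ V : Finset G) (β : G → Measure S)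
    [∀ i, IsProbabilityMeasure (β i)] (ω : G → S) :
    Measurable fun σ : Λ → S => (∫⋯∫⁻_V, boltzmann Φ Δ ∂β) (updateFinset ω Λ σ) :=
  ((measurable_boltzmann hΦ Δ).lmarginal β).comp measurable_updateFinset

/-- Integrating out `Δ \ Λ` leaves the same function of the spins in `Λ` for `η` and `η'`. Any two
of its values differ by at most the factor `M`, so its means under any two probability measures do
too. -/
lemma constrainedPartition_le {Λ Δ : Finset G} (hΛΔ : Λ ⊆ Δ) (ω : G → S) {η η' : G → S'}
    (hη : ∀ i, i ∉ Λ → η i = η' i) :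
    constrainedPartition Φ K Δ ω η
      ≤ ENNReal.ofReal (Real.exp (2 * (normSum Φ (Meets Λ)).toReal))
        * constrainedPartition Φ K Δ ω η' := by
  set M := ENNReal.ofReal (Real.exp (2 * (normSum Φ (Meets Λ)).toReal))
  rw [constrainedPartition_eq_lintegral hΦ hΛΔ, constrainedPartition_eq_lintegral hΦ hΛΔ,
    lmarginal_congr_measure (β' := fun i => K (η' i)) fun i hi => by
      rw [hη i (Finset.mem_sdiff.mp hi).2]]
  set Y := ∫⋯∫⁻_Δ \ Λ, boltzmann Φ Δ ∂fun i => K (η' i) with hY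
  have hYm := measurable_lmarginal_updateFinset hΦ Λ Δ (Δ \ Λ) (fun i => K (η' i)) ω
  have key : ∀ σ τ : Λ → S, Y (updateFinset ω Λ σ) ≤ M * Y (updateFinset ω Λ τ) := by
    intro σ τ
    rw [hY, lmarginal_boltzmann_eq_ratio_mul hΦ h Δ (Δ \ Λ) _ (updateFinset ω Λ σ)
      (updateFinset ω Λ τ)]
    gcongr
    exact ENNReal.ofReal_le_ofReal
      (partitionRatio_le hΦ h hΛΔ _ fun i hi => by simp [updateFinset, hi])
  calc ∫⁻ σ, Y (updateFinset ω Λ σ) ∂Measure.pi (fun i : Λ => K (η i))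
      ≤ ∫⁻ σ, ∫⁻ τ, M * Y (updateFinset ω Λ τ) ∂Measure.pi (fun i : Λ => K (η' i))
        ∂Measure.pi (fun i : Λ => K (η i)) := by
        refine lintegral_mono fun σ => ?_
        calc Y (updateFinset ω Λ σ)
            = ∫⁻ _, Y (updateFinset ω Λ σ) ∂Measure.pi (fun i : Λ => K (η' i)) := by simp
          _ ≤ _ := lintegral_mono fun τ => key σ τ
    _ = M * ∫⁻ τ, Y (updateFinset ω Λ τ) ∂Measure.pi (fun i : Λ => K (η' i)) := by
        rw [lintegral_const, measure_univ, mul_one, lintegral_const_mul _ hYm]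

/-- Since `H_Δ - H_Δ₀` does not depend on the spins in `Δ₀`, the larger partition function is a
mixture of those in `Δ₀` over the boundary spins in `Δ \ Δ₀`. -/
lemma constrainedPartition_eq_lintegral_mul {Δ₀ Δ : Finset G} (hΔ : Δ₀ ⊆ Δ) (ω : G → S)
    (η : G → S') :
    constrainedPartition Φ K Δ ω η
      = ∫⁻ τ, ENNReal.ofReal (Real.exp (-(hamiltonian Φ Δ (updateFinset ω (Δ \ Δ₀) τ)
          - hamiltonian Φ Δ₀ (updateFinset ω (Δ \ Δ₀) τ))))
          * constrainedPartition Φ K Δ₀ (updateFinset ω (Δ \ Δ₀) τ) η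
        ∂Measure.pi fun i : (Δ \ Δ₀ : Finset G) => K (η i) := by
  have hm : Measurable fun σ => ENNReal.ofReal (Real.exp (-(hamiltonian Φ Δ σ
      - hamiltonian Φ Δ₀ σ))) * boltzmann Φ Δ₀ σ :=
    ((measurable_hamiltonian hΦ Δ).sub (measurable_hamiltonian hΦ Δ₀)).neg.exp.ennreal_ofReal.mul
      (measurable_boltzmann hΦ Δ₀)
  have hb : boltzmann Φ Δ = fun σ => ENNReal.ofReal (Real.exp (-(hamiltonian Φ Δ σ
      - hamiltonian Φ Δ₀ σ))) * boltzmann Φ Δ₀ σ := funext fun σ => boltzmann_eq_mul Δ₀ Δ σ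
  rw [constrainedPartition, hb]
  conv_lhs => rw [← Finset.sdiff_union_of_subset hΔ]
  rw [lmarginal_union _ _ (by rw [Finset.sdiff_union_of_subset hΔ]; exact hm)
    Finset.sdiff_disjoint]
  rw [Finset.sdiff_union_of_subset hΔ, lmarginal]
  refine lintegral_congr fun τ => ?_
  rw [lmarginal_mul_left (measurable_boltzmann hΦ Δ₀)
    (g := fun σ => ENNReal.ofReal (Real.exp (-(hamiltonian Φ Δ σ - hamiltonian Φ Δ₀ σ))))]
  · rfl
  · intro x y hxy
    have := hamiltonian_sub_of_subset hΦ h hΔ hxy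
    congr 3
    linarith

end PartitionFunction

/-! ### Asymptotic independence of the boundary condition and of the volume. -/

section CrossRatio

variable {G S S' : Type*} [DecidableEq G] [Countable G] [MeasurableSpace S'] [MetricSpace S]
  [MeasurableSpace S] {Φ : Finset G → (G → S) → ℝ}
  (hΦ : IsInteraction Φ) (h : tripleNorm Φ < ∞) {L : G → G → ℝ≥0}
  (hL : HasLipschitzVariations Φ L) {ρ : ℝ≥0∞} {c : ℝ≥0∞}
  (hC : ∀ i, ∑' j, cBar Φ ρ L i j ≤ c) (hc : c < 1)
  {K : Kernel S' S} [IsMarkovKernel K]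
  {B : S' → Set S} (hB : ∀ s', ∀ᵐ s ∂K s', s ∈ B s') (hBρ : ∀ s', Metric.ediam (B s') ≤ ρ)

include hΦ h hL hC hc hB hBρ

/-- For large volumes, ratios of constrained partition functions hardly depend on the boundary
condition. -/
lemma exists_constrainedPartition_cross (Λ : Finset G) {κ : ℝ≥0} (hκ : 1 < κ) :
    ∃ Δ, Λ ⊆ Δ ∧ ∀ (ω ω' : G → S) (η η' : G → S'), (∀ i, i ∉ Λ → η i = η' i) →
      constrainedPartition Φ K Δ ω η * constrainedPartition Φ K Δ ω' η'
        ≤ κ * (constrainedPartition Φ K Δ ω' η * constrainedPartition Φ K Δ ω η') := by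
  set M := 2 * (normSum Φ (Meets Λ)).toReal with hM
  have hκ' : (1 : ℝ) < κ := by exact_mod_cast hκ
  -- Partition ratios are at least `exp(-M)`, so an additive error of this size is a multiplicative
  -- error of at most `κ`.
  set ε : ℝ := (κ - 1) * Real.exp (-M) with hε
  have hε0 : 0 < ε := mul_pos (by linarith) (Real.exp_pos _)
  have hev := (tendsto_boundaryBound h hC hc Λ).eventually_le_const
    (ENNReal.ofReal_pos.mpr hε0)
  obtain ⟨Δ, hΔε, hΛΔ⟩ := (hev.and (Filter.eventually_ge_atTop Λ)).exists
  have hΛΔ : Λ ⊆ Δ := hΛΔ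
  refine ⟨Δ, hΛΔ, fun ω ω' η η' hη => ?_⟩
  rw [constrainedPartition_eq_lintegral hΦ hΛΔ, constrainedPartition_eq_lintegral hΦ hΛΔ,
    constrainedPartition_eq_lintegral hΦ hΛΔ, constrainedPartition_eq_lintegral hΦ hΛΔ,
    lmarginal_congr_measure (β := fun i => K (η i)) (β' := fun i => K (η' i)) fun i hi => by
      rw [hη i (Finset.mem_sdiff.mp hi).2]]
  refine lintegral_mul_lintegral_le (measurable_lmarginal_updateFinset hΦ _ _ _ _ _)
    (measurable_lmarginal_updateFinset hΦ _ _ _ _ _) fun σ τ => ?_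
  have hoff : ∀ (ω : G → S) i, i ∉ Λ → updateFinset ω Λ σ i = updateFinset ω Λ τ i :=
    fun ω i hi => by simp [updateFinset, hi]
  have hon : ∀ (σ : Λ → S), ∀ i ∈ Λ, updateFinset ω Λ σ i = updateFinset ω' Λ σ i :=
    fun σ i hi => by simp [updateFinset, hi]
  have h1 := ofReal_abs_partitionRatio_sub_le_of_boundary hΦ h hL hC hc hΛΔ rfl
    (β := fun i => K (η' i)) (B := fun i => B (η' i)) (fun i => hB _) (fun i => hBρ _)
    (hoff ω) (hoff ω') (hon σ) (hon τ)
  have h2 := le_partitionRatio hΦ h hΛΔ (V := Δ \ Λ) (fun i => K (η' i)) (hoff ω')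
  have h3 := (ENNReal.ofReal_le_ofReal_iff hε0.le).mp (h1.trans hΔε)
  have h4 : partitionRatio Φ Δ (Δ \ Λ) (fun i => K (η' i)) (updateFinset ω Λ σ)
      (updateFinset ω Λ τ) ≤ κ * partitionRatio Φ Δ (Δ \ Λ) (fun i => K (η' i))
        (updateFinset ω' Λ σ) (updateFinset ω' Λ τ) := by
    have := (abs_le.mp h3).2
    nlinarith [mul_le_mul_of_nonneg_left h2 (by linarith : (0 : ℝ) ≤ κ - 1)]
  rw [lmarginal_boltzmann_eq_ratio_mul hΦ h Δ (Δ \ Λ) _ (updateFinset ω Λ σ) (updateFinset ω Λ τ),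
    lmarginal_boltzmann_eq_ratio_mul hΦ h Δ (Δ \ Λ) _ (updateFinset ω' Λ σ)
      (updateFinset ω' Λ τ)]
  have h5 := ENNReal.ofReal_le_ofReal h4
  rw [ENNReal.ofReal_mul NNReal.zero_le_coe, ENNReal.ofReal_coe_nnreal] at h5
  calc _ ≤ (κ * ENNReal.ofReal _) * _ * _ := by gcongr
    _ = _ := by ring

/-- For large volumes, ratios of constrained partition functions hardly depend on the volume and on
the boundary condition. -/
lemma exists_constrainedPartition_cross_volume (Λ : Finset G) {κ : ℝ≥0} (hκ : 1 < κ) :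
    ∃ Δ₀, Λ ⊆ Δ₀ ∧ ∀ Δ, Δ₀ ⊆ Δ → ∀ (ω ω' : G → S) (η η' : G → S'), (∀ i, i ∉ Λ → η i = η' i) →
      constrainedPartition Φ K Δ ω η * constrainedPartition Φ K Δ₀ ω' η'
        ≤ κ * (constrainedPartition Φ K Δ₀ ω' η * constrainedPartition Φ K Δ ω η') := by
  obtain ⟨Δ₀, hΛ, hcross⟩ :=
    exists_constrainedPartition_cross hΦ h hL hC hc hB hBρ Λ hκ
  refine ⟨Δ₀, hΛ, fun Δ hΔ ω ω' η η' hη => ?_⟩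
  rw [constrainedPartition_eq_lintegral_mul hΦ h hΔ ω η,
    constrainedPartition_eq_lintegral_mul hΦ h hΔ ω η']
  -- The mixing measure, like the mixing weight, does not see `Λ`, hence is the same for `η` and
  -- `η'`. The inequality in `Δ₀`, which is uniform in the boundary spins, can be integrated over
  -- it.
  have e : (fun i : (Δ \ Δ₀ : Finset G) => K (η i)) = fun i : (Δ \ Δ₀ : Finset G) => K (η' i) :=
    funext fun i => by rw [hη i fun hi => (Finset.mem_sdiff.mp i.2).2 (hΛ hi)]
  rw [e, ← lintegral_mul_const' _ _ (constrainedPartition_ne_top hΦ h Δ₀ _ _), ← mul_assoc,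
    ← lintegral_const_mul' _ _ (ENNReal.mul_ne_top ENNReal.coe_ne_top
      (constrainedPartition_ne_top hΦ h Δ₀ _ _))]
  refine lintegral_mono fun τ => ?_
  have hτ := hcross (updateFinset ω (Δ \ Δ₀) τ) ω' η η' hη
  generalize ENNReal.ofReal (Real.exp _) = w
  calc _ = w * (constrainedPartition Φ K Δ₀ (updateFinset ω (Δ \ Δ₀) τ) η
        * constrainedPartition Φ K Δ₀ ω' η') := mul_assoc _ _ _
    _ ≤ w * (κ * (constrainedPartition Φ K Δ₀ ω' η
        * constrainedPartition Φ K Δ₀ (updateFinset ω (Δ \ Δ₀) τ) η')) := by gcongr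
    _ = _ := by ring

end CrossRatio

end Fuzzy

namespace Fuzzy

open Function

/-! ### Infinite-volume densities and the image specification. -/

section ENNRealLemmas

/-- Every passage to infinite volume has this form: each replacement of a limit density by a
finite-volume one costs a factor `κ`, and `κ` tends to 1 along `1 + 1/m`. -/
lemma le_of_forall_one_lt_pow_mul {a b : ℝ≥0∞} (n : ℕ)
    (h : ∀ κ : ℝ≥0, 1 < κ → a ≤ (κ : ℝ≥0∞) ^ n * b) : a ≤ b := by
  have h1 : Filter.Tendsto (fun m : ℕ => ((1 : ℝ≥0∞) + (m : ℝ≥0∞)⁻¹)) Filter.atTop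
      (nhds (1 + 0)) := tendsto_const_nhds.add ENNReal.tendsto_inv_nat_nhds_zero
  rw [add_zero] at h1
  have h2 := ENNReal.Tendsto.mul_const (b := b) (ENNReal.Tendsto.pow (n := n) h1) (Or.inl (by simp))
  rw [one_pow, one_mul] at h2
  refine ge_of_tendsto h2 ?_
  filter_upwards [Filter.eventually_gt_atTop 0] with m hm
  have hm' : (m : ℝ≥0) ≠ 0 := by exact_mod_cast hm.ne'
  have := h (1 + (m : ℝ≥0)⁻¹) (by simpa using hm)
  simpa [ENNReal.coe_inv hm'] using this

lemma div_le_mul_div_of_mul_le {a b c d κ : ℝ≥0∞} (hb : b ≠ 0) (hb' : b ≠ ∞) (hd : d ≠ 0)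
    (hd' : d ≠ ∞) (h : a * d ≤ κ * (c * b)) : a / b ≤ κ * (c / d) := by
  rw [ENNReal.div_le_iff hb hb']
  have : a ≤ κ * (c * b) / d := (ENNReal.le_div_iff_mul_le (Or.inl hd) (Or.inl hd')).mpr h
  refine this.trans_eq ?_
  simp only [div_eq_mul_inv]
  ring

end ENNRealLemmas

section ImageSpecification

variable {G E Ω : Type*} [DecidableEq G] [MeasurableSpace E]

/-- A system of partition functions `z Δ ω η`, constrained by `η` in the volume `Δ`, whose ratios
become independent of the boundary condition `ω` and of the volume as `Δ` grows. -/
structure IsPartitionSystem (z : Finset G → Ω → (G → E) → ℝ≥0∞) : Prop where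
  measurable : ∀ Δ ω, Measurable (z Δ ω)
  congr : ∀ Δ ω η η', (∀ i ∈ Δ, η i = η' i) → z Δ ω η = z Δ ω η'
  ne_zero : ∀ Δ ω η, z Δ ω η ≠ 0
  ne_top : ∀ Δ ω η, z Δ ω η ≠ ∞
  bound : ∀ Λ : Finset G, ∃ M : ℝ≥0, 0 < M ∧ ∀ Δ, Λ ⊆ Δ → ∀ ω η η', (∀ i, i ∉ Λ → η i = η' i) →
    z Δ ω η ≤ M * z Δ ω η'
  cross : ∀ (Λ : Finset G) (κ : ℝ≥0), 1 < κ → ∃ Δ₀, Λ ⊆ Δ₀ ∧ ∀ Δ, Δ₀ ⊆ Δ → ∀ ω ω' η η',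
    (∀ i, i ∉ Λ → η i = η' i) → z Δ ω η * z Δ₀ ω' η' ≤ κ * (z Δ₀ ω' η * z Δ ω η')

lemma marginal_congr {lam : Measure E} (Λ : Finset G) (f : (G → E) → ℝ≥0∞) (x y : G → E)
    (hxy : ∀ i, i ∉ Λ → x i = y i) :
    (∫⋯∫⁻_Λ, f ∂fun _ => lam) x = (∫⋯∫⁻_Λ, f ∂fun _ => lam) y :=
  lmarginal_congr _ f hxy

variable (z : Finset G → Ω → (G → E) → ℝ≥0∞) (lam : Measure E)

/-- The density of the conditional distribution in `Λ` in the finite volume `Δ`. -/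
noncomputable def condDensity (Λ Δ : Finset G) (ω : Ω) (η : G → E) : ℝ≥0∞ :=
  z Δ ω η / (∫⋯∫⁻_Λ, z Δ ω ∂fun _ => lam) η

/-- The infinite-volume limit of the conditional densities. -/
noncomputable def limDensity (ω₀ : Ω) (Λ : Finset G) (η : G → E) : ℝ≥0∞ :=
  ⨅ Δ : Finset G, ⨆ (Δ' : Finset G) (_ : Δ ⊆ Δ'), condDensity z lam Λ Δ' ω₀ η

/-- The finite-volume distributions with the densities `limDensity`. -/
noncomputable def imageSpec (ω₀ : Ω) (Λ : Finset G) (η : G → E) : Measure (G → E) :=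
  ((Measure.pi fun _ : Λ => lam).withDensity
    fun ξ => limDensity z lam ω₀ Λ (updateFinset η Λ ξ)).map (updateFinset η Λ)

variable {z} {lam} [IsProbabilityMeasure lam]

namespace IsPartitionSystem

variable (hz : IsPartitionSystem z)
include hz

omit hz in
lemma marginal_bounds {Λ : Finset G} {M : ℝ≥0} {Δ : Finset G} {ω : Ω}
    (hM : ∀ η η', (∀ i, i ∉ Λ → η i = η' i) → z Δ ω η ≤ M * z Δ ω η') (η : G → E) :
    (∫⋯∫⁻_Λ, z Δ ω ∂fun _ => lam) η ≤ M * z Δ ω η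
      ∧ z Δ ω η ≤ M * (∫⋯∫⁻_Λ, z Δ ω ∂fun _ => lam) η := by
  have hoff : ∀ ξ : Λ → E, ∀ i, i ∉ Λ → updateFinset η Λ ξ i = η i := fun ξ i hi => by
    simp [updateFinset, hi]
  constructor
  · calc (∫⋯∫⁻_Λ, z Δ ω ∂fun _ => lam) η ≤ ∫⁻ _, M * z Δ ω η ∂Measure.pi fun _ : Λ => lam :=
          lintegral_mono fun ξ => hM _ _ (hoff ξ)
      _ = _ := by simp
  · calc z Δ ω η = ∫⁻ _, z Δ ω η ∂Measure.pi fun _ : Λ => lam := by simp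
      _ ≤ ∫⁻ ξ, M * z Δ ω (updateFinset η Λ ξ) ∂Measure.pi fun _ : Λ => lam :=
          lintegral_mono fun ξ => hM _ _ fun i hi => (hoff ξ i hi).symm
      _ = _ := by
          rw [lintegral_const_mul' _ _ ENNReal.coe_ne_top]
          rfl

lemma marginal_ne_top {Λ Δ : Finset G} (hΛ : Λ ⊆ Δ) (ω : Ω) (η : G → E) :
    (∫⋯∫⁻_Λ, z Δ ω ∂fun _ => lam) η ≠ ∞ := by
  obtain ⟨M, -, hM⟩ := hz.bound Λ
  exact ((marginal_bounds (hM Δ hΛ ω) η).1.trans_lt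
    (ENNReal.mul_lt_top ENNReal.coe_lt_top (hz.ne_top Δ ω η).lt_top)).ne

lemma marginal_ne_zero {Λ Δ : Finset G} (hΛ : Λ ⊆ Δ) (ω : Ω) (η : G → E) :
    (∫⋯∫⁻_Λ, z Δ ω ∂fun _ => lam) η ≠ 0 := by
  obtain ⟨M, -, hM⟩ := hz.bound Λ
  intro h0
  have := (marginal_bounds (lam := lam) (hM Δ hΛ ω) η).2
  rw [h0, mul_zero, nonpos_iff_eq_zero] at this
  exact hz.ne_zero Δ ω η this

lemma measurable_condDensity (Λ Δ : Finset G) (ω : Ω) :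
    Measurable (condDensity z lam Λ Δ ω) :=
  (hz.measurable Δ ω).div ((hz.measurable Δ ω).lmarginal _)

lemma condDensity_mul {Λ Δ : Finset G} (hΛ : Λ ⊆ Δ) (ω : Ω) (η : G → E) :
    condDensity z lam Λ Δ ω η * (∫⋯∫⁻_Λ, z Δ ω ∂fun _ => lam) η = z Δ ω η :=
  ENNReal.div_mul_cancel (hz.marginal_ne_zero hΛ ω η) (hz.marginal_ne_top hΛ ω η)

omit [IsProbabilityMeasure lam] in
lemma marginal_condDensity {Λ Λ' Δ : Finset G} (hΛΛ' : Λ ⊆ Λ') (ω : Ω) (η : G → E) :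
    (∫⋯∫⁻_Λ, condDensity z lam Λ' Δ ω ∂fun _ => lam) η
      = (∫⋯∫⁻_Λ, z Δ ω ∂fun _ => lam) η / (∫⋯∫⁻_Λ', z Δ ω ∂fun _ => lam) η := by
  have e : condDensity z lam Λ' Δ ω
      = fun η => ((∫⋯∫⁻_Λ', z Δ ω ∂fun _ => lam) η)⁻¹ * z Δ ω η := by
    ext η
    rw [condDensity, div_eq_mul_inv, mul_comm]
  rw [e, lmarginal_mul_left (hz.measurable Δ ω) (g := fun η => ((∫⋯∫⁻_Λ', z Δ ω ∂fun _ => lam) η)⁻¹)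
    (fun x y hxy => by
      simp only [marginal_congr Λ' (z Δ ω) x y fun i hi => hxy i fun hi' => hi (hΛΛ' hi')]),
    div_eq_mul_inv, mul_comm]

lemma condDensity_bounds {Λ Δ : Finset G} (hΛ : Λ ⊆ Δ) {M : ℝ≥0} {ω : Ω}
    (hM : ∀ η η', (∀ i, i ∉ Λ → η i = η' i) → z Δ ω η ≤ M * z Δ ω η') (η : G → E) :
    condDensity z lam Λ Δ ω η ≤ M ∧ 1 ≤ M * condDensity z lam Λ Δ ω η := by
  obtain ⟨h1, h2⟩ := marginal_bounds (lam := lam) hM η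
  have h3 := hz.marginal_ne_zero (lam := lam) hΛ ω η
  have h4 := hz.marginal_ne_top (lam := lam) hΛ ω η
  constructor
  · rw [condDensity, ENNReal.div_le_iff h3 h4]
    exact h2
  · rw [condDensity, ← mul_div_assoc, ENNReal.le_div_iff_mul_le (Or.inl h3) (Or.inl h4), one_mul]
    exact h1

/-- The cross inequality is integrated over the spins in `Λ` of one of its two configurations, which
turns that partition function into the denominator of the conditional density. -/
lemma exists_condDensity_le (Λ : Finset G) {κ : ℝ≥0} (hκ : 1 < κ) :
    ∃ Δ₀, Λ ⊆ Δ₀ ∧ ∀ Δ, Δ₀ ⊆ Δ → ∀ ω ω' η,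
      condDensity z lam Λ Δ ω η ≤ κ * condDensity z lam Λ Δ₀ ω' η
      ∧ condDensity z lam Λ Δ₀ ω' η ≤ κ * condDensity z lam Λ Δ ω η := by
  obtain ⟨Δ₀, hΛ, hcross⟩ := hz.cross Λ κ hκ
  refine ⟨Δ₀, hΛ, fun Δ hΔ ω ω' η => ?_⟩
  have hoff : ∀ ξ : Λ → E, ∀ i, i ∉ Λ → updateFinset η Λ ξ i = η i := fun ξ i hi => by
    simp [updateFinset, hi]
  have hm : ∀ Δ ω, Measurable fun ξ : Λ → E => z Δ ω (updateFinset η Λ ξ) := fun Δ ω =>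
    (hz.measurable Δ ω).comp measurable_updateFinset
  have hΛ' : Λ ⊆ Δ := hΛ.trans hΔ
  have n1 := hz.marginal_ne_zero (lam := lam) hΛ ω' η
  have n2 := hz.marginal_ne_top (lam := lam) hΛ ω' η
  have n3 := hz.marginal_ne_zero (lam := lam) hΛ' ω η
  have n4 := hz.marginal_ne_top (lam := lam) hΛ' ω η
  constructor
  · refine div_le_mul_div_of_mul_le n3 n4 n1 n2 ?_
    simp only [lmarginal]
    rw [← lintegral_const_mul _ (hm _ _), ← lintegral_const_mul _ (hm _ _),
      ← lintegral_const_mul _ ((hm _ _).const_mul _)]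
    exact lintegral_mono fun ξ => hcross Δ hΔ ω ω' η _ fun i hi => (hoff ξ i hi).symm
  · refine div_le_mul_div_of_mul_le n1 n2 n3 n4 ?_
    rw [mul_comm, mul_comm (z Δ ω η)]
    simp only [lmarginal]
    rw [← lintegral_mul_const _ (hm _ _), ← lintegral_mul_const _ (hm _ _),
      ← lintegral_const_mul _ ((hm _ _).mul_const _)]
    exact lintegral_mono fun ξ => hcross Δ hΔ ω ω' _ η (hoff ξ)

/-- The finite-volume conditional densities converge to `limDensity`, uniformly in the boundary
condition and in the conditioning. -/
lemma exists_limDensity_le (ω₀ : Ω) (Λ : Finset G) {κ : ℝ≥0} (hκ : 1 < κ) :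
    ∃ Δ₀, Λ ⊆ Δ₀ ∧ ∀ Δ, Δ₀ ⊆ Δ → ∀ ω η,
      condDensity z lam Λ Δ ω η ≤ κ * limDensity z lam ω₀ Λ η
      ∧ limDensity z lam ω₀ Λ η ≤ κ * condDensity z lam Λ Δ ω η := by
  -- The error is split evenly: one factor `√κ` compares `Δ` with `Δ₀`, the other compares `Δ₀` with
  -- the limit.
  have hs1 : 1 < NNReal.sqrt κ := by
    rw [← NNReal.sqrt_one]; exact NNReal.sqrt_lt_sqrt.mpr hκ
  have hs : (κ : ℝ≥0∞) = NNReal.sqrt κ * NNReal.sqrt κ := by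
    exact_mod_cast (NNReal.mul_self_sqrt κ).symm
  obtain ⟨Δ₀, hΛ, hcond⟩ := hz.exists_condDensity_le (lam := lam) Λ hs1
  set r := NNReal.sqrt κ
  have hup : ∀ η, limDensity z lam ω₀ Λ η ≤ r * condDensity z lam Λ Δ₀ ω₀ η := fun η =>
    iInf_le_of_le Δ₀ (iSup₂_le fun Δ' hΔ' => (hcond Δ' hΔ' ω₀ ω₀ η).1)
  have hlow : ∀ η, condDensity z lam Λ Δ₀ ω₀ η ≤ r * limDensity z lam ω₀ Λ η := by
    intro η
    rw [limDensity, ENNReal.mul_iInf_of_ne (by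
      have : (0 : ℝ≥0) < r := zero_lt_one.trans hs1
      exact_mod_cast this.ne') ENNReal.coe_ne_top]
    refine le_iInf fun Δ => ?_
    refine (hcond (Δ ∪ Δ₀) Finset.subset_union_right ω₀ ω₀ η).2.trans ?_
    gcongr
    exact le_iSup₂_of_le (Δ ∪ Δ₀) Finset.subset_union_left le_rfl
  refine ⟨Δ₀, hΛ, fun Δ hΔ ω η => ?_⟩
  rw [hs, mul_assoc, mul_assoc]
  constructor
  · exact (hcond Δ hΔ ω ω₀ η).1.trans (by gcongr; exact hlow η)
  · exact (hup η).trans (by gcongr; exact (hcond Δ hΔ ω ω₀ η).2)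

lemma measurable_limDensity [Countable G] (ω₀ : Ω) (Λ : Finset G) :
    Measurable (limDensity z lam ω₀ Λ) :=
  Measurable.iInf fun _ => Measurable.iSup fun _ => Measurable.iSup fun _ =>
    hz.measurable_condDensity _ _ _

lemma marginal_limDensity (ω₀ : Ω) (Λ : Finset G) (η : G → E) :
    (∫⋯∫⁻_Λ, limDensity z lam ω₀ Λ ∂fun _ => lam) η = 1 := by
  have h1 : ∀ {Δ : Finset G}, Λ ⊆ Δ →
      (∫⋯∫⁻_Λ, condDensity z lam Λ Δ ω₀ ∂fun _ => lam) η = 1 := fun {Δ} hΛ => by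
    rw [hz.marginal_condDensity subset_rfl, ENNReal.div_self (hz.marginal_ne_zero hΛ _ _)
      (hz.marginal_ne_top hΛ _ _)]
  refine le_antisymm (le_of_forall_one_lt_pow_mul 1 fun κ hκ => ?_)
    (le_of_forall_one_lt_pow_mul 1 fun κ hκ => ?_)
  · obtain ⟨Δ₀, hΛ, hlim⟩ := hz.exists_limDensity_le (lam := lam) ω₀ Λ hκ
    rw [pow_one, ← h1 hΛ]
    simp only [lmarginal]
    rw [← lintegral_const_mul' _ _ ENNReal.coe_ne_top]
    exact lintegral_mono fun ξ => (hlim Δ₀ subset_rfl ω₀ _).2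
  · obtain ⟨Δ₀, hΛ, hlim⟩ := hz.exists_limDensity_le (lam := lam) ω₀ Λ hκ
    rw [pow_one]
    conv_lhs => rw [← h1 hΛ]
    simp only [lmarginal]
    rw [← lintegral_const_mul' _ _ ENNReal.coe_ne_top]
    exact lintegral_mono fun ξ => (hlim Δ₀ subset_rfl ω₀ _).1

/-- The chain rule for conditional densities. -/
lemma limDensity_eq_mul (ω₀ : Ω) {Λ Λ' : Finset G} (hΛΛ' : Λ ⊆ Λ') (η : G → E) :
    limDensity z lam ω₀ Λ' η
      = (∫⋯∫⁻_Λ, limDensity z lam ω₀ Λ' ∂fun _ => lam) η * limDensity z lam ω₀ Λ η := by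
  have hcond : ∀ {Δ : Finset G}, Λ' ⊆ Δ → condDensity z lam Λ' Δ ω₀ η
      = (∫⋯∫⁻_Λ, condDensity z lam Λ' Δ ω₀ ∂fun _ => lam) η * condDensity z lam Λ Δ ω₀ η := by
    intro Δ hΔ
    rw [hz.marginal_condDensity hΛΛ', condDensity, condDensity, ← ENNReal.mul_div_right_comm,
      ENNReal.mul_div_cancel (hz.marginal_ne_zero (hΛΛ'.trans hΔ) _ _)
      (hz.marginal_ne_top (hΛΛ'.trans hΔ) _ _)]
  refine le_antisymm (le_of_forall_one_lt_pow_mul 3 fun κ hκ => ?_)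
    (le_of_forall_one_lt_pow_mul 3 fun κ hκ => ?_)
  all_goals
    obtain ⟨Δ₁, hΛ₁, hlim₁⟩ := hz.exists_limDensity_le (lam := lam) ω₀ Λ hκ
    obtain ⟨Δ₂, hΛ₂, hlim₂⟩ := hz.exists_limDensity_le (lam := lam) ω₀ Λ' hκ
    have l1 := fun η => hlim₁ (Δ₁ ∪ Δ₂) Finset.subset_union_left ω₀ η
    have l2 := fun η => hlim₂ (Δ₁ ∪ Δ₂) Finset.subset_union_right ω₀ η
    have hc := hcond (hΛ₂.trans (Finset.subset_union_right (s₁ := Δ₁)))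
    set p := condDensity z lam Λ (Δ₁ ∪ Δ₂) ω₀
    set p' := condDensity z lam Λ' (Δ₁ ∪ Δ₂) ω₀
  · have hint : (∫⋯∫⁻_Λ, p' ∂fun _ => lam) η
        ≤ κ * (∫⋯∫⁻_Λ, limDensity z lam ω₀ Λ' ∂fun _ => lam) η := by
      simp only [lmarginal]
      rw [← lintegral_const_mul' _ _ ENNReal.coe_ne_top]
      exact lintegral_mono fun ξ => (l2 _).1
    calc limDensity z lam ω₀ Λ' η ≤ κ * p' η := (l2 η).2
      _ = κ * ((∫⋯∫⁻_Λ, p' ∂fun _ => lam) η * p η) := by rw [← hc]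
      _ ≤ κ * ((κ * (∫⋯∫⁻_Λ, limDensity z lam ω₀ Λ' ∂fun _ => lam) η)
          * (κ * limDensity z lam ω₀ Λ η)) := by
          gcongr
          exact (l1 η).1
      _ = _ := by ring
  · have hint : (∫⋯∫⁻_Λ, limDensity z lam ω₀ Λ' ∂fun _ => lam) η
        ≤ κ * (∫⋯∫⁻_Λ, p' ∂fun _ => lam) η := by
      simp only [lmarginal]
      rw [← lintegral_const_mul' _ _ ENNReal.coe_ne_top]
      exact lintegral_mono fun ξ => (l2 _).2
    calc (∫⋯∫⁻_Λ, limDensity z lam ω₀ Λ' ∂fun _ => lam) η * limDensity z lam ω₀ Λ η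
        ≤ (κ * (∫⋯∫⁻_Λ, p' ∂fun _ => lam) η) * (κ * p η) := by
          gcongr
          exact (l1 η).2
      _ = κ ^ 2 * ((∫⋯∫⁻_Λ, p' ∂fun _ => lam) η * p η) := by ring
      _ = κ ^ 2 * p' η := by rw [← hc]
      _ ≤ κ ^ 2 * (κ * limDensity z lam ω₀ Λ' η) := by gcongr; exact (l2 η).1
      _ = _ := by ring

variable [Countable G]

lemma lintegral_imageSpec (ω₀ : Ω) (Λ : Finset G) (η : G → E) {f : (G → E) → ℝ≥0∞}
    (hf : Measurable f) :
    ∫⁻ σ, f σ ∂imageSpec z lam ω₀ Λ η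
      = (∫⋯∫⁻_Λ, (fun ξ => limDensity z lam ω₀ Λ ξ * f ξ) ∂fun _ => lam) η := by
  have hm := hz.measurable_limDensity (lam := lam) ω₀ Λ
  have hu : Measurable (updateFinset η Λ) := measurable_updateFinset
  rw [imageSpec, lintegral_map hf hu]
  exact lintegral_withDensity_eq_lintegral_mul _ (hm.comp hu) (hf.comp hu)

lemma imageSpec_apply (ω₀ : Ω) (Λ : Finset G) (η : G → E) {A : Set (G → E)}
    (hA : MeasurableSet A) :
    imageSpec z lam ω₀ Λ η A
      = (∫⋯∫⁻_Λ, (fun ξ => limDensity z lam ω₀ Λ ξ * A.indicator 1 ξ) ∂fun _ => lam) η := by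
  rw [← hz.lintegral_imageSpec ω₀ Λ η (measurable_one.indicator hA), lintegral_indicator_one hA]

lemma measurable_imageSpec (ω₀ : Ω) (Λ : Finset G) : Measurable (imageSpec z lam ω₀ Λ) := by
  refine Measure.measurable_of_measurable_coe _ fun A hA => ?_
  simp only [hz.imageSpec_apply ω₀ Λ _ hA]
  exact ((hz.measurable_limDensity ω₀ Λ).mul (measurable_one.indicator hA)).lmarginal _

lemma isProbabilityMeasure_imageSpec (ω₀ : Ω) (Λ : Finset G) (η : G → E) :
    IsProbabilityMeasure (imageSpec z lam ω₀ Λ η) := by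
  refine ⟨?_⟩
  rw [hz.imageSpec_apply ω₀ Λ η MeasurableSet.univ, ← hz.marginal_limDensity (lam := lam) ω₀ Λ η]
  simp

omit hz [Countable G] [DecidableEq G] [IsProbabilityMeasure lam] in
-- A marginal over `Λ` no longer depends on the spins in `Λ`, so both sides are the product of the
-- two marginals: averaging is self-adjoint.
lemma marginal_mul_marginal [DecidableEq G] [IsProbabilityMeasure lam] (Λ : Finset G)
    {f g : (G → E) → ℝ≥0∞} (hf : Measurable f) (hg : Measurable g) (η : G → E) :
    (∫⋯∫⁻_Λ, (fun ξ => f ξ * (∫⋯∫⁻_Λ, g ∂fun _ => lam) ξ) ∂fun _ => lam) η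
      = (∫⋯∫⁻_Λ, (fun ξ => (∫⋯∫⁻_Λ, f ∂fun _ => lam) ξ * g ξ) ∂fun _ => lam) η := by
  rw [lmarginal_mul_left hg (marginal_congr Λ f)]
  simp only [mul_comm (f _)]
  rw [lmarginal_mul_left hf (marginal_congr Λ g), mul_comm]

omit hz [Countable G] in
/-- Moving a marginal integral in a subset from one factor to another. -/
lemma marginal_mul_marginal_of_subset {Λ Δ : Finset G} (hΛΔ : Λ ⊆ Δ)
    {f g : (G → E) → ℝ≥0∞} (hf : Measurable f) (hg : Measurable g) (η : G → E) :
    (∫⋯∫⁻_Δ, (fun ξ => f ξ * (∫⋯∫⁻_Λ, g ∂fun _ => lam) ξ) ∂fun _ => lam) η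
      = (∫⋯∫⁻_Δ, (fun ξ => (∫⋯∫⁻_Λ, f ∂fun _ => lam) ξ * g ξ) ∂fun _ => lam) η := by
  refine congrFun (lmarginal_eq_of_subset hΛΔ (hf.mul (hg.lmarginal _))
    ((hf.lmarginal _).mul hg) ?_) η
  ext η
  exact marginal_mul_marginal Λ hf hg η

lemma isSpecification_imageSpec [MeasurableSingletonClass E] (ω₀ : Ω) :
    IsSpecification (imageSpec z lam ω₀) where
  measurable := hz.measurable_imageSpec ω₀
  isProbabilityMeasure := hz.isProbabilityMeasure_imageSpec ω₀
  congr_of_eq_off Λ η η' hη := by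
    have : updateFinset η Λ = updateFinset η' Λ := by
      ext ξ i
      by_cases hi : i ∈ Λ
      · simp [updateFinset, hi]
      · simp [updateFinset, hi, hη i hi]
    simp only [imageSpec, this]
  proper Λ η := by
    have hms : MeasurableSet {σ : G → E | ∀ i, i ∉ Λ → σ i = η i} := by
      have : {σ : G → E | ∀ i, i ∉ Λ → σ i = η i} = ⋂ i, ⋂ (_ : i ∉ Λ), {σ | σ i = η i} := by
        ext σ; simp
      rw [this]
      exact MeasurableSet.iInter fun i => MeasurableSet.iInter fun _ =>
        (measurable_pi_apply i : Measurable fun σ : G → E => σ i) (measurableSet_singleton (η i))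
    rw [imageSpec, ae_map_iff measurable_updateFinset.aemeasurable hms]
    exact .of_forall fun ξ i hi => by simp [updateFinset, hi]
  consistent Λ Λ' hΛΛ' η := by
    have hm := hz.measurable_limDensity (lam := lam) ω₀ Λ
    have hm' := hz.measurable_limDensity (lam := lam) ω₀ Λ'
    ext A hA
    have h1A : Measurable (A.indicator (1 : (G → E) → ℝ≥0∞)) := measurable_one.indicator hA
    rw [Measure.bind_apply hA (hz.measurable_imageSpec ω₀ Λ).aemeasurable,
      hz.imageSpec_apply ω₀ Λ' η hA,
      hz.lintegral_imageSpec ω₀ Λ' η (f := fun σ => imageSpec z lam ω₀ Λ σ A)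
        ((Measure.measurable_coe hA).comp (hz.measurable_imageSpec ω₀ Λ))]
    simp only [hz.imageSpec_apply ω₀ Λ _ hA]
    -- Moving the average over `Λ` onto the density for `Λ'` leaves (marginal of the `Λ'` density)
    -- times (the `Λ` density), which the chain rule identifies with the `Λ'` density.
    rw [marginal_mul_marginal_of_subset hΛΛ' hm'
      (g := fun ξ => limDensity z lam ω₀ Λ ξ * A.indicator 1 ξ) (hm.mul h1A)]
    simp only [← mul_assoc, ← hz.limDensity_eq_mul ω₀ hΛΛ']

omit hz [Countable G] [IsProbabilityMeasure lam] in
lemma map_restrict_imageSpec [SigmaFinite lam] (ω₀ : Ω) (Λ : Finset G) (η : G → E) :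
    (imageSpec z lam ω₀ Λ η).map Λ.restrict
      = (Measure.pi fun _ : Λ => lam).withDensity
        fun ξ => limDensity z lam ω₀ Λ (updateFinset η Λ ξ) := by
  have hu : Measurable (updateFinset η Λ) := measurable_updateFinset
  rw [imageSpec, Measure.map_map (Finset.measurable_restrict Λ) hu]
  have : Λ.restrict ∘ updateFinset η Λ = id := by
    ext ξ i
    simp [updateFinset]
  rw [this, Measure.map_id]

omit hz [Countable G] [IsProbabilityMeasure lam] [DecidableEq G] in
lemma tvDist_le_of_le_mul {X : Type*} [MeasurableSpace X] {μ ν : Measure X}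
    [IsProbabilityMeasure μ] [IsProbabilityMeasure ν] {κ : ℝ≥0} (hκ : 1 ≤ κ)
    (h1 : ∀ A, MeasurableSet A → μ A ≤ κ * ν A) (h2 : ∀ A, MeasurableSet A → ν A ≤ κ * μ A) :
    tvDist μ ν ≤ (κ - 1 : ℝ≥0) := by
  refine iSup₂_le fun A hA => ?_
  rw [← ENNReal.ofReal_coe_nnreal, NNReal.coe_sub hκ, NNReal.coe_one]
  refine ENNReal.ofReal_le_ofReal ?_
  have hκ' : (1 : ℝ) ≤ κ := by exact_mod_cast hκ
  have toR : ∀ {μ ν : Measure X} [IsProbabilityMeasure μ] [IsProbabilityMeasure ν],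
      μ A ≤ κ * ν A → μ.real A ≤ κ * ν.real A := by
    intro μ ν _ _ h
    have := ENNReal.toReal_mono (ENNReal.mul_ne_top ENNReal.coe_ne_top (measure_ne_top ν A)) h
    simpa [Measure.real] using this
  have a1 := toR (h1 A hA)
  have a2 := toR (h2 A hA)
  have b1 : μ.real A ≤ 1 := measureReal_le_one
  have b2 : ν.real A ≤ 1 := measureReal_le_one
  rw [abs_le]
  constructor <;> nlinarith

lemma isQuasilocal_imageSpec (ω₀ : Ω) : IsQuasilocal (imageSpec z lam ω₀) := by
  intro Λ ε hε
  obtain ⟨δ, hδ0, hδε⟩ := ENNReal.lt_iff_exists_nnreal_btwn.mp hε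
  have hδ0 : 0 < δ := by exact_mod_cast hδ0
  -- The density is compared twice with that in `Δ₀`, which depends only on the spins in `Δ₀`; the
  -- total factor is `κ * κ = 1 + δ`.
  set κ : ℝ≥0 := NNReal.sqrt (1 + δ) with hκ
  have hκ1 : 1 < κ := by
    rw [hκ, ← NNReal.sqrt_one]; exact NNReal.sqrt_lt_sqrt.mpr (by simpa using hδ0)
  have hκκ : κ * κ = 1 + δ := NNReal.mul_self_sqrt _
  obtain ⟨Δ₀, hΛ, hlim⟩ := hz.exists_limDensity_le (lam := lam) ω₀ Λ hκ1
  refine ⟨Δ₀, fun η η' hη => ?_⟩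
  have hle : ∀ {η η' : G → E}, (∀ i ∈ Δ₀, η i = η' i) → ∀ A,  MeasurableSet A →
      (imageSpec z lam ω₀ Λ η).map Λ.restrict A
        ≤ (1 + δ : ℝ≥0) * (imageSpec z lam ω₀ Λ η').map Λ.restrict A := by
    intro η η' hη A hA
    rw [map_restrict_imageSpec, map_restrict_imageSpec, withDensity_apply _ hA,
      withDensity_apply _ hA, ← lintegral_const_mul' _ _ ENNReal.coe_ne_top]
    refine lintegral_mono fun ξ => ?_
    have hagree : ∀ i ∈ Δ₀, updateFinset η Λ ξ i = updateFinset η' Λ ξ i := fun i hi => by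
      by_cases hi' : i ∈ Λ
      · simp [updateFinset, hi']
      · simp [updateFinset, hi', hη i hi]
    have hc : condDensity z lam Λ Δ₀ ω₀ (updateFinset η Λ ξ)
        = condDensity z lam Λ Δ₀ ω₀ (updateFinset η' Λ ξ) := by
      rw [condDensity, condDensity, hz.congr Δ₀ ω₀ _ _ hagree]
      congr 1
      simp only [lmarginal]
      refine lintegral_congr fun ξ' => hz.congr Δ₀ ω₀ _ _ fun i hi => ?_
      by_cases hi' : i ∈ Λ
      · simp [updateFinset, hi']
      · simp [updateFinset, hi', hη i hi]
    calc limDensity z lam ω₀ Λ (updateFinset η Λ ξ)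
        ≤ κ * condDensity z lam Λ Δ₀ ω₀ (updateFinset η Λ ξ) := (hlim Δ₀ subset_rfl ω₀ _).2
      _ = κ * condDensity z lam Λ Δ₀ ω₀ (updateFinset η' Λ ξ) := by rw [hc]
      _ ≤ κ * (κ * limDensity z lam ω₀ Λ (updateFinset η' Λ ξ)) := by
          gcongr; exact (hlim Δ₀ subset_rfl ω₀ _).1
      _ = _ := by rw [← mul_assoc, ← ENNReal.coe_mul, hκκ]
  have p1 := hz.isProbabilityMeasure_imageSpec (lam := lam) ω₀ Λ η
  have p2 := hz.isProbabilityMeasure_imageSpec (lam := lam) ω₀ Λ η'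
  have p3 := Measure.isProbabilityMeasure_map (μ := imageSpec z lam ω₀ Λ η)
    (Finset.measurable_restrict Λ).aemeasurable
  have p4 := Measure.isProbabilityMeasure_map (μ := imageSpec z lam ω₀ Λ η')
    (Finset.measurable_restrict Λ).aemeasurable
  refine (tvDist_le_of_le_mul (κ := 1 + δ) (by simp) (hle hη)
    (hle fun i hi => (hη i hi).symm)).trans ?_
  rw [add_tsub_cancel_left]
  exact hδε.le

omit [Countable G] in
lemma isUniformlyNonnull_imageSpec (ω₀ : Ω) : IsUniformlyNonnull (imageSpec z lam ω₀) lam := by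
  intro Λ
  obtain ⟨M, hM0, hM⟩ := hz.bound Λ
  -- Any fixed factor would do. With 2, the limit density lies between `(2M)⁻¹` and `2M`.
  obtain ⟨Δ₀, hΛ, hlim⟩ := hz.exists_limDensity_le (lam := lam) ω₀ Λ one_lt_two
  have hMM : (M : ℝ≥0∞) ≠ 0 := by exact_mod_cast hM0.ne'
  have hinv : (((2 * M)⁻¹ : ℝ≥0) : ℝ≥0∞) * (2 * M) = 1 := by
    rw [← ENNReal.coe_ofNat, ← ENNReal.coe_mul, ← ENNReal.coe_mul,
      inv_mul_cancel₀ (mul_pos two_pos hM0).ne', ENNReal.coe_one]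
  refine ⟨(2 * M)⁻¹, inv_pos.mpr (mul_pos two_pos hM0), fun η => ?_⟩
  have hbd : ∀ ζ, 1 ≤ (2 * M) * limDensity z lam ω₀ Λ ζ ∧ limDensity z lam ω₀ Λ ζ ≤ 2 * M := by
    intro ζ
    obtain ⟨h1, h2⟩ := hz.condDensity_bounds (lam := lam) hΛ (hM Δ₀ hΛ ω₀) ζ
    obtain ⟨h3, h4⟩ := hlim Δ₀ subset_rfl ω₀ ζ
    constructor
    · calc 1 ≤ M * condDensity z lam Λ Δ₀ ω₀ ζ := h2
        _ ≤ M * (2 * limDensity z lam ω₀ Λ ζ) := by gcongr; exact_mod_cast h3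
        _ = _ := by ring
    · exact h4.trans (by rw [ENNReal.coe_ofNat]; gcongr)
  have hinv_le : ∀ ζ, (((2 * M)⁻¹ : ℝ≥0) : ℝ≥0∞) ≤ limDensity z lam ω₀ Λ ζ := by
    intro ζ
    calc (((2 * M)⁻¹ : ℝ≥0) : ℝ≥0∞) = (((2 * M)⁻¹ : ℝ≥0) : ℝ≥0∞) * 1 := (mul_one _).symm
      _ ≤ (((2 * M)⁻¹ : ℝ≥0) : ℝ≥0∞) * ((2 * M) * limDensity z lam ω₀ Λ ζ) := by
          gcongr; exact (hbd ζ).1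
      _ = _ := by rw [← mul_assoc, hinv, one_mul]
  rw [map_restrict_imageSpec]
  constructor
  · refine Measure.le_iff.mpr fun A hA => ?_
    rw [withDensity_apply _ hA, Measure.smul_apply, ENNReal.smul_def, smul_eq_mul]
    calc (((2 * M)⁻¹ : ℝ≥0) : ℝ≥0∞) * Measure.pi (fun _ : Λ => lam) A
        = ∫⁻ _ in A, (((2 * M)⁻¹ : ℝ≥0) : ℝ≥0∞) ∂Measure.pi (fun _ : Λ => lam) := by simp
      _ ≤ _ := lintegral_mono fun ξ => hinv_le _
  · refine Measure.le_iff.mpr fun A hA => ?_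
    rw [Measure.smul_apply, withDensity_apply _ hA, ENNReal.smul_def, smul_eq_mul]
    calc (((2 * M)⁻¹ : ℝ≥0) : ℝ≥0∞) * ∫⁻ ξ in A, limDensity z lam ω₀ Λ (updateFinset η Λ ξ)
          ∂Measure.pi (fun _ : Λ => lam)
        ≤ (((2 * M)⁻¹ : ℝ≥0) : ℝ≥0∞) * ∫⁻ _ in A, 2 * M ∂Measure.pi (fun _ : Λ => lam) := by
          gcongr
          exact (hbd _).2
      _ = _ := by
          rw [setLIntegral_const, ← mul_assoc, hinv, one_mul]

end IsPartitionSystem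

end ImageSpecification

end Fuzzy

namespace Fuzzy

open Function ProbabilityTheory

/-! ### Disintegration of the a priori measure along `T`. -/

section CellKernel

variable {S S' : Type*} [MeasurableSpace S] [StandardBorelSpace S] [MeasurableSpace S']
  [StandardBorelSpace S']

/-- The conditional distributions of `α` given `T` have a version that is concentrated, for every
value of the condition, on a set that is no larger than a cell of `T`. -/
lemma exists_cell_kernel [PseudoEMetricSpace S] [MeasurableSingletonClass S] {T : S → S'}
    (hT : Measurable T) (α : Measure S) [IsProbabilityMeasure α] :
    ∃ K : Kernel S' S, IsMarkovKernel K ∧ (α.map T) ⊗ₘ K = α.map (fun s => (T s, s)) ∧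
      ∃ B : S' → Set S, (∀ s', ∀ᵐ s ∂K s', s ∈ B s') ∧ ∀ s', Metric.ediam (B s') ≤ fineness T := by
  classical
  have : Nonempty S := nonempty_of_isProbabilityMeasure α
  let a₀ : S := Classical.arbitrary S
  have hmap : (α.map T) ⊗ₘ condDistrib id T α = α.map fun s => (T s, s) :=
    compProd_map_condDistrib aemeasurable_id
  set K₀ := condDistrib id T α
  have hbad : MeasurableSet {p : S' × S | T p.2 ≠ p.1} :=
    (measurableSet_eq_fun (hT.comp measurable_snd) measurable_fst).compl
  set good : Set S' := {s' | K₀ s' (Prod.mk s' ⁻¹' {p : S' × S | T p.2 ≠ p.1}) = 0}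
  have hgoodm : MeasurableSet good :=
    Kernel.measurable_kernel_prodMk_left hbad (measurableSet_singleton 0)
  have hae : ∀ᵐ s' ∂α.map T, s' ∈ good := by
    have h1 : ∀ᵐ p ∂(α.map T) ⊗ₘ K₀, ¬ (T p.2 ≠ p.1) := by
      rw [hmap]
      refine (ae_map_iff (hT.prodMk measurable_id).aemeasurable hbad.compl).mpr ?_
      exact Filter.Eventually.of_forall fun s => by simp
    filter_upwards [Measure.ae_ae_of_ae_compProd h1] with s' hs'
    exact measure_eq_zero_iff_ae_notMem.mpr hs'
  -- The regular conditional law lives on its cell only for almost every `s'`, but the estimates are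
  -- needed for every `η`. On the null set it is replaced by a point mass, carried by a set of
  -- diameter 0.
  refine ⟨Kernel.piecewise hgoodm K₀ (Kernel.const _ (Measure.dirac a₀)), inferInstance, ?_,
    fun s' => if s' ∈ good then T ⁻¹' {s'} else {a₀}, fun s' => ?_, fun s' => ?_⟩
  · rw [← hmap]
    refine Measure.compProd_congr ?_
    filter_upwards [hae] with s' hs'
    rw [Kernel.piecewise_apply, if_pos hs']
  · rw [Kernel.piecewise_apply]
    beta_reduce
    by_cases hs' : s' ∈ good
    · rw [if_pos hs', if_pos hs']
      filter_upwards [measure_eq_zero_iff_ae_notMem.mp hs'] with s hs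
      simpa using hs
    · rw [if_neg hs', if_neg hs', Kernel.const_apply]
      exact (ae_dirac_iff (measurableSet_singleton a₀)).mpr rfl
  · dsimp only
    split_ifs
    · exact le_iSup (fun s' => Metric.ediam (T ⁻¹' {s'})) s'
    · simp

end CellKernel

section ProductDisintegration

variable {ι S S' : Type*} [Fintype ι] [MeasurableSpace S] [MeasurableSpace S']

lemma lintegral_pi_prod {X : ι → Type*} [∀ i, MeasurableSpace (X i)] (μ : ∀ i, Measure (X i))
    [∀ i, IsProbabilityMeasure (μ i)] {f : ∀ i, X i → ℝ≥0∞} (hf : ∀ i, Measurable (f i)) :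
    ∫⁻ x, ∏ i, f i (x i) ∂Measure.pi μ = ∏ i, ∫⁻ x, f i x ∂μ i := by
  refine (lintegral_prod_eq_prod_lintegral_of_indepFun Finset.univ
    (fun i (x : ∀ i, X i) => f i (x i)) (iIndepFun_pi fun i => (hf i).aemeasurable)
    fun i => by fun_prop).trans ?_
  refine Finset.prod_congr rfl fun i _ => ?_
  exact (measurePreserving_eval μ i).lintegral_comp (hf i)

/-- A disintegration of `α` along `T` induces a disintegration of the powers of `α`. -/
lemma compProd_piKernel {K : Kernel S' S} [IsMarkovKernel K] {T : S → S'} (hT : Measurable T)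
    {α : Measure S} [IsProbabilityMeasure α]
    (hK : (α.map T) ⊗ₘ K = α.map (fun s => (T s, s))) :
    (Measure.pi fun _ : ι => α.map T) ⊗ₘ piKernel ι K
      = (Measure.pi fun _ : ι => α).map fun σ => (fun i => T (σ i), σ) := by
  have : IsProbabilityMeasure (α.map T) := Measure.isProbabilityMeasure_map hT.aemeasurable
  set e := MeasurableEquiv.arrowProdEquivProdArrow S' S ι
  -- Both sides are compared as laws of families of pairs, where they are products over the sites,
  -- and then rearranged into pairs of families.
  have h1 : Measure.pi (fun _ : ι => α.map (fun s => (T s, s)))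
      = ((Measure.pi fun _ : ι => α.map T) ⊗ₘ piKernel ι K).map e.symm := by
    rw [← hK]
    refine Measure.pi_eq fun s hs => ?_
    have hpi : MeasurableSet (e.symm ⁻¹' Set.univ.pi s) :=
      e.symm.measurable (MeasurableSet.univ_pi hs)
    rw [Measure.map_apply e.symm.measurable (MeasurableSet.univ_pi hs), Measure.compProd_apply hpi]
    have h2 : ∀ η : ι → S', piKernel ι K η (Prod.mk η ⁻¹' (e.symm ⁻¹' Set.univ.pi s))
        = ∏ i, K (η i) (Prod.mk (η i) ⁻¹' s i) := by
      intro η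
      rw [piKernel_apply, ← Measure.pi_pi]
      rfl
    simp only [h2]
    rw [lintegral_pi_prod (fun _ : ι => α.map T) (f := fun i ξ => K ξ (Prod.mk ξ ⁻¹' s i))
      fun i => Kernel.measurable_kernel_prodMk_left (hs i)]
    exact Finset.prod_congr rfl fun i _ => (Measure.compProd_apply (hs i)).symm
  have h3 : Measure.pi (fun _ : ι => α.map (fun s => (T s, s)))
      = (Measure.pi fun _ : ι => α).map fun σ i => (T (σ i), σ i) := by
    have : IsProbabilityMeasure (α.map fun s => (T s, s)) :=
      Measure.isProbabilityMeasure_map (by fun_prop)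
    exact (Measure.pi_map_pi (f := fun _ s => (T s, s)) fun i => by fun_prop).symm
  rw [h3] at h1
  have h4 := congrArg (Measure.map e) h1
  rw [Measure.map_map e.measurable (by fun_prop), Measure.map_map e.measurable e.symm.measurable,
    e.self_comp_symm, Measure.map_id] at h4
  exact h4.symm

/-- Integration with respect to the a priori measure can be performed in two steps: first under
the constraint that the image under `T` is given. -/
lemma lmarginal_comp_eq {G : Type*} [DecidableEq G] {K : Kernel S' S} [IsMarkovKernel K]
    {T : S → S'} (hT : Measurable T) {α : Measure S} [IsProbabilityMeasure α]
    (hK : (α.map T) ⊗ₘ K = α.map (fun s => (T s, s))) {f : (G → S) → ℝ≥0∞} (hf : Measurable f)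
    {F : (G → S') → ℝ≥0∞} (hF : Measurable F) (Δ : Finset G) (ω : G → S) :
    (∫⋯∫⁻_Δ, (fun σ => f σ * F fun i => T (σ i)) ∂fun _ => α) ω
      = (∫⋯∫⁻_Δ, (fun η => (∫⋯∫⁻_Δ, f ∂fun i => K (η i)) ω * F η) ∂fun _ => α.map T)
        fun i => T (ω i) := by
  have : IsProbabilityMeasure (α.map T) := Measure.isProbabilityMeasure_map hT.aemeasurable
  have hm : Measurable fun p : (Δ → S') × (Δ → S) =>
      f (updateFinset ω Δ p.2) * F (updateFinset (fun i => T (ω i)) Δ p.1) :=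
    (hf.comp (measurable_updateFinset.comp measurable_snd)).mul
      (hF.comp (measurable_updateFinset.comp measurable_fst))
  have h1 := congrArg (fun m => ∫⁻ p, f (updateFinset ω Δ p.2)
    * F (updateFinset (fun i => T (ω i)) Δ p.1) ∂m) (compProd_piKernel (ι := Δ) hT hK)
  rw [Measure.lintegral_compProd hm, lintegral_map hm (by fun_prop)] at h1
  have e1 : ∀ σ : Δ → S, (fun i => T (updateFinset ω Δ σ i))
      = updateFinset (fun i => T (ω i)) Δ fun i => T (σ i) := by
    intro σ
    ext i
    by_cases hi : i ∈ Δ <;> simp [updateFinset, hi]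
  simp only [lmarginal, e1]
  rw [← h1]
  refine lintegral_congr fun η => ?_
  dsimp only
  rw [lintegral_mul_const _
    (show Measurable fun σ => f (updateFinset ω Δ σ) from hf.comp measurable_updateFinset),
    piKernel_apply]
  have e2 : (fun i : Δ => K (updateFinset (fun i => T (ω i)) Δ η i)) = fun i => K (η i) := by
    ext1 i
    simp [updateFinset, i.2]
  rw [e2]

end ProductDisintegration

/-! ### Gibbs distributions and images of Gibbs measures. -/

section GibbsIntegral

variable {G S S' : Type*} [DecidableEq G] [Countable G] [MeasurableSpace S]
  {Φ : Finset G → (G → S) → ℝ} (hΦ : IsInteraction Φ) (h : tripleNorm Φ < ∞)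
  (α : Measure S) [IsProbabilityMeasure α]

include hΦ h

/-- Integrals with respect to the Gibbs distributions. -/
lemma lintegral_gibbsSpecification (Δ : Finset G) (ω : G → S) {f : (G → S) → ℝ≥0∞}
    (hf : Measurable f) :
    ∫⁻ σ, f σ ∂gibbsSpecification Φ α Δ ω
      = (∫⋯∫⁻_Δ, (fun σ => boltzmann Φ Δ σ * f σ) ∂fun _ => α) ω
        / (∫⋯∫⁻_Δ, boltzmann Φ Δ ∂fun _ => α) ω := by
  have hg : Measurable (glue Δ ω) := measurable_updateFinset
  have : IsProbabilityMeasure ((Measure.pi fun _ : Δ => α).map (glue Δ ω)) :=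
    Measure.isProbabilityMeasure_map hg.aemeasurable
  have hH : BddMeasurable (hamiltonian Φ Δ) :=
    ⟨measurable_hamiltonian hΦ Δ, _, abs_hamiltonian_le h Δ⟩
  have hpos := integral_exp_neg_pos hH ((Measure.pi fun _ : Δ => α).map (glue Δ ω))
  have hZ : ENNReal.ofReal (∫ σ, Real.exp (-hamiltonian Φ Δ σ)
      ∂(Measure.pi fun _ : Δ => α).map (glue Δ ω)) = (∫⋯∫⁻_Δ, boltzmann Φ Δ ∂fun _ => α) ω := by
    rw [ofReal_integral_eq_lintegral_ofReal (hH.exp_neg.integrable _)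
      (.of_forall fun _ => (Real.exp_pos _).le),
      lintegral_map (show Measurable fun σ => ENNReal.ofReal (Real.exp (-hamiltonian Φ Δ σ)) from
        measurable_boltzmann hΦ Δ) hg]
    rfl
  rw [gibbsSpecification, lintegral_tilted]
  simp_rw [ENNReal.ofReal_div_of_pos hpos]
  simp only [hZ, div_eq_mul_inv]
  simp only [mul_right_comm _ (((∫⋯∫⁻_Δ, boltzmann Φ Δ ∂fun _ => α) ω)⁻¹)]
  have hm : Measurable fun σ => ENNReal.ofReal (Real.exp (-hamiltonian Φ Δ σ)) * f σ :=
    (measurable_boltzmann hΦ Δ).mul hf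
  rw [lintegral_mul_const _ hm, lintegral_map hm hg]
  rfl

lemma measurable_gibbsSpecification (Δ : Finset G) : Measurable (gibbsSpecification Φ α Δ) := by
  refine Measure.measurable_of_measurable_coe _ fun s hs => ?_
  have : ∀ ω, gibbsSpecification Φ α Δ ω s
      = (∫⋯∫⁻_Δ, (fun σ => boltzmann Φ Δ σ * s.indicator 1 σ) ∂fun _ => α) ω
        / (∫⋯∫⁻_Δ, boltzmann Φ Δ ∂fun _ => α) ω := fun ω => by
    rw [← lintegral_gibbsSpecification hΦ h α Δ ω (measurable_one.indicator hs),
      lintegral_indicator_one hs]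
  simp only [this]
  exact (((measurable_boltzmann hΦ Δ).mul (measurable_one.indicator hs)).lmarginal _).div
    ((measurable_boltzmann hΦ Δ).lmarginal _)

/-- Integrals of functions of the image configuration with respect to the Gibbs distributions. -/
lemma lintegral_gibbsSpecification_comp [MeasurableSpace S'] {K : Kernel S' S} [IsMarkovKernel K]
    {T : S → S'} (hT : Measurable T) (hK : (α.map T) ⊗ₘ K = α.map (fun s => (T s, s)))
    (Δ : Finset G) (ω : G → S) {F : (G → S') → ℝ≥0∞} (hF : Measurable F) :
    ∫⁻ σ, F (fun i => T (σ i)) ∂gibbsSpecification Φ α Δ ω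
      = (∫⋯∫⁻_Δ, (fun η => constrainedPartition Φ K Δ ω η * F η) ∂fun _ => α.map T)
          (fun i => T (ω i)) / (∫⋯∫⁻_Δ, boltzmann Φ Δ ∂fun _ => α) ω := by
  rw [lintegral_gibbsSpecification hΦ h α Δ ω
      (show Measurable fun σ : G → S => F fun i => T (σ i) from hF.comp (by fun_prop)),
    lmarginal_comp_eq hT hK (measurable_boltzmann hΦ Δ) hF]
  rfl

end GibbsIntegral

end Fuzzy

namespace Fuzzy

open Function ProbabilityTheory

section ImageGibbs

variable {G S S' : Type*} [DecidableEq G] [Countable G] [MeasurableSpace S] [MeasurableSpace S']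
  {Φ : Finset G → (G → S) → ℝ} (hΦ : IsInteraction Φ) (h : tripleNorm Φ < ∞)
  {α : Measure S} [IsProbabilityMeasure α] {K : Kernel S' S} [IsMarkovKernel K]
  {T : S → S'} (hT : Measurable T) (hK : (α.map T) ⊗ₘ K = α.map (fun s => (T s, s)))

include hΦ h hT hK

/-- The DLR equation in a finite volume, as an equation for the image of a Gibbs measure. -/
lemma lintegral_comp_of_isGibbsMeasure {μ : Measure (G → S)}
    (hμ : IsGibbsMeasure (gibbsSpecification Φ α) μ) (Δ : Finset G) {F : (G → S') → ℝ≥0∞}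
    (hF : Measurable F) :
    ∫⁻ σ, F (fun i => T (σ i)) ∂μ
      = ∫⁻ ω, (∫⋯∫⁻_Δ, (fun η => constrainedPartition Φ K Δ ω η * F η) ∂fun _ => α.map T)
          (fun i => T (ω i)) / (∫⋯∫⁻_Δ, boltzmann Φ Δ ∂fun _ => α) ω ∂μ := by
  have hm : Measurable fun σ : G → S => F fun i => T (σ i) := hF.comp (by fun_prop)
  conv_lhs => rw [← hμ.dlr Δ]
  rw [Measure.lintegral_bind (measurable_gibbsSpecification hΦ h α Δ).aemeasurable hm.aemeasurable]
  exact lintegral_congr fun ω => lintegral_gibbsSpecification_comp hΦ h α hT hK Δ ω hF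

/-- Images of Gibbs measures are Gibbs measures for the image specification. -/
lemma isGibbsMeasure_imageSpec (hz : IsPartitionSystem (constrainedPartition Φ K)) (ω₀ : G → S)
    {μ : Measure (G → S)} (hμ : IsGibbsMeasure (gibbsSpecification Φ α) μ) :
    IsGibbsMeasure (imageSpec (constrainedPartition Φ K) (α.map T) ω₀)
      (μ.map fun σ i => T (σ i)) := by
  have := hμ.isProbabilityMeasure
  have : IsProbabilityMeasure (α.map T) := Measure.isProbabilityMeasure_map hT.aemeasurable
  have hτ : Measurable fun (σ : G → S) i => T (σ i) := by fun_prop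
  refine ⟨Measure.isProbabilityMeasure_map hτ.aemeasurable, fun Λ => ?_⟩
  have hp := hz.measurable_limDensity (lam := α.map T) ω₀ Λ
  ext A hA
  have h1A : Measurable (A.indicator (1 : (G → S') → ℝ≥0∞)) := measurable_one.indicator hA
  have hpA : Measurable fun ξ => limDensity (constrainedPartition Φ K) (α.map T) ω₀ Λ ξ
      * A.indicator 1 ξ := hp.mul h1A
  have hΨ : Measurable (∫⋯∫⁻_Λ, (fun ξ => limDensity (constrainedPartition Φ K) (α.map T) ω₀ Λ ξ
      * A.indicator 1 ξ) ∂fun _ => α.map T) := hpA.lmarginal _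
  rw [Measure.bind_apply hA (hz.measurable_imageSpec ω₀ Λ).aemeasurable,
    ← lintegral_indicator_one hA]
  simp only [hz.imageSpec_apply ω₀ Λ _ hA]
  rw [lintegral_map hΨ hτ, lintegral_map h1A hτ]
  refine le_antisymm (le_of_forall_one_lt_pow_mul 1 fun κ hκ => ?_)
    (le_of_forall_one_lt_pow_mul 1 fun κ hκ => ?_)
  all_goals
    obtain ⟨Δ, hΛ, hlim⟩ := hz.exists_limDensity_le (lam := α.map T) ω₀ Λ hκ
    have hl := hlim Δ subset_rfl
    rw [lintegral_comp_of_isGibbsMeasure hΦ h hT hK hμ Δ hΨ,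
      lintegral_comp_of_isGibbsMeasure hΦ h hT hK hμ Δ h1A, pow_one,
      ← lintegral_const_mul' _ _ ENNReal.coe_ne_top]
    refine lintegral_mono fun ω => ?_
    rw [← mul_div_assoc]
    refine ENNReal.div_le_div_right ?_ _
    -- After this move the integrand is (marginal of Z over `Λ`) × `limDensity` × indicator. With
    -- the finite-volume density in place of `limDensity` the first two factors give back Z, so only
    -- a factor `κ` is lost.
    rw [IsPartitionSystem.marginal_mul_marginal_of_subset hΛ (hz.measurable Δ ω) hpA]
    simp only [lmarginal]
    rw [← lintegral_const_mul' _ _ ENNReal.coe_ne_top]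
    refine lintegral_mono fun ξ => ?_
    dsimp only
    generalize updateFinset (fun i => T (ω i)) Δ ξ = η
    have hc := hz.condDensity_mul (lam := α.map T) hΛ ω η
    have hN : ∫⁻ y, constrainedPartition Φ K Δ ω (updateFinset η Λ y)
        ∂Measure.pi (fun _ : Λ => α.map T)
        = (∫⋯∫⁻_Λ, constrainedPartition Φ K Δ ω ∂fun _ => α.map T) η := rfl
    rw [hN, ← hc]
  · calc _ ≤ (∫⋯∫⁻_Λ, constrainedPartition Φ K Δ ω ∂fun _ => α.map T) η
          * (κ * condDensity (constrainedPartition Φ K) (α.map T) Λ Δ ω η * A.indicator 1 η) := by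
          gcongr
          exact (hl ω η).2
      _ = _ := by ring
  · calc _ ≤ κ * limDensity (constrainedPartition Φ K) (α.map T) ω₀ Λ η
          * (∫⋯∫⁻_Λ, constrainedPartition Φ K Δ ω ∂fun _ => α.map T) η * A.indicator 1 η := by
          gcongr
          exact (hl ω η).1
      _ = _ := by ring

end ImageGibbs

/-! ### The interdependence matrix of the image specification. -/

section InterdependenceMatrix

/-- Comparison of normalized integrals of two functions that are uniformly close. -/
lemma setLIntegral_div_le {X : Type*} [MeasurableSpace X] {lam : Measure X}
    [IsProbabilityMeasure lam] {g g' : X → ℝ≥0∞} {e : ℝ≥0∞}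
    (h1 : ∀ x, g x ≤ g' x + e) (h2 : ∀ x, g' x ≤ g x + e) (hg : 1 ≤ ∫⁻ x, g x ∂lam)
    (hgt : ∫⁻ x, g x ∂lam ≠ ∞) (hg' : ∫⁻ x, g' x ∂lam ≠ 0) (hgt' : ∫⁻ x, g' x ∂lam ≠ ∞)
    {A : Set X} (hA : MeasurableSet A) :
    (∫⁻ x in A, g x ∂lam) / ∫⁻ x, g x ∂lam ≤ (∫⁻ x in A, g' x ∂lam) / (∫⁻ x, g' x ∂lam) + e := by
  have key : ∀ {f f' : X → ℝ≥0∞}, (∀ x, f x ≤ f' x + e) → ∀ B : Set X,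
      ∫⁻ x in B, f x ∂lam ≤ (∫⁻ x in B, f' x ∂lam) + e := by
    intro f f' hf B
    calc ∫⁻ x in B, f x ∂lam ≤ ∫⁻ x in B, (f' x + e) ∂lam := lintegral_mono hf
      _ = (∫⁻ x in B, f' x ∂lam) + e * lam B := by
          rw [lintegral_add_right _ measurable_const, setLIntegral_const]
      _ ≤ _ := by
          gcongr
          exact mul_le_of_le_one_right' prob_le_one
  have k1 := key h1 A
  have k2 := key h2 Aᶜ
  rw [ENNReal.div_le_iff (by intro h0; simp [h0] at hg) hgt]
  have hs := lintegral_add_compl g hA (μ := lam)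
  have hs' := lintegral_add_compl g' hA (μ := lam)
  set a := ∫⁻ x in A, g x ∂lam
  set a' := ∫⁻ x in A, g' x ∂lam
  set b := ∫⁻ x in Aᶜ, g x ∂lam
  set b' := ∫⁻ x in Aᶜ, g' x ∂lam
  rw [← hs] at hg ⊢
  rw [← hs'] at hg' hgt' ⊢
  -- Cleared of denominators, the claim compares `a * b'` with `a' * b`. Using closeness on `A` for
  -- one factor and on the complement for the other gives the total error `e * (a' + b')`, with no
  -- extra factor 2; `1 ≤ a + b` then absorbs it.
  rw [add_mul, mul_comm (a' / _), ← mul_div_assoc, ← ENNReal.mul_le_mul_iff_left hg' hgt', add_mul,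
    ENNReal.div_mul_cancel hg' hgt']
  calc a * (a' + b') = a * a' + a * b' := mul_add _ _ _
    _ ≤ a * a' + (a' + e) * b' := by gcongr
    _ = a * a' + a' * b' + e * b' := by ring
    _ ≤ a * a' + a' * (b + e) + e * b' := by gcongr
    _ = (a + b) * a' + e * 1 * (a' + b') := by ring
    _ ≤ (a + b) * a' + e * (a + b) * (a' + b') := by gcongr

lemma tvDist_le_of_le_add {X : Type*} [MeasurableSpace X] {μ ν : Measure X}
    [IsProbabilityMeasure μ] [IsProbabilityMeasure ν] {e : ℝ≥0∞}
    (h1 : ∀ A, MeasurableSet A → μ A ≤ ν A + e) (h2 : ∀ A, MeasurableSet A → ν A ≤ μ A + e) :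
    tvDist μ ν ≤ e := by
  refine iSup₂_le fun A hA => ?_
  have key : ∀ {μ ν : Measure X} [IsProbabilityMeasure μ] [IsProbabilityMeasure ν],
      μ A ≤ ν A + e → ENNReal.ofReal (μ.real A - ν.real A) ≤ e := by
    intro μ ν _ _ h
    rw [ENNReal.ofReal_sub _ measureReal_nonneg, ofReal_measureReal, ofReal_measureReal]
    exact tsub_le_iff_left.mpr h
  rcases abs_cases (μ.real A - ν.real A) with ⟨h, -⟩ | ⟨h, -⟩
  · rw [h]
    exact key (h1 A hA)
  · rw [h, neg_sub]
    exact key (h2 A hA)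

variable {G S S' : Type*} [DecidableEq G] [Countable G]

lemma IsPartitionSystem.map_eval_imageSpec_apply {Ω E : Type*} [MeasurableSpace E]
    {z : Finset G → Ω → (G → E) → ℝ≥0∞} (hz : IsPartitionSystem z) {lam : Measure E}
    [IsProbabilityMeasure lam] (ω₀ : Ω) (i : G) (η : G → E) {A : Set E} (hA : MeasurableSet A) :
    (imageSpec z lam ω₀ {i} η).map (fun σ => σ i) A
      = ∫⁻ ξ in A, limDensity z lam ω₀ {i} (update η i ξ) ∂lam := by
  have hi : Measurable fun σ : G → E => σ i := measurable_pi_apply i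
  rw [Measure.map_apply hi hA, hz.imageSpec_apply ω₀ {i} η (hi hA), lmarginal_singleton,
    ← lintegral_indicator hA]
  refine lintegral_congr fun ξ => ?_
  by_cases hξ : ξ ∈ A <;> simp [Set.indicator, hξ]

variable [MeasurableSpace S'] [MetricSpace S]
  [MeasurableSpace S] {Φ : Finset G → (G → S) → ℝ}
  (hΦ : IsInteraction Φ) (h : tripleNorm Φ < ∞) {L : G → G → ℝ≥0}
  (hL : HasLipschitzVariations Φ L) {ρ : ℝ≥0∞} {c : ℝ≥0∞}
  (hC : ∀ i, ∑' j, cBar Φ ρ L i j ≤ c) (hc : c < 1)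
  {K : Kernel S' S} [IsMarkovKernel K]
  {B : S' → Set S} (hB : ∀ s', ∀ᵐ s ∂K s', s ∈ B s') (hBρ : ∀ s', Metric.ediam (B s') ≤ ρ)
  {lam : Measure S'} [IsProbabilityMeasure lam]

omit [MetricSpace S] in
include hΦ in
/-- Separating the integration over one spin in the constrained partition function. -/
lemma constrainedPartition_update {i : G} {Δ : Finset G} (hi : i ∈ Δ) (ω : G → S) (η : G → S')
    (ξ : S') :
    constrainedPartition Φ K Δ ω (update η i ξ)
      = ∫⁻ s, (∫⋯∫⁻_Δ.erase i, boltzmann Φ Δ ∂fun k => K (η k)) (update ω i s) ∂K ξ := by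
  rw [constrainedPartition, lmarginal_erase _ (measurable_boltzmann hΦ Δ) hi, update_self,
    lmarginal_congr_measure (β' := fun k => K (η k)) fun k hk => by
      rw [update_of_ne (Finset.ne_of_mem_erase hk)]]

include hΦ h hL hC hc hB hBρ

lemma setLIntegral_condDensity_le (hz : IsPartitionSystem (constrainedPartition Φ K)) {i j : G}
    {Δ : Finset G} (hi : i ∈ Δ) (ω : G → S) {η η' : G → S'} (hη : ∀ k, k ≠ j → η k = η' k)
    {A : Set S'} (hA : MeasurableSet A) :
    ∫⁻ ξ in A, condDensity (constrainedPartition Φ K) lam {i} Δ ω (update η i ξ) ∂lam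
      ≤ (∫⁻ ξ in A, condDensity (constrainedPartition Φ K) lam {i} Δ ω (update η' i ξ) ∂lam)
        + ∑' k, siteOsc Φ i k * neumann (cBar Φ ρ L) k j := by
  set V := Δ.erase i with hV
  set Y : (G → S') → (G → S) → ℝ≥0∞ := fun η => ∫⋯∫⁻_V, boltzmann Φ Δ ∂fun k => K (η k) with hY
  have hYm : ∀ η, Measurable fun s => Y η (update ω i s) := fun η =>
    ((measurable_boltzmann hΦ Δ).lmarginal _).comp (measurable_update ω)
  -- The reference spin at `i` is chosen so that its partition function for `η` does not exceed the
  -- mean. Ratios relative to it then have mean at least 1, as required for the comparison of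
  -- normalized integrals.
  obtain ⟨a₀, ha₀⟩ : ∃ a₀, Y η (update ω i a₀) ≤ ∫⁻ s, Y η (update ω i s) ∂lam.bind K :=
    exists_le_lintegral (hYm η).aemeasurable
  rw [Measure.lintegral_bind K.aemeasurable (hYm η).aemeasurable] at ha₀
  set a := update ω i a₀ with ha
  set R : (G → S') → S → ℝ := fun η s => partitionRatio Φ Δ V (fun k => K (η k)) (update ω i s) a
    with hR
  set g : (G → S') → S' → ℝ≥0∞ := fun η ξ => ∫⁻ s, ENNReal.ofReal (R η s) ∂K ξ with hg
  have hY0 : ∀ η, Y η a ≠ 0 := fun η => lmarginal_boltzmann_pos hΦ h Δ V _ a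
  have hYt : ∀ η, Y η a ≠ ∞ := fun η => lmarginal_boltzmann_ne_top hΦ h Δ V _ a
  have hYR : ∀ η s, Y η (update ω i s) = ENNReal.ofReal (R η s) * Y η a := fun η s =>
    lmarginal_boltzmann_eq_ratio_mul hΦ h Δ V _ _ _
  have hzg : ∀ η ξ, constrainedPartition Φ K Δ ω (update η i ξ) = g η ξ * Y η a := by
    intro η ξ
    rw [constrainedPartition_update hΦ hi, ← lintegral_mul_const' _ _ (hYt η)]
    exact lintegral_congr fun s => hYR η s
  have hzint : ∀ η, (∫⋯∫⁻_{i}, constrainedPartition Φ K Δ ω ∂fun _ => lam) η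
      = (∫⁻ ξ, g η ξ ∂lam) * Y η a := by
    intro η
    rw [lmarginal_singleton, ← lintegral_mul_const' _ _ (hYt η)]
    exact lintegral_congr fun ξ => hzg η ξ
  have hi' : {i} ⊆ Δ := Finset.singleton_subset_iff.mpr hi
  have hg0 : ∀ η, ∫⁻ ξ, g η ξ ∂lam ≠ 0 := fun η h0 =>
    hz.marginal_ne_zero (lam := lam) hi' ω η (by rw [hzint, h0, zero_mul])
  have hgt : ∀ η, ∫⁻ ξ, g η ξ ∂lam ≠ ∞ := fun η h0 =>
    hz.marginal_ne_top (lam := lam) hi' ω η (by rw [hzint, h0, ENNReal.top_mul (hY0 η)])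
  have hcond : ∀ η, ∫⁻ ξ in A, condDensity (constrainedPartition Φ K) lam {i} Δ ω (update η i ξ)
      ∂lam = (∫⁻ ξ in A, g η ξ ∂lam) / ∫⁻ ξ, g η ξ ∂lam := by
    intro η
    simp only [div_eq_mul_inv]
    rw [← lintegral_mul_const' _ _ (ENNReal.inv_ne_top.mpr (hg0 η))]
    refine lintegral_congr fun ξ => ?_
    rw [condDensity, hzg, marginal_congr {i} _ (update η i ξ) η fun k hk => by
      rw [update_of_ne (by simpa using hk)], hzint, ← div_eq_mul_inv,
      ENNReal.mul_div_mul_right _ _ (hY0 η) (hYt η)]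
  have hclose : ∀ {η η' : G → S'}, (∀ k, k ≠ j → η k = η' k) → ∀ ξ,
      g η ξ ≤ g η' ξ + ∑' k, siteOsc Φ i k * neumann (cBar Φ ρ L) k j := by
    intro η η' hη ξ
    calc g η ξ ≤ ∫⁻ s, (ENNReal.ofReal (R η' s)
          + ∑' k, siteOsc Φ i k * neumann (cBar Φ ρ L) k j) ∂K ξ := by
          refine lintegral_mono fun s => ?_
          have hsite := ofReal_abs_partitionRatio_sub_le_of_site hΦ h hL hC hc hi
            (Finset.erase_subset i Δ) (Finset.notMem_erase i Δ)
            (β := fun k => K (η k)) (β' := fun k => K (η' k)) (fun k hk => by rw [hη k hk])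
            (B := fun k => B (η k)) (fun k => hB _) (fun k => hBρ _)
            (x := update ω i s) (a := a) (fun k hk => by simp [ha, hk])
          calc ENNReal.ofReal (R η s)
              ≤ ENNReal.ofReal (R η' s + |R η s - R η' s|) :=
                ENNReal.ofReal_le_ofReal (by linarith [le_abs_self (R η s - R η' s)])
            _ ≤ ENNReal.ofReal (R η' s) + ENNReal.ofReal |R η s - R η' s| :=
                ENNReal.ofReal_add_le
            _ ≤ _ := by gcongr
      _ = _ := by
          rw [lintegral_add_right _ measurable_const, lintegral_const, measure_univ, mul_one]
  rw [hcond, hcond]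
  refine setLIntegral_div_le (hclose hη) (hclose fun k hk => (hη k hk).symm) ?_ (hgt η) (hg0 η')
    (hgt η') hA
  have hle : 1 * Y η a ≤ (∫⁻ ξ, g η ξ ∂lam) * Y η a := by
    rw [one_mul, ← lintegral_mul_const' _ _ (hYt η)]
    refine ha₀.trans_eq (lintegral_congr fun ξ => ?_)
    rw [← hzg, constrainedPartition_update hΦ hi]
  exact (ENNReal.mul_le_mul_iff_left (hY0 η) (hYt η)).mp hle

/-- The finite-volume bound does not depend on `Δ`, so it survives the limit; the two passages
between limit and finite-volume density cost `κ ^ 2`. -/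
lemma setLIntegral_limDensity_le (hz : IsPartitionSystem (constrainedPartition Φ K)) (ω₀ : G → S)
    {i j : G} {η η' : G → S'} (hη : ∀ k, k ≠ j → η k = η' k) {A : Set S'} (hA : MeasurableSet A) :
    ∫⁻ ξ in A, limDensity (constrainedPartition Φ K) lam ω₀ {i} (update η i ξ) ∂lam
      ≤ (∫⁻ ξ in A, limDensity (constrainedPartition Φ K) lam ω₀ {i} (update η' i ξ) ∂lam)
        + ∑' k, siteOsc Φ i k * neumann (cBar Φ ρ L) k j := by
  refine le_of_forall_one_lt_pow_mul 2 fun κ hκ => ?_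
  obtain ⟨Δ, hΛ, hlim⟩ := hz.exists_limDensity_le (lam := lam) ω₀ {i} hκ
  have hl := fun η => hlim Δ subset_rfl ω₀ η
  have hfin := setLIntegral_condDensity_le hΦ h hL hC hc hB hBρ (lam := lam) hz
    (Finset.singleton_subset_iff.mp hΛ) ω₀ hη hA
  set E := ∑' k, siteOsc Φ i k * neumann (cBar Φ ρ L) k j
  set p := condDensity (constrainedPartition Φ K) lam {i} Δ ω₀
  set q := limDensity (constrainedPartition Φ K) lam ω₀ {i}
  have h1 : ∫⁻ ξ in A, q (update η i ξ) ∂lam ≤ κ * ∫⁻ ξ in A, p (update η i ξ) ∂lam := by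
    rw [← lintegral_const_mul' _ _ ENNReal.coe_ne_top]
    exact lintegral_mono fun ξ => (hl _).2
  have h2 : ∫⁻ ξ in A, p (update η' i ξ) ∂lam ≤ κ * ∫⁻ ξ in A, q (update η' i ξ) ∂lam := by
    rw [← lintegral_const_mul' _ _ ENNReal.coe_ne_top]
    exact lintegral_mono fun ξ => (hl _).1
  have hκ1 : (1 : ℝ≥0∞) ≤ κ := by exact_mod_cast hκ.le
  calc ∫⁻ ξ in A, q (update η i ξ) ∂lam
      ≤ κ * (κ * (∫⁻ ξ in A, q (update η' i ξ) ∂lam) + κ * E) := by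
        refine h1.trans ?_
        gcongr
        refine hfin.trans ?_
        gcongr
        exact le_mul_of_one_le_left' hκ1
    _ = _ := by ring

/-- The Dobrushin interdependence matrix of the image specification. -/
lemma dobrushinMatrix_imageSpec_le (hz : IsPartitionSystem (constrainedPartition Φ K))
    (ω₀ : G → S) (i j : G) :
    dobrushinMatrix (imageSpec (constrainedPartition Φ K) lam ω₀) i j
      ≤ ∑' k, siteOsc Φ i k * neumann (cBar Φ ρ L) k j := by
  refine iSup_le fun η => iSup_le fun η' => iSup_le fun hη => ?_
  have hprob : ∀ η, IsProbabilityMeasure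
      ((imageSpec (constrainedPartition Φ K) lam ω₀ {i} η).map fun σ => σ i) := fun η => by
    have := hz.isProbabilityMeasure_imageSpec (lam := lam) ω₀ {i} η
    exact Measure.isProbabilityMeasure_map (measurable_pi_apply i).aemeasurable
  have := hprob η
  have := hprob η'
  refine tvDist_le_of_le_add (fun A hA => ?_) fun A hA => ?_
  · rw [hz.map_eval_imageSpec_apply ω₀ i η hA, hz.map_eval_imageSpec_apply ω₀ i η' hA]
    exact setLIntegral_limDensity_le hΦ h hL hC hc hB hBρ hz ω₀ hη hA
  · rw [hz.map_eval_imageSpec_apply ω₀ i η hA, hz.map_eval_imageSpec_apply ω₀ i η' hA]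
    exact setLIntegral_limDensity_le hΦ h hL hC hc hB hBρ hz ω₀ (fun k hk => (hη k hk).symm) hA

omit hΦ hL hC hc hB hBρ [MetricSpace S] [MeasurableSpace S] [Countable G] in
-- The proved bound has the constant 2 and no factor at `j`; enlarging 2 to 4 and inserting a factor
-- ≥ 1 gives `qMatrix`.
lemma tsum_siteOsc_mul_le_qMatrix (C : G → G → ℝ≥0∞) (i j : G) :
    ∑' k, siteOsc Φ i k * neumann C k j ≤ qMatrix Φ C i j := by
  have hm : normSum Φ (Meets {i}) = ∑' A : {A : Finset G // i ∈ A}, supNorm (Φ A) := by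
    have : (Meets {i} : Finset G → Prop) = fun A => i ∈ A := by
      ext A; exact meets_singleton
    rw [this, normSum]
  have hfin : normSum Φ (Meets {i}) ≠ ∞ := (normSum_meets_lt_top h {i}).ne
  have hexp : ENNReal.ofReal (Real.exp (2 * (normSum Φ (Meets {i})).toReal))
      = expE (2 * ∑' A : {A : Finset G // i ∈ A}, supNorm (Φ A)) := by
    rw [← hm, ← expE_ofReal (by positivity), ENNReal.ofReal_mul (by norm_num),
      ENNReal.ofReal_toReal hfin, ENNReal.ofReal_ofNat]
  have hsum : ∑' k, siteOsc Φ i k * neumann C k j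
      = expE (2 * ∑' A : {A : Finset G // i ∈ A}, supNorm (Φ A)) * 2
        * ∑' k : {k : G // k ≠ i}, oscAt (k : G) (pairHamiltonian Φ i k) * neumann C k j := by
    rw [← ENNReal.tsum_mul_left]
    refine Eq.trans ?_ (tsum_subtype {k : G | k ≠ i} fun k =>
      expE (2 * ∑' A : {A : Finset G // i ∈ A}, supNorm (Φ A)) * 2
        * (oscAt k (pairHamiltonian Φ i k) * neumann C k j)).symm
    refine tsum_congr fun k => ?_
    by_cases hk : k = i
    · simp [siteOsc, hk]
    · simp only [siteOsc, hk, if_false, Set.indicator, Set.mem_ofPred_eq, ne_eq, not_false_eq_true,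
        if_true, hexp]
      ring
  rw [hsum, qMatrix]
  generalize expE (2 * ∑' A : {A : Finset G // i ∈ A}, supNorm (Φ A)) = x
  generalize (∑' k : {k : G // k ≠ i}, oscAt (k : G) (pairHamiltonian Φ i k) * neumann C k j) = y
  calc x * 2 * y = 2 * x * y * 1 := by ring
    _ ≤ 4 * x * y * expE (∑' A : {A : Finset G // j ∈ A}, oscAt j (Φ A)) := by
        gcongr
        · norm_num
        · exact one_le_expE _

end InterdependenceMatrix

end Fuzzy

/-! ### Assembly of the theorem. -/

namespace Fuzzy

open ProbabilityTheory

/-- The constrained partition functions form a partition system. -/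
lemma isPartitionSystem_constrainedPartition {G S S' : Type*} [DecidableEq G] [Countable G]
    [MeasurableSpace S'] [MetricSpace S] [MeasurableSpace S] {Φ : Finset G → (G → S) → ℝ}
    (hΦ : IsInteraction Φ) (h : tripleNorm Φ < ∞) {L : G → G → ℝ≥0}
    (hL : HasLipschitzVariations Φ L) {ρ c : ℝ≥0∞}
    (hC : ∀ i, ∑' j, cBar Φ ρ L i j ≤ c) (hc : c < 1)
    {K : Kernel S' S} [IsMarkovKernel K]
    {B : S' → Set S} (hB : ∀ s', ∀ᵐ s ∂K s', s ∈ B s') (hBρ : ∀ s', Metric.ediam (B s') ≤ ρ) :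
    IsPartitionSystem (constrainedPartition Φ K) where
  measurable := measurable_constrainedPartition hΦ
  congr _ _ _ _ hη := constrainedPartition_congr hη
  ne_zero := constrainedPartition_ne_zero hΦ h
  ne_top := constrainedPartition_ne_top hΦ h
  bound Λ := ⟨Real.toNNReal (Real.exp (2 * (normSum Φ (Meets Λ)).toReal)),
    Real.toNNReal_pos.mpr (Real.exp_pos _),
    fun _ hΛ ω _ _ hη => constrainedPartition_le hΦ h hΛ ω hη⟩
  cross Λ _ hκ := exists_constrainedPartition_cross_volume hΦ h hL hC hc hB hBρ Λ hκ

end Fuzzy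

/-- Sufficiently fine local coarse graining preserves the Gibbs property. -/
theorem theorem2p6
    {G : Type*} [Countable G] [DecidableEq G]
    {S : Type*} [MetricSpace S] [MeasurableSpace S] [BorelSpace S] [StandardBorelSpace S]
    {S' : Type*} [MeasurableSpace S'] [StandardBorelSpace S']
    (Φ : Finset G → (G → S) → ℝ) (hΦ : Fuzzy.IsInteraction Φ) (hsum : Fuzzy.tripleNorm Φ < ∞)
    (L : G → G → ℝ≥0) (hL : Fuzzy.HasLipschitzVariations Φ L)
    (T : S → S') (hT : Measurable T)
    (hρ : Fuzzy.fineness T / 2 * (⨆ i, ∑' j, Fuzzy.pairFactor Φ i j * (L i j : ℝ≥0∞)) < 1)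
    (α : Measure S) [IsProbabilityMeasure α] :
    ∃ γ' : Finset G → (G → S') → Measure (G → S'),
      Fuzzy.IsSpecification γ' ∧ Fuzzy.IsQuasilocal γ' ∧
      Fuzzy.IsUniformlyNonnull γ' (α.map T) ∧
      (∀ μ : Measure (G → S), Fuzzy.IsGibbsMeasure (Fuzzy.gibbsSpecification Φ α) μ →
        Fuzzy.IsGibbsMeasure γ' (μ.map (fun σ i => T (σ i)))) ∧
      ∀ i j, Fuzzy.dobrushinMatrix γ' i j
        ≤ Fuzzy.qMatrix Φ (Fuzzy.cBar Φ (Fuzzy.fineness T) L) i j := by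
  have hC : ∀ i, ∑' j, Fuzzy.cBar Φ (Fuzzy.fineness T) L i j
      ≤ Fuzzy.fineness T / 2 * (⨆ i, ∑' j, Fuzzy.pairFactor Φ i j * (L i j : ℝ≥0∞)) := fun i => by
    simp only [Fuzzy.cBar, mul_assoc, ENNReal.tsum_mul_left]
    gcongr
    exact le_iSup (fun i => ∑' j, Fuzzy.pairFactor Φ i j * (L i j : ℝ≥0∞)) i
  obtain ⟨K, _, hK, B, hB, hBρ⟩ := Fuzzy.exists_cell_kernel hT α
  have hz := Fuzzy.isPartitionSystem_constrainedPartition hΦ hsum hL hC hρ hB hBρ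
  have : IsProbabilityMeasure (α.map T) := Measure.isProbabilityMeasure_map hT.aemeasurable
  obtain ⟨a₀⟩ : Nonempty S := nonempty_of_isProbabilityMeasure α
  -- The choice of the boundary condition that defines the limit density is immaterial, since
  -- convergence is uniform in it.
  let ω₀ : G → S := fun _ => a₀
  exact ⟨Fuzzy.imageSpec (Fuzzy.constrainedPartition Φ K) (α.map T) ω₀,
    hz.isSpecification_imageSpec ω₀, hz.isQuasilocal_imageSpec ω₀,
    hz.isUniformlyNonnull_imageSpec ω₀,
    fun μ hμ => Fuzzy.isGibbsMeasure_imageSpec hΦ hsum hT hK hz ω₀ hμ,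
    fun i j => (Fuzzy.dobrushinMatrix_imageSpec_le hΦ hsum hL hC hρ hB hBρ hz ω₀ i j).trans
      (Fuzzy.tsum_siteOsc_mul_le_qMatrix hsum _ i j)⟩
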